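/- Let $K$ be an algebraically closed field of characteristic $0$, let $\alpha\in K\setminus\{0\}$ and let $\beta\in K$ with $\beta^2=\alpha$. Let $\Lambda=\mathcal{D}_4(\alpha,-\alpha)$ be the $K$-algebra generated by $x_{ij}=-x_{ji}$, $1\le i\neq j\le 4$, with relations $x_{ij}^2=\alpha$ ($i,j$ distinct), $x_{ij}x_{kl}=x_{kl}x_{ij}$ ($i,j,k,l$ distinct) and $x_{ij}x_{jk}+x_{jk}x_{ki}+x_{ki}x_{ij}=-\alpha$ ($i,j,k$ distinct). The group $\mathbb{S}_4$ acts on $\Lambda$ by algebra automorphisms, $\sigma(x_{ij})=x_{\sigma(i)\sigma(j)}$. For $\sigma\in\mathbb{S}_4$ let $\rho_\sigma:\Lambda\to K$ be the one-dimensional representation with $\rho_\sigma(x_{ij})=\beta$ if $\sigma(i)<\sigma(j)$ and $\rho_\sigma(x_{ij})=-\beta$ if $\sigma(i)>\sigma(j)$. Put $t_1=(1\,3)$, $t_2=(1\,4)$, $t_3=(2\,4)$ (the non-simple transpositions), and let $Q$ be the quiver with vertex set $\mathbb{S}_4$ and one arrow $\alpha(\sigma;t_i\sigma):\sigma\to t_i\sigma$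 for each $\sigma\in\mathbb{S}_4$ and $i=1,2,3$. Paths are composed from left to right, and modules are right modules. (1) $\Lambda$ is basic (finite-dimensional, with $\Lambda/\mathrm{rad}\,\Lambda$ isomorphic to a product of copies of $K$), the $\rho_\sigma$, $\sigma\in\mathbb{S}_4$, form a complete list of pairwise non-isomorphic simple $\Lambda$-modules, and $Q$ is the ordinary quiver of $\Lambda$: $\dim_K\mathrm{Ext}^1_\Lambda(\rho_\sigma,\rho_\tau)$ is the number of arrows $\sigma\to\tau$ in $Q$, for all $\sigma,\tau$. (2) There is a surjective algebra homomorphism $\phi:KQ\to\Lambda$ with admissible kernel, such that the images $e_\sigma$ of the trivial paths satisfy $\rho_\tau(e_\sigma)=\delta_{\sigma\tau}$, and which is compatible with the action of $\mathbb{S}_4$: $\sigma(e_\tau)=e_{\tau\sigma^{-1}}$ and $\sigma(\phi(\alpha(\tau;t_i\tau)))=\phi(\alpha(\tau\sigma^{-1};t_i\tau\sigma^{-1}))$, such that the following holds. The right ideal $\Gamma=e_e\Lambda$ is an indecomposable projective $\Lambda$-module. It is isomorphic to the nil-Coxeter algebra of $\mathbb{S}_4$, $$N=K\langle s_1,s_2,s_3\rangle/(s_i^2,\;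 s_1s_3-s_3s_1,\; s_1s_2s_1-s_2s_1s_2,\; s_3s_2s_3-s_2s_3s_2),$$ where a path starting at $e$ is identified with the word of the labels $i$ of its arrows $\alpha(\sigma;t_i\sigma)$: there is a $K$-linear bijection $\Psi:N\to\Gamma$ that sends each word $s_{i_1}\cdots s_{i_k}$ to the image under $\phi$ of the path that starts at $e$ and has labels $i_1,\dots,i_k$. Moreover $\Psi$ is an isomorphism of algebras for the product of $\Gamma$ given by concatenation of paths: $\Psi(1)=e_e$ and $$\Psi(yz)=\Psi(y)\cdot\sum_{\sigma\in\mathbb{S}_4}\sigma(\Psi(z))\qquad(y,z\in N).$$ -/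

import Mathlib

universe u v

noncomputable section

/-! ## Deformed Fomin-Kirillov algebras -/

/-- Indices of the generators `x_{ij}`: ordered pairs of distinct elements of `Fin n`. -/
abbrev FKIndex (n : ℕ) : Type := {p : Fin n × Fin n // p.1 ≠ p.2}

/-- The free generator `x_{ij}`, for `i ≠ j`. -/
def fkGen (K : Type u) [CommRing K] {n : ℕ} (i j : Fin n) (h : i ≠ j) :
    FreeAlgebra K (FKIndex n) :=
  FreeAlgebra.ι K ⟨(i, j), h⟩

/-- The defining relations of the deformed Fomin-Kirillov algebra with parameters `a₁`, `a₂`. -/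
inductive DFKRel (n : ℕ) (K : Type u) [CommRing K] (a₁ a₂ : K) :
    FreeAlgebra K (FKIndex n) → FreeAlgebra K (FKIndex n) → Prop
  | antisymm (i j : Fin n) (h : i ≠ j) :
      DFKRel n K a₁ a₂ (fkGen K i j h) (-fkGen K j i h.symm)
  | square (i j : Fin n) (h : i ≠ j) :
      DFKRel n K a₁ a₂ (fkGen K i j h * fkGen K i j h) (algebraMap K _ a₁)
  | commute (i j k l : Fin n) (hij : i ≠ j) (hkl : k ≠ l)
      (hik : i ≠ k) (hil : i ≠ l) (hjk : j ≠ k) (hjl : j ≠ l) :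
      DFKRel n K a₁ a₂ (fkGen K i j hij * fkGen K k l hkl - fkGen K k l hkl * fkGen K i j hij) 0
  | triple (i j k : Fin n) (hij : i ≠ j) (hjk : j ≠ k) (hki : k ≠ i) :
      DFKRel n K a₁ a₂
        (fkGen K i j hij * fkGen K j k hjk + fkGen K j k hjk * fkGen K k i hki
          + fkGen K k i hki * fkGen K i j hij)
        (algebraMap K _ a₂)

/-- The deformed Fomin-Kirillov algebra `𝒟_n(a₁, a₂)` over `K`. -/
abbrev DeformedFK (n : ℕ) (K : Type u) [CommRing K] (a₁ a₂ : K) : Type u :=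
  RingQuot (DFKRel n K a₁ a₂)

namespace DeformedFK

variable {n : ℕ} {K : Type u} [CommRing K]

/-- The generator `x_{ij}` of `𝒟_n(a₁, a₂)`. -/
def x (a₁ a₂ : K) (i j : Fin n) (h : i ≠ j) : DeformedFK n K a₁ a₂ :=
  RingQuot.mkAlgHom K (DFKRel n K a₁ a₂) (fkGen K i j h)

theorem x_antisymm (a₁ a₂ : K) (i j : Fin n) (h : i ≠ j) :
    x a₁ a₂ i j h = -x a₁ a₂ j i h.symm := by
  simpa [x] using RingQuot.mkAlgHom_rel K (DFKRel.antisymm (a₁ := a₁) (a₂ := a₂) i j h)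

theorem x_square (a₁ a₂ : K) (i j : Fin n) (h : i ≠ j) :
    x a₁ a₂ i j h * x a₁ a₂ i j h = algebraMap K _ a₁ := by
  simpa [x] using RingQuot.mkAlgHom_rel K (DFKRel.square (a₁ := a₁) (a₂ := a₂) i j h)

theorem x_commute (a₁ a₂ : K) (i j k l : Fin n) (hij : i ≠ j) (hkl : k ≠ l)
    (hik : i ≠ k) (hil : i ≠ l) (hjk : j ≠ k) (hjl : j ≠ l) :
    x a₁ a₂ i j hij * x a₁ a₂ k l hkl - x a₁ a₂ k l hkl * x a₁ a₂ i j hij = 0 := by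
  simpa [x] using RingQuot.mkAlgHom_rel K
    (DFKRel.commute (a₁ := a₁) (a₂ := a₂) i j k l hij hkl hik hil hjk hjl)

theorem x_triple (a₁ a₂ : K) (i j k : Fin n) (hij : i ≠ j) (hjk : j ≠ k) (hki : k ≠ i) :
    x a₁ a₂ i j hij * x a₁ a₂ j k hjk + x a₁ a₂ j k hjk * x a₁ a₂ k i hki
      + x a₁ a₂ k i hki * x a₁ a₂ i j hij = algebraMap K _ a₂ := by
  simpa [x] using RingQuot.mkAlgHom_rel K
    (DFKRel.triple (a₁ := a₁) (a₂ := a₂) i j k hij hjk hki)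

/-- The action of `σ ∈ 𝕊_n` on `𝒟_n(a₁, a₂)` by algebra endomorphisms,
`x_{ij} ↦ x_{σ(i)σ(j)}`. -/
def act {a₁ a₂ : K} (σ : Equiv.Perm (Fin n)) :
    DeformedFK n K a₁ a₂ →ₐ[K] DeformedFK n K a₁ a₂ :=
  RingQuot.liftAlgHom K
    ⟨FreeAlgebra.lift K fun p => x a₁ a₂ (σ p.1.1) (σ p.1.2) (σ.injective.ne p.2), by
      intro a b hab
      cases hab with
      | antisymm i j h => simpa [fkGen] using x_antisymm a₁ a₂ (σ i) (σ j) _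
      | square i j h => simpa [fkGen] using x_square a₁ a₂ (σ i) (σ j) _
      | commute i j k l hij hkl hik hil hjk hjl =>
        simpa [fkGen] using x_commute a₁ a₂ (σ i) (σ j) (σ k) (σ l)
          (σ.injective.ne hij) (σ.injective.ne hkl) (σ.injective.ne hik) (σ.injective.ne hil)
          (σ.injective.ne hjk) (σ.injective.ne hjl)
      | triple i j k hij hjk hki =>
        simpa [fkGen] using x_triple a₁ a₂ (σ i) (σ j) (σ k)
          (σ.injective.ne hij) (σ.injective.ne hjk) (σ.injective.ne hki)⟩

@[simp] theorem act_x {a₁ a₂ : K} (σ : Equiv.Perm (Fin n)) (i j : Fin n) (h : i ≠ j) :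
    act σ (x a₁ a₂ i j h) = x a₁ a₂ (σ i) (σ j) (σ.injective.ne h) := by
  simp [act, x, fkGen]

/-- The one-dimensional representation `ρ_σ` of `𝒟_n(a, -a)`, for a square root `b` of `a`:
`x_{ij} ↦ b` if `σ(i) < σ(j)`, and `x_{ij} ↦ -b` if `σ(i) > σ(j)`. -/
def rho {a b : K} (hb : b ^ 2 = a) (σ : Equiv.Perm (Fin n)) :
    DeformedFK n K a (-a) →ₐ[K] K :=
  RingQuot.liftAlgHom K
    ⟨FreeAlgebra.lift K fun p => if σ p.1.1 < σ p.1.2 then b else -b, by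
      intro y z hyz
      cases hyz with
      | antisymm i j h =>
        have h' := σ.injective.ne h
        rcases lt_or_gt_of_ne h' with h1 | h1 <;> simp [fkGen, h1, h1.not_gt]
      | square i j h => simp only [fkGen, map_mul, FreeAlgebra.lift_ι_apply, AlgHom.commutes,
          Algebra.algebraMap_self, RingHom.id_apply]; subst hb; split_ifs <;> ring
      | commute i j k l hij hkl hik hil hjk hjl => simp [fkGen, mul_comm]
      | triple i j k hij hjk hki =>
        have h1 := σ.injective.ne hij
        have h2 := σ.injective.ne hjk
        have h3 := σ.injective.ne hki
        simp only [fkGen, map_mul, map_add, FreeAlgebra.lift_ι_apply, AlgHom.commutes,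
          Algebra.algebraMap_self, RingHom.id_apply]
        subst hb
        split_ifs <;> first | ring1 | (exfalso; order)⟩

@[simp] theorem rho_x {a b : K} (hb : b ^ 2 = a) (σ : Equiv.Perm (Fin n))
    (i j : Fin n) (h : i ≠ j) :
    rho hb σ (x a (-a) i j h) = if σ i < σ j then b else -b := by
  simp [rho, x, fkGen]

end DeformedFK

/-! ## Nil-Coxeter algebras of symmetric groups -/

/-- The nil-Coxeter relations for the simple generators `s_i`, `i : Fin m`, of `𝕊_{m+1}`. -/
inductive NilCoxeterRel (m : ℕ) (K : Type u) [CommRing K] :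
    FreeAlgebra K (Fin m) → FreeAlgebra K (Fin m) → Prop
  | square (i : Fin m) : NilCoxeterRel m K (FreeAlgebra.ι K i * FreeAlgebra.ι K i) 0
  | commute (i j : Fin m) (h : (i : ℕ) + 1 < j) :
      NilCoxeterRel m K (FreeAlgebra.ι K i * FreeAlgebra.ι K j)
        (FreeAlgebra.ι K j * FreeAlgebra.ι K i)
  | braid (i j : Fin m) (h : (i : ℕ) + 1 = j) :
      NilCoxeterRel m K (FreeAlgebra.ι K i * FreeAlgebra.ι K j * FreeAlgebra.ι K i)
        (FreeAlgebra.ι K j * FreeAlgebra.ι K i * FreeAlgebra.ι K j)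

/-- The nil-Coxeter algebra of `𝕊_{m+1}` over `K`. -/
abbrev NilCoxeter (m : ℕ) (K : Type u) [CommRing K] : Type u := RingQuot (NilCoxeterRel m K)

/-- The generator `s_i` of the nil-Coxeter algebra. -/
def NilCoxeter.s {m : ℕ} (K : Type u) [CommRing K] (i : Fin m) : NilCoxeter m K :=
  RingQuot.mkAlgHom K (NilCoxeterRel m K) (FreeAlgebra.ι K i)

/-! ## Path algebras -/

/-- The paths of a quiver, with arbitrary source and target. -/
abbrev AnyPath (V : Type v) [Quiver.{v} V] : Type v := Σ a b : V, Quiver.Path a b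

/-- The path algebra `K V` of a quiver: the `K`-vector space on the set of all paths. -/
def PathAlgebra (K : Type u) (V : Type v) [CommRing K] [Quiver.{v} V] : Type (max u v) :=
  AnyPath V →₀ K

namespace PathAlgebra

variable (K : Type u) {V : Type v} [CommRing K] [Quiver.{v} V]

instance : AddCommGroup (PathAlgebra K V) := inferInstanceAs (AddCommGroup (AnyPath V →₀ K))
instance : Module K (PathAlgebra K V) := inferInstanceAs (Module K (AnyPath V →₀ K))

/-- The basis element of the path algebra given by a path. -/
def of (p : AnyPath V) : PathAlgebra K V := Finsupp.single p 1

/-- The trivial path at a vertex. -/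
def vertex (a : V) : PathAlgebra K V := of K ⟨a, a, Quiver.Path.nil⟩

/-- The path of length one given by an arrow. -/
def arrow {a b : V} (f : a ⟶ b) : PathAlgebra K V := of K ⟨a, b, f.toPath⟩

open scoped Classical in
/-- Product of two paths: first `p`, then `q`, if `p` ends where `q` starts; zero otherwise. -/
def pathMul : AnyPath V → AnyPath V → PathAlgebra K V
  | ⟨a, b, p⟩, ⟨c, d, q⟩ =>
    if h : b = c then of K ⟨a, d, Quiver.Path.comp p (Quiver.Path.cast h.symm rfl q)⟩ else 0

/-- The bilinear extension of the product of paths. -/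
def mulLin : PathAlgebra K V →ₗ[K] PathAlgebra K V →ₗ[K] PathAlgebra K V :=
  Finsupp.linearCombination K fun p => Finsupp.linearCombination K (pathMul K p)

instance : Mul (PathAlgebra K V) := ⟨fun x y => mulLin K x y⟩

theorem of_mul_of (p q : AnyPath V) : of K p * of K q = pathMul K p q := by
  change mulLin K (of K p) (of K q) = _
  unfold mulLin of
  erw [Finsupp.linearCombination_single, one_smul, Finsupp.linearCombination_single, one_smul]

theorem of_mul_of_comp {a b c : V} (p : Quiver.Path a b) (q : Quiver.Path b c) :
    of K ⟨a, b, p⟩ * of K ⟨b, c, q⟩ = of K ⟨a, c, p.comp q⟩ := by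
  simp [of_mul_of, pathMul]

theorem of_mul_of_ne {a b c d : V} (p : Quiver.Path a b) (q : Quiver.Path c d) (h : b ≠ c) :
    of K ⟨a, b, p⟩ * of K ⟨c, d, q⟩ = 0 := by
  simp [of_mul_of, pathMul, h]

variable {K} in
theorem hom_ext {M : Type*} [AddCommGroup M] [Module K M] {f g : PathAlgebra K V →ₗ[K] M}
    (h : ∀ p, f (of K p) = g (of K p)) : f = g :=
  Finsupp.lhom_ext' fun p => LinearMap.ext_ring (h p)

theorem mulLin_of_of_assoc (p q r : AnyPath V) :
    mulLin K (mulLin K (of K p) (of K q)) (of K r)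
      = mulLin K (of K p) (mulLin K (of K q) (of K r)) := by
  change of K p * of K q * of K r = of K p * (of K q * of K r)
  have hz : ∀ x : PathAlgebra K V, 0 * x = 0 := fun x => by
    change mulLin K 0 x = 0
    simp
  have hz' : ∀ x : PathAlgebra K V, x * 0 = 0 := fun x => by
    change mulLin K x 0 = 0
    simp
  obtain ⟨a, b, p⟩ := p
  obtain ⟨c, d, q⟩ := q
  obtain ⟨e, f, r⟩ := r
  by_cases h1 : b = c
  · subst h1
    by_cases h2 : d = e
    · subst h2
      simp only [of_mul_of_comp, Quiver.Path.comp_assoc]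
    · rw [of_mul_of_comp, of_mul_of_ne K _ _ h2, of_mul_of_ne K _ _ h2, hz']
  · rw [of_mul_of_ne K _ _ h1, hz]
    by_cases h2 : d = e
    · subst h2
      rw [of_mul_of_comp, of_mul_of_ne K _ _ h1]
    · rw [of_mul_of_ne K _ _ h2, hz']

theorem mulLin_assoc (x y z : PathAlgebra K V) :
    mulLin K (mulLin K x y) z = mulLin K x (mulLin K y z) := by
  refine DFunLike.congr_fun (f := (mulLin K).flip z ∘ₗ (mulLin K).flip y)
    (g := (mulLin K).flip (mulLin K y z)) (hom_ext fun p => ?_) x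
  refine DFunLike.congr_fun (f := (mulLin K).flip z ∘ₗ mulLin K (of K p))
    (g := mulLin K (of K p) ∘ₗ (mulLin K).flip z) (hom_ext fun q => ?_) y
  refine DFunLike.congr_fun (f := mulLin K (mulLin K (of K p) (of K q)))
    (g := mulLin K (of K p) ∘ₗ mulLin K (of K q)) (hom_ext fun r => ?_) z
  exact mulLin_of_of_assoc K p q r

variable (V) in
/-- The span of all paths of length at least `m`, that is, the `m`-th power of the arrow ideal. -/
def arrowPower (m : ℕ) : Submodule K (PathAlgebra K V) :=
  Submodule.span K {x | ∃ p : AnyPath V, m ≤ p.2.2.length ∧ x = of K p}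

variable [Fintype V]

instance : One (PathAlgebra K V) := ⟨∑ a : V, vertex K a⟩

theorem one_def : (1 : PathAlgebra K V) = ∑ a : V, vertex K a := rfl

theorem mulLin_one_left (x : PathAlgebra K V) : mulLin K 1 x = x := by
  classical
  refine DFunLike.congr_fun (g := LinearMap.id) (hom_ext fun p => ?_) x
  obtain ⟨a, b, p⟩ := p
  rw [one_def, map_sum, LinearMap.sum_apply, Finset.sum_eq_single a]
  · exact (of_mul_of_comp K Quiver.Path.nil p).trans (by simp)
  · intro c _ hc
    exact of_mul_of_ne K Quiver.Path.nil p hc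
  · simp

theorem mulLin_one_right (x : PathAlgebra K V) : mulLin K x 1 = x := by
  classical
  refine DFunLike.congr_fun (f := (mulLin K).flip 1) (g := LinearMap.id) (hom_ext fun p => ?_) x
  obtain ⟨a, b, p⟩ := p
  rw [LinearMap.flip_apply, one_def, map_sum, Finset.sum_eq_single b]
  · exact (of_mul_of_comp K p Quiver.Path.nil).trans (by simp)
  · intro c _ hc
    exact of_mul_of_ne K p Quiver.Path.nil hc.symm
  · simp

instance : Ring (PathAlgebra K V) where
  __ := (inferInstance : AddCommGroup (PathAlgebra K V))
  mul := (· * ·)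
  one := 1
  left_distrib x y z := map_add (mulLin K x) y z
  right_distrib x y z := LinearMap.map_add₂ (mulLin K) x y z
  zero_mul x := LinearMap.map_zero₂ (mulLin K) x
  mul_zero x := map_zero (mulLin K x)
  mul_assoc := mulLin_assoc K
  one_mul := mulLin_one_left K
  mul_one := mulLin_one_right K

instance : Algebra K (PathAlgebra K V) :=
  Algebra.ofModule (fun r x y => LinearMap.map_smul₂ (mulLin K) r x y)
    (fun r x y => map_smul (mulLin K x) r y)

end PathAlgebra

/-! ## Basic algebras, simple modules, extensions, quivers -/

/-- A finite-dimensional algebra is basic if its quotient by the Jacobson radical is a product of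
copies of the base field. -/
def IsBasicAlgebra (K : Type u) (A : Type v) [Field K] [Ring A] [Algebra K A] : Prop :=
  Module.Finite K A ∧ ∃ m : ℕ, Nonempty ((A ⧸ Ring.jacobson A) ≃ₐ[K] (Fin m → K))

section Representations

variable {K : Type u} {A : Type u} [Field K] [Ring A] [Algebra K A]

/-- The one-dimensional representations `S v` are pairwise non-isomorphic and every simple right
`A`-module is isomorphic to one of them. -/
def IsCompleteSystemOfSimples {V : Type v} (S : V → (A →ₐ[K] K)) : Prop :=
  Function.Injective S ∧
    ∀ (M : Type u) [AddCommGroup M] [Module Aᵐᵒᵖ M] [IsSimpleModule Aᵐᵒᵖ M],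
      ∃ v : V, ∃ f : M ≃+ K, ∀ (a : A) (m : M), f (MulOpposite.op a • m) = f m * S v a

/-- The 1-cocycles with values in `Hom_K(r, r') = K`, for one-dimensional representations
`r` and `r'`. -/
def extCocycles (r r' : A →ₐ[K] K) : Submodule K (A →ₗ[K] K) where
  carrier := {f | ∀ x y, f (x * y) = r x * f y + f x * r' y}
  add_mem' {f g} hf hg x y := by
    simp only [LinearMap.add_apply, hf x y, hg x y]
    ring
  zero_mem' x y := by simp
  smul_mem' c f hf x y := by
    simp only [LinearMap.smul_apply, hf x y, smul_eq_mul]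
    ring

/-- The 1-coboundaries `x ↦ r(x) h - h r'(x)`, for `h ∈ Hom_K(r, r') = K`. -/
def extCoboundaries (r r' : A →ₐ[K] K) : Submodule K (A →ₗ[K] K) :=
  Submodule.span K {r.toLinearMap - r'.toLinearMap}

theorem extCoboundaries_le (r r' : A →ₐ[K] K) : extCoboundaries r r' ≤ extCocycles r r' := by
  rw [extCoboundaries, Submodule.span_singleton_le_iff_mem]
  intro x y
  simp only [LinearMap.sub_apply, AlgHom.toLinearMap_apply, map_mul]
  ring

/-- The space of extensions `Ext¹(r, r')` of one-dimensional representations: cocycles modulo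
coboundaries, as the image of the cocycles in the quotient of `A →ₗ[K] K` by the coboundaries. -/
def Ext1 (r r' : A →ₐ[K] K) : Submodule K ((A →ₗ[K] K) ⧸ extCoboundaries r r') :=
  (extCocycles r r').map (extCoboundaries r r').mkQ

/-- The quiver `V` is the ordinary quiver of the basic algebra `A`, where the vertex `v`
corresponds to the simple module `S v`: the number of arrows from `v` to `w` is the dimension of
`Ext¹(S v, S w)`. -/
def IsOrdinaryQuiver {V : Type v} [Quiver.{v} V] (S : V → (A →ₐ[K] K)) : Prop :=
  IsBasicAlgebra K A ∧ IsCompleteSystemOfSimples S ∧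
    ∀ v w : V, Finite (v ⟶ w) ∧ Module.Finite K (Ext1 (S v) (S w)) ∧
      Module.finrank K (Ext1 (S v) (S w)) = Nat.card (v ⟶ w)

/-- `φ` presents `A` as the quotient of the path algebra of the quiver `V` by an admissible ideal
(one that contains a power of the arrow ideal and is contained in its square), in such a way that
the trivial path at `v` goes to an idempotent belonging to the simple module `S v`. -/
structure IsGabrielPresentation {V : Type v} [Quiver.{v} V] [Fintype V]
    (S : V → (A →ₐ[K] K)) (φ : PathAlgebra K V →ₐ[K] A) : Prop where
  surjective : Function.Surjective φ
  admissible_lower : ∃ m : ℕ, 2 ≤ m ∧ ∀ x ∈ PathAlgebra.arrowPower K V m, φ x = 0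
  admissible_upper : ∀ x, φ x = 0 → x ∈ PathAlgebra.arrowPower K V 2
  simple_self : ∀ v, S v (φ (PathAlgebra.vertex K v)) = 1
  simple_ne : ∀ v w, v ≠ w → S w (φ (PathAlgebra.vertex K v)) = 0

end Representations

/-- A module is indecomposable if it is nonzero and not the direct sum of two nonzero
submodules. -/
def IsIndecomposableModule (R : Type u) (M : Type v) [Ring R] [AddCommGroup M] [Module R M] :
    Prop :=
  Nontrivial M ∧ ∀ p q : Submodule R M, IsCompl p q → p = ⊥ ∨ q = ⊥

/-! ## The quiver on `𝕊₄` given by the non-simple transpositions -/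

/-- The vertices of the quiver: the elements of `𝕊₄`. The letters `1, 2, 3, 4` are `0, 1, 2, 3` in
`Fin 4`. -/
def S4Quiver : Type := Equiv.Perm (Fin 4)

namespace S4Quiver

instance : Group S4Quiver := inferInstanceAs (Group (Equiv.Perm (Fin 4)))
instance : Fintype S4Quiver := inferInstanceAs (Fintype (Equiv.Perm (Fin 4)))

/-- The permutation underlying a vertex. -/
def perm (σ : S4Quiver) : Equiv.Perm (Fin 4) := σ

/-- The non-simple transpositions `t₁ = (1 3)`, `t₂ = (1 4)`, `t₃ = (2 4)`. -/
def t : Fin 3 → S4Quiver := ![Equiv.swap (0 : Fin 4) 2, Equiv.swap (0 : Fin 4) 3,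
  Equiv.swap (1 : Fin 4) 3]

/-- There is an arrow `σ ⟶ t_i σ` for each vertex `σ` and each `i`, and there are no others. -/
instance : Quiver.{0} S4Quiver := ⟨fun σ τ => {i : Fin 3 // t i * σ = τ}⟩

/-- The arrow `σ ⟶ t_i σ`. -/
def edge (σ : S4Quiver) (i : Fin 3) : σ ⟶ t i * σ := ⟨i, rfl⟩

/-- The path that starts at `σ` and follows the arrows with the labels in the given word. -/
def wordPath : (σ : S4Quiver) → List (Fin 3) → Σ τ : S4Quiver, Quiver.Path σ τ
  | σ, [] => ⟨σ, Quiver.Path.nil⟩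
  | σ, i :: l => ⟨(wordPath (t i * σ) l).1, (edge σ i).toPath.comp (wordPath (t i * σ) l).2⟩

end S4Quiver

end

noncomputable section

/-! ## Closure of subspaces under multiplication by generators -/

section Closure

variable {K : Type*} {A : Type*} [Field K] [Ring A] [Algebra K A]

/-! Put y_ij = (1 + x_ij/β)/2. In terms of these elements the relations of Λ say that y_ij is
idempotent, y_ij + y_ji = 1, y_ij and y_kl commute for disjoint indices, and y_ij y_jk = y_jk y_ik +
y_ik y_ij - y_ik. Everything is read off from an isomorphism of Λ with an explicit algebra B =
`GeoMatrix K S4Quiver` of dimension 24² = 576. It has a basis E(σ,τ), σ, τ ∈ 𝕊₄, with E(σ,τ)E(τ,υ) =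
E(σ,υ) if d(σ,τ) + d(τ,υ) = d(σ,υ), and all other products of basis elements zero. Here d is the
distance in the graph with edges σ, t_i σ. The t_i are the adjacent transpositions for the order 3 <
1 < 4 < 2 of the letters, so d(1,σ) is the Coxeter length of σ for that order.

The isomorphism rests on two bounds. From above, all y_ij with i < j can be sorted: Λ is the product
of the subalgebra generated by y_12, y_13, y_14, spanned by 48 words, and the one generated by y_23,
y_24, y_34, spanned by 12 words, so dim Λ ≤ 576 (`FKIdempotents.finite_and_finrank_le`). From below,
a homomorphism Λ → B is given by a finite table for the row of y_ij at the identity, continued to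
the other rows by 𝕊₄-equivariance; the relations are a finite check on that row (`rowMul_self`,
`rowMul_comm`, `rowMul_triple`). It is onto by a leading term argument for the filtration of B by
distance: the image contains every E(σ,τ) with d(σ,τ) ≤ 1 up to terms at larger distance
(`eq_top_of_idemMatrix_mem`). Hence it is bijective (`toGeoMatrix_bijective`), and ρ_σ becomes the
diagonal entry at σ.

In B the radical consists of the matrices with zero diagonal, the diagonal entries are the simple
modules, and Ext¹ between σ and τ is one-dimensional if d(σ,τ) = 1 and zero otherwise. The map φ
sends a geodesic path from σ to τ to E(σ,τ) and every other path to zero, so its kernel is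
admissible. Finally 𝕊₄ acts on B by translating both indices. The nil-Coxeter algebra N maps into
the translation invariant matrices, s_i going to the sum of all E(σ, t_i σ). Passing to the row at
the identity identifies N with e_e Λ, since dim N ≤ 24 and words reach every E(1,τ). An invariant
matrix is the sum of the translates of its row at the identity, which is the product formula for Ψ.
-/

theorem mul_mem_of_mem_adjoin {s : Set A} {S : Submodule K A}
    (hs : ∀ x ∈ S, ∀ g ∈ s, x * g ∈ S) {x y : A} (hx : x ∈ S) (hy : y ∈ Algebra.adjoin K s) :
    x * y ∈ S := by
  induction hy using Algebra.adjoin_induction generalizing x with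
  | mem g hg => exact hs x hx g hg
  | algebraMap r => rw [← Algebra.commutes, ← Algebra.smul_def]; exact S.smul_mem r hx
  | add y z _ _ hy hz => rw [mul_add]; exact S.add_mem (hy hx) (hz hx)
  | mul y z _ _ hy hz => rw [← mul_assoc]; exact hz (hy hx)

theorem mem_of_mem_adjoin {s : Set A} {S : Submodule K A} (h1 : (1 : A) ∈ S)
    (hs : ∀ x ∈ S, ∀ g ∈ s, x * g ∈ S) {y : A} (hy : y ∈ Algebra.adjoin K s) : y ∈ S := by
  simpa using mul_mem_of_mem_adjoin hs h1 hy

/-- Compute `p * a * a` in two ways: it equals `p * a`, and moving `p` past both letters `a`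
produces `a * b * a + b * a * b`. The terms with `p` cancel. -/
theorem braid_of_straightening {a b p : A} (haa : a * a = a) (hbb : b * b = b)
    (hpa : p * a = a * b + b * p - b) : a * b * a + b * a * b = a * b + b * a := by
  linear_combination (norm := noncomm_ring)
    -(hpa * a) + p * haa - b * hpa - hbb * p + hbb + hpa

/-- Multiply `hac` by `p` on the left and move `p` to the right through every word. The terms that
still contain `p` cancel by `hbc`, and a rule for `c * a * b * c` remains. -/
theorem cyclic_of_straightening {a b c p : A} (hac : a * c * a + c * a * c = a * c + c * a)
    (hbc : b * c * b + c * b * c = b * c + c * b) (hpa : p * a = a * b + b * p - b)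
    (hpc : p * c = c * p) :
    c * a * b * c = a * b * c + b * c * a + c * a * b - a * b * c * a - b * c * a * b := by
  linear_combination (norm := noncomm_ring) p * hac - hpa * c * a - b * hpc * a - b * c * hpa
    - hpc * a * c - c * hpa * c - c * b * hpc + hpa * c + b * hpc + hpc * a + c * hpa
    - hbc * p + hbc

/-- The span of the words in two idempotents satisfying the braid relation. -/
theorem mem_span_of_mem_adjoin_pair {a b : A} (haa : a * a = a) (hbb : b * b = b)
    (hab : a * b * a + b * a * b = a * b + b * a) {y : A} (hy : y ∈ Algebra.adjoin K {a, b}) :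
    y ∈ Submodule.span K {1, a, b, a * b, b * a, a * b * a} := by
  have hm : ∀ z ∈ ({1, a, b, a * b, b * a, a * b * a} : Set A),
      z ∈ Submodule.span K {1, a, b, a * b, b * a, a * b * a} := fun z hz =>
    Submodule.subset_span hz
  simp only [Set.mem_insert_iff, Set.mem_singleton_iff, forall_eq_or_imp, forall_eq] at hm
  obtain ⟨h1, h2, h3, h4, h5, h6⟩ := hm
  refine mem_of_mem_adjoin h1 (fun x hx g hg => ?_) hy
  have hbab : b * a * b = a * b + b * a - a * b * a := by rw [← hab]; abel
  have haba : a * b * a * b = a * b := by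
    rw [mul_assoc a, mul_assoc a, hbab, mul_sub, mul_add]
    simp only [← mul_assoc, haa]; abel
  induction hx using Submodule.span_induction with
  | zero => simp
  | add x y _ _ hx hy => rw [add_mul]; exact Submodule.add_mem _ hx hy
  | smul k x _ hx => rw [smul_mul_assoc]; exact Submodule.smul_mem _ k hx
  | mem x hx =>
    simp only [Set.mem_insert_iff, Set.mem_singleton_iff] at hx hg
    rcases hg with rfl | rfl
    · rcases hx with rfl | rfl | rfl | rfl | rfl | rfl
      · simpa using h2
      · simpa [haa] using h2
      · exact h5
      · exact h6
      · simpa [mul_assoc, haa] using h5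
      · simpa [mul_assoc, haa] using h6
    · rcases hx with rfl | rfl | rfl | rfl | rfl | rfl
      · simpa using h3
      · exact h4
      · simpa [hbb] using h3
      · simpa [mul_assoc, hbb] using h4
      · rw [hbab]; exact Submodule.sub_mem _ (Submodule.add_mem _ h4 h5) h6
      · rw [haba]; exact h4

end Closure

/-- The defining relations of `𝒟₄(α, -α)`, in terms of the idempotents
`a = y₁₂`, `b = y₁₃`, `c = y₁₄`, `p = y₂₃`, `q = y₂₄`, `r = y₃₄`. -/
structure FKIdempotents {A : Type*} [Ring A] (a b c p q r : A) : Prop where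
  aa : a * a = a
  bb : b * b = b
  cc : c * c = c
  pp : p * p = p
  qq : q * q = q
  rr : r * r = r
  pa : p * a = a * b + b * p - b
  pb : p * b = b + a * p - b * a
  pc : p * c = c * p
  qa : q * a = a * c + c * q - c
  qb : q * b = b * q
  qc : q * c = c + a * q - c * a
  ra : r * a = a * r
  rb : r * b = b * c + c * r - c
  rc : r * c = c + b * r - c * b
  rp : r * p = p * q + q * r - q
  rq : r * q = q + p * r - q * p

/-! ### Rewriting rules implied by the idempotent relations -/

namespace FKIdempotents

variable {K : Type*} {A : Type*} [Field K] [Ring A] [Algebra K A] {a b c p q r : A}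
  (h : FKIdempotents a b c p q r)

include h

theorem braid_ab : a * b * a + b * a * b = a * b + b * a :=
  braid_of_straightening h.aa h.bb h.pa

theorem braid_ac : a * c * a + c * a * c = a * c + c * a :=
  braid_of_straightening h.aa h.cc h.qa

theorem braid_bc : b * c * b + c * b * c = b * c + c * b :=
  braid_of_straightening h.bb h.cc h.rb

theorem braid_pq : p * q * p + q * p * q = p * q + q * p :=
  braid_of_straightening h.pp h.qq h.rp

theorem cabc : c * a * b * c =
    a * b * c + b * c * a + c * a * b - a * b * c * a - b * c * a * b :=
  cyclic_of_straightening h.braid_ac h.braid_bc h.pa h.pc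

theorem cbac : c * b * a * c =
    b * a * c + a * c * b + c * b * a - b * a * c * b - a * c * b * a := by
  -- Exchanging the indices 2 and 3 swaps `a` and `b` and turns `p = y₂₃` into `y₃₂ = 1 - p`.
  refine cyclic_of_straightening (p := 1 - p) h.braid_bc h.braid_ac ?_ ?_
  · rw [sub_mul, h.pb]; noncomm_ring
  · rw [sub_mul, mul_sub, h.pc]; simp

theorem cac : c * a * c = a * c + c * a - a * c * a := by rw [← h.braid_ac]; abel

theorem cbc : c * b * c = b * c + c * b - b * c * b := by rw [← h.braid_bc]; abel

/-- The word `c * a * b * c * a * c` is reduced in two ways, by `cac` at its end and by `cabc` at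
its beginning. -/
theorem cabaca : c * a * b * a * c * a =
    c * a * b * c * a - b * (c * a * c) + b * (c * a * b * a * c) := by
  have h1 := h.cabc
  have h2 := h.cac
  have h3 := h.aa
  linear_combination (norm := noncomm_ring) c * a * b * h2 - h1 * a * c
    + a * b * c * h3 * c - b * c * h3 * c

theorem cbabcb : c * b * a * b * c * b =
    c * b * a * c * b - a * (c * b * c) + a * (c * b * a * b * c) := by
  have h1 := h.cbac
  have h2 := h.cbc
  have h3 := h.bb
  linear_combination (norm := noncomm_ring) c * b * a * h2 - h1 * b * c
    + b * a * c * h3 * c - a * c * h3 * c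

end FKIdempotents

end

/-! ### The upper bound 576 for the dimension -/

noncomputable section

open scoped Pointwise

namespace FKIdempotents

variable {A : Type*} [Ring A] {a b c p q r : A}

/-- The products of words in `a`, `b` and `c` that span the subalgebra generated by `a, b, c`. -/
inductive IsLeftWord (K : Type*) [Field K] [Algebra K A] (a b c : A) : A → Prop
  | base {u : A} (hu : u ∈ Algebra.adjoin K {a, b}) : IsLeftWord K a b c u
  | once {u v : A} (hu : u ∈ Algebra.adjoin K {a, b}) (hv : v ∈ Algebra.adjoin K {a, b}) :
      IsLeftWord K a b c (u * c * v)
  | twice {u : A} (hu : u ∈ Algebra.adjoin K {a, b}) :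
      IsLeftWord K a b c (u * (c * a * b * a * c))

/-- The span of the left words. -/
def leftSpan (K : Type*) [Field K] [Algebra K A] (a b c : A) : Submodule K A :=
  Submodule.span K {x | IsLeftWord K a b c x}

section

variable {K : Type*} [Field K] [Algebra K A]

theorem base_mem {u : A} (hu : u ∈ Algebra.adjoin K {a, b}) : u ∈ leftSpan K a b c :=
  Submodule.subset_span (.base hu)

theorem once_mem {u v : A} (hu : u ∈ Algebra.adjoin K {a, b})
    (hv : v ∈ Algebra.adjoin K {a, b}) : u * c * v ∈ leftSpan K a b c :=
  Submodule.subset_span (.once hu hv)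

theorem twice_mem {u : A} (hu : u ∈ Algebra.adjoin K {a, b}) :
    u * (c * a * b * a * c) ∈ leftSpan K a b c :=
  Submodule.subset_span (.twice hu)

theorem left_mul_mem {u x : A} (hu : u ∈ Algebra.adjoin K {a, b}) (hx : x ∈ leftSpan K a b c) :
    u * x ∈ leftSpan K a b c := by
  induction hx using Submodule.span_induction with
  | zero => simp
  | add x y _ _ hx hy => rw [mul_add]; exact Submodule.add_mem _ hx hy
  | smul k x _ hx => rw [mul_smul_comm]; exact Submodule.smul_mem _ k hx
  | mem x hx =>
    cases hx with
    | base hv => exact base_mem (mul_mem hu hv)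
    | once hv hw => rw [← mul_assoc, ← mul_assoc]; exact once_mem (mul_mem hu hv) hw
    | twice hv => rw [← mul_assoc]; exact twice_mem (mul_mem hu hv)

variable (h : FKIdempotents a b c p q r)

include h

/-- Of the six words in `a` and `b` between two letters `c`, all but `a * b * a` allow one `c` to be
removed. The exception accounts for the third kind of left word. -/
theorem c_mul_mul_c_mem {v : A} (hv : v ∈ Algebra.adjoin K {a, b}) :
    c * v * c ∈ leftSpan K a b c := by
  have ha : a ∈ Algebra.adjoin K {a, b} := Algebra.subset_adjoin (by simp)
  have hb : b ∈ Algebra.adjoin K {a, b} := Algebra.subset_adjoin (by simp)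
  have h1 := one_mem (Algebra.adjoin K {a, b})
  replace hv := mem_span_of_mem_adjoin_pair (K := K) h.aa h.bb h.braid_ab hv
  induction hv using Submodule.span_induction with
  | zero => simp
  | add x y _ _ hx hy => rw [mul_add, add_mul]; exact Submodule.add_mem _ hx hy
  | smul k x _ hx =>
    rw [mul_smul_comm, smul_mul_assoc]; exact Submodule.smul_mem _ k hx
  | mem x hx =>
    simp only [Set.mem_insert_iff, Set.mem_singleton_iff] at hx
    rcases hx with rfl | rfl | rfl | rfl | rfl | rfl
    · rw [mul_one, h.cc]
      simpa using once_mem (c := c) h1 h1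
    · have e : c * x * c = x * c * 1 + 1 * c * x - x * c * x := by rw [h.cac]; noncomm_ring
      rw [e]
      exact sub_mem (add_mem (once_mem ha h1) (once_mem h1 ha)) (once_mem ha ha)
    · have e : c * x * c = x * c * 1 + 1 * c * x - x * c * x := by rw [h.cbc]; noncomm_ring
      rw [e]
      exact sub_mem (add_mem (once_mem hb h1) (once_mem h1 hb)) (once_mem hb hb)
    · have e : c * (a * b) * c = (a * b) * c * 1 + b * c * a + 1 * c * (a * b)
          - (a * b) * c * a - b * c * (a * b) := by
        rw [← mul_assoc c, h.cabc]; noncomm_ring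
      rw [e]
      exact sub_mem (sub_mem (add_mem (add_mem (once_mem (mul_mem ha hb) h1) (once_mem hb ha))
        (once_mem h1 (mul_mem ha hb))) (once_mem (mul_mem ha hb) ha)) (once_mem hb (mul_mem ha hb))
    · have e : c * (b * a) * c = (b * a) * c * 1 + a * c * b + 1 * c * (b * a)
          - (b * a) * c * b - a * c * (b * a) := by
        rw [← mul_assoc c, h.cbac]; noncomm_ring
      rw [e]
      exact sub_mem (sub_mem (add_mem (add_mem (once_mem (mul_mem hb ha) h1) (once_mem ha hb))
        (once_mem h1 (mul_mem hb ha))) (once_mem (mul_mem hb ha) hb)) (once_mem ha (mul_mem hb ha))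
    · have e : c * (a * b * a) * c = 1 * (c * a * b * a * c) := by noncomm_ring
      rw [e]
      exact twice_mem h1

theorem c_mul_mul_c_mul_mem {v w : A} (hv : v ∈ ({a, b, a * b, b * a} : Set A))
    (hw : w ∈ Algebra.adjoin K {a, b}) : c * v * c * w ∈ leftSpan K a b c := by
  have ha : a ∈ Algebra.adjoin K {a, b} := Algebra.subset_adjoin (by simp)
  have hb : b ∈ Algebra.adjoin K {a, b} := Algebra.subset_adjoin (by simp)
  have h1 := one_mem (Algebra.adjoin K {a, b})
  simp only [Set.mem_insert_iff, Set.mem_singleton_iff] at hv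
  rcases hv with rfl | rfl | rfl | rfl
  · have e : c * v * c * w = v * c * w + 1 * c * (v * w) - v * c * (v * w) := by
      rw [h.cac]; noncomm_ring
    rw [e]
    exact sub_mem (add_mem (once_mem ha hw) (once_mem h1 (mul_mem ha hw)))
      (once_mem ha (mul_mem ha hw))
  · have e : c * v * c * w = v * c * w + 1 * c * (v * w) - v * c * (v * w) := by
      rw [h.cbc]; noncomm_ring
    rw [e]
    exact sub_mem (add_mem (once_mem hb hw) (once_mem h1 (mul_mem hb hw)))
      (once_mem hb (mul_mem hb hw))
  · have e : c * (a * b) * c * w = (a * b) * c * w + b * c * (a * w) + 1 * c * (a * b * w)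
        - (a * b) * c * (a * w) - b * c * (a * b * w) := by
      rw [← mul_assoc c, h.cabc]; noncomm_ring
    rw [e]
    exact sub_mem (sub_mem (add_mem (add_mem (once_mem (mul_mem ha hb) hw)
      (once_mem hb (mul_mem ha hw))) (once_mem h1 (mul_mem (mul_mem ha hb) hw)))
      (once_mem (mul_mem ha hb) (mul_mem ha hw))) (once_mem hb (mul_mem (mul_mem ha hb) hw))
  · have e : c * (b * a) * c * w = (b * a) * c * w + a * c * (b * w) + 1 * c * (b * a * w)
        - (b * a) * c * (b * w) - a * c * (b * a * w) := by
      rw [← mul_assoc c, h.cbac]; noncomm_ring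
    rw [e]
    exact sub_mem (sub_mem (add_mem (add_mem (once_mem (mul_mem hb ha) hw)
      (once_mem ha (mul_mem hb hw))) (once_mem h1 (mul_mem (mul_mem hb ha) hw)))
      (once_mem (mul_mem hb ha) (mul_mem hb hw))) (once_mem ha (mul_mem (mul_mem hb ha) hw))

/-- Together with `cabac_mul_b_mem` this makes right factors after `c * a * b * a * c` superfluous,
so that this middle part contributes only 6 words and not 36. -/
theorem cabac_mul_a_mem : c * a * b * a * c * a ∈ leftSpan K a b c := by
  have ha : a ∈ Algebra.adjoin K {a, b} := Algebra.subset_adjoin (by simp)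
  have hb : b ∈ Algebra.adjoin K {a, b} := Algebra.subset_adjoin (by simp)
  have e : c * a * b * a * c * a =
      c * (a * b) * c * a - b * (c * a * c * 1) + b * (c * a * b * a * c) := by
    rw [h.cabaca]; noncomm_ring
  rw [e]
  exact add_mem (sub_mem (h.c_mul_mul_c_mul_mem (by simp) ha)
    (left_mul_mem hb (h.c_mul_mul_c_mul_mem (by simp) (one_mem _)))) (twice_mem hb)

theorem cabac_mul_b_mem : c * a * b * a * c * b ∈ leftSpan K a b c := by
  have ha : a ∈ Algebra.adjoin K {a, b} := Algebra.subset_adjoin (by simp)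
  have hb : b ∈ Algebra.adjoin K {a, b} := Algebra.subset_adjoin (by simp)
  -- The braid relation trades `a * b * a` for `b * a * b`, to which `cbabcb` applies; the last term
  -- is traded back in the same way.
  have e : c * a * b * a * c * b = c * (a * b) * c * b + a * (c * b * c * 1)
      - a * (c * (a * b) * c * 1) - a * (c * (b * a) * c * 1) + a * (c * a * b * a * c) := by
    have h1 := h.braid_ab
    have h2 := h.cbabcb
    linear_combination (norm := noncomm_ring) c * h1 * c * b - h2 - a * c * h1 * c
  rw [e]
  exact add_mem (sub_mem (sub_mem (add_mem (h.c_mul_mul_c_mul_mem (by simp) hb)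
    (left_mul_mem ha (h.c_mul_mul_c_mul_mem (by simp) (one_mem _))))
    (left_mul_mem ha (h.c_mul_mul_c_mul_mem (by simp) (one_mem _))))
    (left_mul_mem ha (h.c_mul_mul_c_mul_mem (by simp) (one_mem _)))) (twice_mem ha)

theorem leftSpan_mul_mem {x g : A} (hx : x ∈ leftSpan K a b c) (hg : g ∈ ({a, b, c} : Set A)) :
    x * g ∈ leftSpan K a b c := by
  have hga : g ∈ ({a, b} : Set A) → g ∈ Algebra.adjoin K {a, b} :=
    fun h => Algebra.subset_adjoin h
  have hg' : g ∈ ({a, b} : Set A) ∨ g = c := by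
    simpa only [Set.mem_insert_iff, Set.mem_singleton_iff, or_assoc] using hg
  induction hx using Submodule.span_induction with
  | zero => simp
  | add x y _ _ hx hy => rw [add_mul]; exact Submodule.add_mem _ hx hy
  | smul k x _ hx => rw [smul_mul_assoc]; exact Submodule.smul_mem _ k hx
  | mem x hx =>
    cases hx with
    | base hu =>
      rcases hg' with hg' | rfl
      · exact base_mem (mul_mem hu (hga hg'))
      · simpa using once_mem (c := g) hu (one_mem _)
    | once hu hv =>
      rcases hg' with hg' | rfl
      · rw [mul_assoc]; exact once_mem hu (mul_mem hv (hga hg'))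
      · rw [mul_assoc, mul_assoc, ← mul_assoc g]
        exact left_mul_mem hu (h.c_mul_mul_c_mem hv)
    | twice hu =>
      rw [mul_assoc]
      refine left_mul_mem hu ?_
      rcases hg' with hg' | rfl
      · simp only [Set.mem_insert_iff, Set.mem_singleton_iff] at hg'
        rcases hg' with rfl | rfl
        · exact h.cabac_mul_a_mem
        · exact h.cabac_mul_b_mem
      · rw [mul_assoc, h.cc]
        simpa using twice_mem (c := g) (one_mem (Algebra.adjoin K {a, b}))

theorem adjoin_abc_le :
    Subalgebra.toSubmodule (Algebra.adjoin K {a, b, c}) ≤ leftSpan K a b c := fun _ hx =>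
  mem_of_mem_adjoin (base_mem (one_mem _)) (fun _ hx _ hg => h.leftSpan_mul_mem hx hg) hx

/-- By `rp`, `rq` and `rr` a letter `r` moves to the end and at most one survives. With six words in
`p` and `q` this leaves 12 words. -/
theorem adjoin_pqr_le :
    Subalgebra.toSubmodule (Algebra.adjoin K {p, q, r}) ≤
      Subalgebra.toSubmodule (Algebra.adjoin K {p, q}) * Submodule.span K {1, r} := by
  have hone : (1 : A) ∈ Subalgebra.toSubmodule (Algebra.adjoin K {p, q}) :=
    one_mem (Algebra.adjoin K {p, q})
  have hp : p ∈ Subalgebra.toSubmodule (Algebra.adjoin K {p, q}) :=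
    Algebra.subset_adjoin (by simp)
  have hq : q ∈ Subalgebra.toSubmodule (Algebra.adjoin K {p, q}) :=
    Algebra.subset_adjoin (by simp)
  have hpq : p * q ∈ Subalgebra.toSubmodule (Algebra.adjoin K {p, q}) :=
    (Algebra.adjoin K {p, q}).mul_mem hp hq
  have hqp : q * p ∈ Subalgebra.toSubmodule (Algebra.adjoin K {p, q}) :=
    (Algebra.adjoin K {p, q}).mul_mem hq hp
  have h1 : (1 : A) ∈ Submodule.span K {1, r} := Submodule.subset_span (by simp)
  have hr : r ∈ Submodule.span K {1, r} := Submodule.subset_span (by simp)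
  have key : ∀ y ∈ Submodule.span K {1, r}, ∀ g ∈ ({p, q, r} : Set A), y * g ∈
      Subalgebra.toSubmodule (Algebra.adjoin K {p, q}) * Submodule.span K {1, r} := by
    intro y hy g hg
    simp only [Set.mem_insert_iff, Set.mem_singleton_iff] at hg
    induction hy using Submodule.span_induction with
    | zero => simp
    | add x y _ _ hx hy => rw [add_mul]; exact Submodule.add_mem _ hx hy
    | smul k x _ hx => rw [smul_mul_assoc]; exact Submodule.smul_mem _ k hx
    | mem y hy =>
      simp only [Set.mem_insert_iff, Set.mem_singleton_iff] at hy
      rcases hy with rfl | rfl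
      · rw [one_mul]
        rcases hg with rfl | rfl | rfl
        · simpa using Submodule.mul_mem_mul hp h1
        · simpa using Submodule.mul_mem_mul hq h1
        · simpa using Submodule.mul_mem_mul hone hr
      · rcases hg with rfl | rfl | rfl
        · have e : y * g = (g * q) * 1 + q * y - q * 1 := by rw [h.rp]; simp
          rw [e]
          exact sub_mem (add_mem (Submodule.mul_mem_mul hpq h1)
            (Submodule.mul_mem_mul hq hr)) (Submodule.mul_mem_mul hq h1)
        · have e : y * g = g * 1 + p * y - (g * p) * 1 := by rw [h.rq]; simp
          rw [e]
          exact sub_mem (add_mem (Submodule.mul_mem_mul hq h1)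
            (Submodule.mul_mem_mul hp hr)) (Submodule.mul_mem_mul hqp h1)
        · rw [h.rr]
          simpa using Submodule.mul_mem_mul hone hr
  refine fun x hx => mem_of_mem_adjoin ?_ (fun x hx g hg => ?_) hx
  · simpa using Submodule.mul_mem_mul hone h1
  · induction hx using Submodule.mul_induction_on' with
    | mem_mul_mem u hu y hy =>
      rw [mul_assoc]
      have := Submodule.mul_mem_mul hu (key y hy g hg)
      rwa [← mul_assoc, show Subalgebra.toSubmodule (Algebra.adjoin K {p, q}) *
        Subalgebra.toSubmodule (Algebra.adjoin K {p, q}) =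
        Subalgebra.toSubmodule (Algebra.adjoin K {p, q}) from
          Subalgebra.isIdempotentElem_toSubmodule _] at this
    | add x _ y _ hx hy => rw [add_mul]; exact Submodule.add_mem _ hx hy

/-- The generators `p, q, r` can be moved to the right of the generators `a, b, c`. -/
theorem straighten {y g : A} (hy : y ∈ Submodule.span K {1, p, q, r})
    (hg : g ∈ ({a, b, c} : Set A)) :
    y * g ∈ Subalgebra.toSubmodule (Algebra.adjoin K {a, b, c}) *
      Submodule.span K {1, p, q, r} := by
  have ha : a ∈ Algebra.adjoin K {a, b, c} := Algebra.subset_adjoin (by simp)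
  have hb : b ∈ Algebra.adjoin K {a, b, c} := Algebra.subset_adjoin (by simp)
  have hc : c ∈ Algebra.adjoin K {a, b, c} := Algebra.subset_adjoin (by simp)
  have hp : p ∈ Submodule.span K {1, p, q, r} := Submodule.subset_span (by simp)
  have hq : q ∈ Submodule.span K {1, p, q, r} := Submodule.subset_span (by simp)
  have hr : r ∈ Submodule.span K {1, p, q, r} := Submodule.subset_span (by simp)
  have mem : ∀ {u}, u ∈ Algebra.adjoin K {a, b, c} → ∀ {y}, y ∈ Submodule.span K {1, p, q, r} →
      u * y ∈ Subalgebra.toSubmodule (Algebra.adjoin K {a, b, c}) *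
        Submodule.span K {1, p, q, r} := fun hu _ hy => Submodule.mul_mem_mul hu hy
  have mem' : ∀ {u}, u ∈ Algebra.adjoin K {a, b, c} →
      u ∈ Subalgebra.toSubmodule (Algebra.adjoin K {a, b, c}) *
        Submodule.span K {1, p, q, r} := fun hu => by
    simpa using mem hu (Submodule.subset_span (by simp : (1 : A) ∈ ({1, p, q, r} : Set A)))
  simp only [Set.mem_insert_iff, Set.mem_singleton_iff] at hg
  induction hy using Submodule.span_induction with
  | zero => simp
  | add x y _ _ hx hy => rw [add_mul]; exact Submodule.add_mem _ hx hy
  | smul k x _ hx => rw [smul_mul_assoc]; exact Submodule.smul_mem _ k hx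
  | mem y hy =>
    simp only [Set.mem_insert_iff, Set.mem_singleton_iff] at hy
    rcases hy with rfl | rfl | rfl | rfl
    · rw [one_mul]
      rcases hg with rfl | rfl | rfl
      exacts [mem' ha, mem' hb, mem' hc]
    · rcases hg with rfl | rfl | rfl
      · rw [h.pa]
        exact sub_mem (add_mem (mem' (mul_mem ha hb)) (mem hb hp)) (mem' hb)
      · rw [h.pb]
        exact sub_mem (add_mem (mem' hb) (mem ha hp)) (mem' (mul_mem hb ha))
      · rw [h.pc]
        exact mem hc hp
    · rcases hg with rfl | rfl | rfl
      · rw [h.qa]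
        exact sub_mem (add_mem (mem' (mul_mem ha hc)) (mem hc hq)) (mem' hc)
      · rw [h.qb]
        exact mem hb hq
      · rw [h.qc]
        exact sub_mem (add_mem (mem' hc) (mem ha hq)) (mem' (mul_mem hc ha))
    · rcases hg with rfl | rfl | rfl
      · rw [h.ra]
        exact mem ha hr
      · rw [h.rb]
        exact sub_mem (add_mem (mem' (mul_mem hb hc)) (mem hc hr)) (mem' hc)
      · rw [h.rc]
        exact sub_mem (add_mem (mem' hc) (mem hb hr)) (mem' (mul_mem hc hb))

theorem straighten_adjoin {y v : A} (hy : y ∈ Submodule.span K {1, p, q, r})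
    (hv : v ∈ Algebra.adjoin K {a, b, c}) :
    y * v ∈ Subalgebra.toSubmodule (Algebra.adjoin K {a, b, c}) *
      Submodule.span K {1, p, q, r} := by
  refine mul_mem_of_mem_adjoin (fun x hx g hg => ?_) ?_ hv
  · induction hx using Submodule.mul_induction_on' with
    | mem_mul_mem u hu y hy =>
      rw [mul_assoc]
      have := Submodule.mul_mem_mul hu (h.straighten hy hg)
      rwa [← mul_assoc, show Subalgebra.toSubmodule (Algebra.adjoin K {a, b, c}) *
        Subalgebra.toSubmodule (Algebra.adjoin K {a, b, c}) =
        Subalgebra.toSubmodule (Algebra.adjoin K {a, b, c}) from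
          Subalgebra.isIdempotentElem_toSubmodule _] at this
    | add x _ y _ hx hy => rw [add_mul]; exact Submodule.add_mem _ hx hy
  · have h1 : (1 : A) ∈ Subalgebra.toSubmodule (Algebra.adjoin K {a, b, c}) :=
      one_mem (Algebra.adjoin K {a, b, c})
    simpa using Submodule.mul_mem_mul h1 hy

theorem adjoin_mul_adjoin_eq_top (htop : Algebra.adjoin K {a, b, c, p, q, r} = ⊤) :
    Subalgebra.toSubmodule (Algebra.adjoin K {a, b, c}) *
      Subalgebra.toSubmodule (Algebra.adjoin K {p, q, r}) = ⊤ := by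
  have straighten' := fun {y v : A} => h.straighten_adjoin (K := K) (y := y) (v := v)
  have hPU : Submodule.span K {1, p, q, r} ≤
      Subalgebra.toSubmodule (Algebra.adjoin K {p, q, r}) := by
    rw [Submodule.span_le]
    rintro y (rfl | hy)
    · exact one_mem (Algebra.adjoin K {p, q, r})
    · exact Algebra.subset_adjoin hy
  have hL : ∀ g ∈ ({a, b, c} : Set A), g ∈ Subalgebra.toSubmodule (Algebra.adjoin K {a, b, c}) :=
    fun g hg => Algebra.subset_adjoin hg
  have hU : ∀ g ∈ ({p, q, r} : Set A), g ∈ Subalgebra.toSubmodule (Algebra.adjoin K {p, q, r}) :=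
    fun g hg => Algebra.subset_adjoin hg
  have hLL : Subalgebra.toSubmodule (Algebra.adjoin K {a, b, c}) *
      Subalgebra.toSubmodule (Algebra.adjoin K {a, b, c}) =
      Subalgebra.toSubmodule (Algebra.adjoin K {a, b, c}) :=
    Subalgebra.isIdempotentElem_toSubmodule _
  have hUU : Subalgebra.toSubmodule (Algebra.adjoin K {p, q, r}) *
      Subalgebra.toSubmodule (Algebra.adjoin K {p, q, r}) =
      Subalgebra.toSubmodule (Algebra.adjoin K {p, q, r}) :=
    Subalgebra.isIdempotentElem_toSubmodule _
  have h1L : (1 : A) ∈ Subalgebra.toSubmodule (Algebra.adjoin K {a, b, c}) :=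
    one_mem (Algebra.adjoin K {a, b, c})
  have h1U : (1 : A) ∈ Subalgebra.toSubmodule (Algebra.adjoin K {p, q, r}) :=
    one_mem (Algebra.adjoin K {p, q, r})
  have hind : ∀ {x}, x ∈ Algebra.adjoin K {p, q, r} → ∀ {S : Submodule K A}, (1 : A) ∈ S →
      (∀ x ∈ S, ∀ g ∈ ({p, q, r} : Set A), x * g ∈ S) → x ∈ S := fun hx _ h1 hs =>
    mem_of_mem_adjoin h1 hs hx
  have hmem : ∀ {S : Submodule K A}, (1 : A) ∈ S →
      (∀ x ∈ S, ∀ g ∈ ({a, b, c, p, q, r} : Set A), x * g ∈ S) → S = ⊤ := fun h1 hs =>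
    eq_top_iff.2 fun x _ => mem_of_mem_adjoin h1 hs (by rw [htop]; exact Algebra.mem_top)
  change ∀ {y v : A}, _ → v ∈ Subalgebra.toSubmodule (Algebra.adjoin K {a, b, c}) → _
    at straighten'
  change ∀ {x}, x ∈ Subalgebra.toSubmodule (Algebra.adjoin K {p, q, r}) → _ at hind
  generalize Subalgebra.toSubmodule (Algebra.adjoin K {a, b, c}) = L at *
  generalize Subalgebra.toSubmodule (Algebra.adjoin K {p, q, r}) = U at *
  have hLU : L * (L * U) = L * U := by rw [← mul_assoc, hLL]
  have hLU' : (L * U) * U = L * U := by rw [mul_assoc, hUU]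
  have swap : ∀ u ∈ U, ∀ v ∈ L, u * v ∈ L * U := by
    intro u hu
    -- The elements that can be moved across all of `L`. It suffices that `T` contains 1 and is
    -- stable under right multiplication by `p`, `q`, `r`.
    let T : Submodule K A :=
      { carrier := {x | ∀ v ∈ L, x * v ∈ L * U}
        add_mem' := fun hx hy v hv => by rw [add_mul]; exact add_mem (hx v hv) (hy v hv)
        zero_mem' := fun v _ => by rw [zero_mul]; exact zero_mem _
        smul_mem' := fun k x hx v hv => by
          rw [smul_mul_assoc]; exact Submodule.smul_mem _ k (hx v hv) }
    refine hind hu (S := T) (fun v hv => ?_) (fun x hx g hg v hv => ?_)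
    · simpa using Submodule.mul_mem_mul hv h1U
    · have hgv : g * v ∈ L * Submodule.span K {1, p, q, r} :=
        straighten' (Submodule.subset_span (Or.inr hg)) hv
      rw [mul_assoc]
      generalize g * v = z at hgv
      induction hgv using Submodule.mul_induction_on' with
      | mem_mul_mem w hw y hy =>
        rw [← mul_assoc, ← hLU']
        exact Submodule.mul_mem_mul (hx w hw) (hPU hy)
      | add y _ z _ hy hz => rw [mul_add]; exact add_mem hy hz
  refine hmem (by simpa using Submodule.mul_mem_mul h1L h1U) fun x hx g hg => ?_
  have hg' : g ∈ ({a, b, c} : Set A) ∨ g ∈ ({p, q, r} : Set A) := by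
    simpa only [Set.mem_insert_iff, Set.mem_singleton_iff, or_assoc] using hg
  rcases hg' with hg' | hg'
  · induction hx using Submodule.mul_induction_on' with
    | mem_mul_mem v hv u hu =>
      rw [mul_assoc, ← hLU]
      exact Submodule.mul_mem_mul hv (swap u hu g (hL g hg'))
    | add y _ z _ hy hz => rw [add_mul]; exact add_mem hy hz
  · rw [← hLU']
    exact Submodule.mul_mem_mul hx (hU g hg')

omit h in
theorem leftSpan_le_span {s : Finset A} [DecidableEq A]
    (hs : Subalgebra.toSubmodule (Algebra.adjoin K {a, b}) ≤ Submodule.span K s) :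
    leftSpan K a b c ≤
      Submodule.span K ↑(s ∪ s * {c} * s ∪ s * {c * a * b * a * c} : Finset A) := by
  refine Submodule.span_le.2 fun x hx => ?_
  rw [Finset.coe_union, Finset.coe_union, Finset.coe_mul, Finset.coe_mul, Finset.coe_mul,
    Finset.coe_singleton, Finset.coe_singleton, Submodule.span_union, Submodule.span_union,
    ← Submodule.span_mul_span, ← Submodule.span_mul_span, ← Submodule.span_mul_span]
  cases hx with
  | base hu => exact Submodule.mem_sup_left (Submodule.mem_sup_left (hs hu))
  | once hu hv =>
    exact Submodule.mem_sup_left (Submodule.mem_sup_right (Submodule.mul_mem_mul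
      (Submodule.mul_mem_mul (hs hu) (Submodule.mem_span_singleton_self c)) (hs hv)))
  | twice hu =>
    exact Submodule.mem_sup_right (Submodule.mul_mem_mul (hs hu)
      (Submodule.mem_span_singleton_self _))

/-- An algebra generated by idempotents as in the relations of `𝒟₄(α, -α)` has dimension at most
`576`. -/
theorem finite_and_finrank_le (htop : Algebra.adjoin K {a, b, c, p, q, r} = ⊤) :
    Module.Finite K A ∧ Module.finrank K A ≤ 576 := by
  classical
  let s : Finset A := {1, a, b, a * b, b * a, a * b * a}
  let t : Finset A := {1, p, q, p * q, q * p, p * q * p}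
  let e : Finset A := {1, r}
  have hs : Subalgebra.toSubmodule (Algebra.adjoin K {a, b}) ≤ Submodule.span K s := fun x hx => by
    simpa [s] using mem_span_of_mem_adjoin_pair h.aa h.bb h.braid_ab hx
  have ht : Subalgebra.toSubmodule (Algebra.adjoin K {p, q}) ≤ Submodule.span K t := fun x hx => by
    simpa [t] using mem_span_of_mem_adjoin_pair h.pp h.qq h.braid_pq hx
  have he : Submodule.span K {1, r} ≤ Submodule.span K (e : Set A) := by simp [e]
  have hle := mul_le_mul' (h.adjoin_abc_le.trans (leftSpan_le_span (c := c) hs))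
    (h.adjoin_pqr_le.trans (mul_le_mul' ht he))
  rw [h.adjoin_mul_adjoin_eq_top htop, Submodule.span_mul_span, Submodule.span_mul_span,
    ← Finset.coe_mul, ← Finset.coe_mul, top_le_iff] at hle
  refine ⟨⟨⟨_, hle⟩⟩, ?_⟩
  have hs6 : s.card ≤ 6 := Finset.card_le_six
  have ht6 : t.card ≤ 6 := Finset.card_le_six
  have he2 : e.card ≤ 2 := Finset.card_le_two
  -- The three kinds of left words give 6 + 6 · 6 + 6 = 48.
  have h1 : (s ∪ s * {c} * s ∪ s * {c * a * b * a * c} : Finset A).card ≤ 48 := by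
    have h2 : (s * {c} * s : Finset A).card ≤ s.card * 1 * s.card :=
      Finset.card_mul_le.trans (Nat.mul_le_mul_right _ Finset.card_mul_le)
    have h3 : (s * {c * a * b * a * c} : Finset A).card ≤ s.card * 1 := Finset.card_mul_le
    have h4 := Finset.card_union_le (s ∪ s * {c} * s) (s * {c * a * b * a * c} : Finset A)
    have h5 := Finset.card_union_le s (s * {c} * s)
    have h6 : s.card * 1 * s.card ≤ 36 := by nlinarith
    omega
  have h2 : (t * e : Finset A).card ≤ 12 :=
    Finset.card_mul_le.trans (Nat.mul_le_mul ht6 he2)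
  rw [← finrank_top, ← hle]
  exact (finrank_span_finset_le_card _).trans
    (Finset.card_mul_le.trans (Nat.mul_le_mul h1 h2))

end

end FKIdempotents

end

noncomputable section

/-! ## Geodesic matrix algebras -/

/-- A set with an integral, possibly non-symmetric distance, in which any two distinct points are
joined by a geodesic with steps of length one. -/
class GeodesicSpace (V : Type*) where
  /-- The distance. -/
  gdist : V → V → ℕ
  gdist_self : ∀ σ, gdist σ σ = 0
  eq_of_gdist_eq_zero : ∀ {σ τ}, gdist σ τ = 0 → σ = τ
  gdist_triangle : ∀ σ τ υ, gdist σ υ ≤ gdist σ τ + gdist τ υ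
  exists_step : ∀ {σ τ}, σ ≠ τ → ∃ υ, gdist σ υ = 1 ∧ gdist σ υ + gdist υ τ = gdist σ τ


open GeodesicSpace

/-- The point `τ` lies on a geodesic from `σ` to `υ`. -/
def IsBetween {V : Type*} [GeodesicSpace V] (σ τ υ : V) : Prop :=
  gdist σ τ + gdist τ υ = gdist σ υ

section IsBetween

variable {V : Type*} [GeodesicSpace V]

instance (σ τ υ : V) : Decidable (IsBetween σ τ υ) :=
  inferInstanceAs (Decidable (gdist σ τ + gdist τ υ = gdist σ υ))

theorem isBetween_left (σ τ : V) : IsBetween σ σ τ := by simp [IsBetween, gdist_self]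

theorem isBetween_right (σ τ : V) : IsBetween σ τ τ := by simp [IsBetween, gdist_self]

/-- By the triangle inequality both sides say that the distances along `σ, τ, υ, ω` add up to `gdist
σ ω`. This is the associativity of the product of geodesic matrices. -/
theorem isBetween_assoc {σ τ υ ω : V} :
    IsBetween σ υ ω ∧ IsBetween σ τ υ ↔ IsBetween σ τ ω ∧ IsBetween τ υ ω := by
  have h1 := gdist_triangle σ τ υ
  have h2 := gdist_triangle σ τ ω
  have h3 := gdist_triangle σ υ ω
  have h4 := gdist_triangle τ υ ω
  unfold IsBetween
  omega

end IsBetween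

/-- The geodesic matrix algebra of `V`: matrices indexed by `V`, where the product of the matrix
units `E σ τ` and `E τ υ` is `E σ υ` if `τ` lies on a geodesic from `σ` to `υ`, and zero
otherwise. -/
def GeoMatrix (K : Type u) (V : Type v) : Type (max u v) := V → V → K

namespace GeoMatrix

variable {K : Type u} {V : Type v} [CommRing K]

instance : AddCommGroup (GeoMatrix K V) := inferInstanceAs (AddCommGroup (V → V → K))
instance : Module K (GeoMatrix K V) := inferInstanceAs (Module K (V → V → K))

@[ext] theorem ext {K : Type*} {V : Type*} {F G : GeoMatrix K V} (h : ∀ σ τ, F σ τ = G σ τ) :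
    F = G :=
  funext fun σ => funext (h σ)

@[simp] theorem add_apply (F G : GeoMatrix K V) (σ τ : V) : (F + G) σ τ = F σ τ + G σ τ := rfl
@[simp] theorem sub_apply (F G : GeoMatrix K V) (σ τ : V) : (F - G) σ τ = F σ τ - G σ τ := rfl
@[simp] theorem zero_apply (σ τ : V) : (0 : GeoMatrix K V) σ τ = 0 := rfl
@[simp] theorem smul_apply (c : K) (F : GeoMatrix K V) (σ τ : V) : (c • F) σ τ = c * F σ τ := rfl

/-- The entry of a matrix, as a linear map. -/
def entry (σ τ : V) : GeoMatrix K V →ₗ[K] K where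
  toFun F := F σ τ
  map_add' _ _ := rfl
  map_smul' _ _ := rfl

@[simp] theorem entry_apply (F : GeoMatrix K V) (σ τ : V) : entry σ τ F = F σ τ := rfl

@[simp] theorem sum_apply {ι : Type*} (s : Finset ι) (F : ι → GeoMatrix K V) (σ τ : V) :
    (∑ i ∈ s, F i) σ τ = ∑ i ∈ s, F i σ τ := map_sum (entry (K := K) σ τ) F s

open scoped Classical in
/-- The matrix unit. -/
def unit (K : Type u) [CommRing K] (σ τ : V) : GeoMatrix K V :=
  fun a b => if a = σ ∧ b = τ then 1 else 0

@[simp] theorem unit_self (σ τ : V) : unit K σ τ σ τ = 1 := by simp [unit]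

theorem unit_apply_of_ne {σ τ a b : V} (h : ¬(a = σ ∧ b = τ)) : unit K σ τ a b = 0 := by
  simp [unit, h]

open scoped Classical in
instance : One (GeoMatrix K V) := ⟨fun σ τ => if σ = τ then 1 else 0⟩

open scoped Classical in
theorem one_apply (σ τ : V) : (1 : GeoMatrix K V) σ τ = if σ = τ then 1 else 0 := rfl

section Filtration

variable [GeodesicSpace V]

/-- The matrices supported on pairs at distance at least `k`. -/
def filtration (K : Type u) (V : Type v) [CommRing K] [GeodesicSpace V] (k : ℕ) :
    Submodule K (GeoMatrix K V) where
  carrier := {F | ∀ σ τ, gdist σ τ < k → F σ τ = 0}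
  add_mem' hF hG σ τ h := by simp [hF σ τ h, hG σ τ h]
  zero_mem' _ _ _ := rfl
  smul_mem' c F hF σ τ h := by simp [hF σ τ h]

theorem filtration_mono {k l : ℕ} (h : k ≤ l) : filtration K V l ≤ filtration K V k :=
  fun _ hF σ τ hd => hF σ τ (hd.trans_le h)

theorem unit_mem_filtration (σ τ : V) : unit K σ τ ∈ filtration K V (gdist σ τ) := by
  intro a b h
  refine unit_apply_of_ne ?_
  rintro ⟨rfl, rfl⟩
  exact lt_irrefl _ h

end Filtration

variable [Fintype V]

theorem eq_sum_unit (F : GeoMatrix K V) : F = ∑ σ, ∑ τ, F σ τ • unit K σ τ := by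
  classical
  ext a b
  simp [unit, ite_and]

theorem hom_ext {M : Type*} [AddCommGroup M] [Module K M] {f g : GeoMatrix K V →ₗ[K] M}
    (h : ∀ σ τ, f (unit K σ τ) = g (unit K σ τ)) : f = g := by
  refine LinearMap.ext fun F => ?_
  rw [eq_sum_unit F]
  simp [h]

variable [GeodesicSpace V]

instance : Mul (GeoMatrix K V) :=
  ⟨fun F G σ υ => ∑ τ, if IsBetween σ τ υ then F σ τ * G τ υ else 0⟩

theorem mul_apply (F G : GeoMatrix K V) (σ υ : V) :
    (F * G) σ υ = ∑ τ, if IsBetween σ τ υ then F σ τ * G τ υ else 0 := rfl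

protected theorem mul_assoc (F G H : GeoMatrix K V) : F * G * H = F * (G * H) := by
  ext σ ω
  simp only [mul_apply]
  have h1 : ∀ υ, (if IsBetween σ υ ω then
      (∑ τ, if IsBetween σ τ υ then F σ τ * G τ υ else 0) * H υ ω else 0) =
      ∑ τ, if IsBetween σ υ ω ∧ IsBetween σ τ υ then F σ τ * G τ υ * H υ ω else 0 := fun υ => by
    split_ifs with h
    · simp [h, Finset.sum_mul]
    · simp [h]
  have h2 : ∀ τ, (if IsBetween σ τ ω then
      F σ τ * (∑ υ, if IsBetween τ υ ω then G τ υ * H υ ω else 0) else 0) =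
      ∑ υ, if IsBetween σ τ ω ∧ IsBetween τ υ ω then F σ τ * G τ υ * H υ ω else 0 := fun τ => by
    split_ifs with h
    · simp [h, Finset.mul_sum, mul_assoc]
    · simp [h]
  rw [Finset.sum_congr rfl fun υ _ => h1 υ, Finset.sum_congr rfl fun τ _ => h2 τ,
    Finset.sum_comm]
  exact Finset.sum_congr rfl fun τ _ => Finset.sum_congr rfl fun υ _ =>
    if_congr isBetween_assoc rfl rfl

protected theorem one_mul (F : GeoMatrix K V) : 1 * F = F := by
  classical
  ext σ τ
  rw [mul_apply, Finset.sum_eq_single σ]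
  · simp [one_apply, isBetween_left]
  · intro b _ hb
    simp [one_apply, hb.symm]
  · simp

protected theorem mul_one (F : GeoMatrix K V) : F * 1 = F := by
  classical
  ext σ τ
  rw [mul_apply, Finset.sum_eq_single τ]
  · simp [one_apply, isBetween_right]
  · intro b _ hb
    simp [one_apply, hb]
  · simp

theorem ite_add_ite_zero (p : Prop) [Decidable p] (x y : K) :
    (if p then x + y else 0) = (if p then x else 0) + if p then y else 0 := by
  split_ifs <;> simp

instance : Ring (GeoMatrix K V) where
  __ := (inferInstance : AddCommGroup (GeoMatrix K V))
  mul := (· * ·)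
  one := 1
  left_distrib F G H := by
    ext; simp only [mul_apply, add_apply, mul_add, ite_add_ite_zero, Finset.sum_add_distrib]
  right_distrib F G H := by
    ext; simp only [mul_apply, add_apply, add_mul, ite_add_ite_zero, Finset.sum_add_distrib]
  zero_mul F := by ext; simp [mul_apply]
  mul_zero F := by ext; simp [mul_apply]
  mul_assoc := GeoMatrix.mul_assoc
  one_mul := GeoMatrix.one_mul
  mul_one := GeoMatrix.mul_one

instance : Algebra K (GeoMatrix K V) :=
  Algebra.ofModule (fun r F G => by ext; simp [mul_apply, Finset.mul_sum, mul_assoc])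
    (fun r F G => by ext; simp [mul_apply, Finset.mul_sum, mul_left_comm])

open scoped Classical in
open scoped Classical in
theorem unit_mul_apply (σ τ a b : V) (G : GeoMatrix K V) :
    (unit K σ τ * G) a b = if a = σ ∧ IsBetween σ τ b then G τ b else 0 := by
  rw [mul_apply, Finset.sum_eq_single τ]
  · by_cases h : a = σ
    · subst h; simp
    · simp [unit, h]
  · intro c _ hc
    simp [unit, hc]
  · simp

open scoped Classical in
theorem mul_unit_apply (τ υ a b : V) (F : GeoMatrix K V) :
    (F * unit K τ υ) a b = if b = υ ∧ IsBetween a τ υ then F a τ else 0 := by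
  rw [mul_apply, Finset.sum_eq_single τ]
  · by_cases h : b = υ
    · subst h; simp
    · simp [unit, h]
  · intro c _ hc
    simp [unit, hc]
  · simp

theorem unit_mul_unit {σ τ υ : V} (h : IsBetween σ τ υ) :
    unit K σ τ * unit K τ υ = unit K σ υ := by
  classical
  ext a b
  rw [unit_mul_apply]
  by_cases hb : b = υ
  · subst hb; simp [unit, h]
  · simp [unit, hb]

theorem unit_mul_unit_of_not {σ τ υ : V} (h : ¬IsBetween σ τ υ) :
    unit K σ τ * unit K τ υ = 0 := by
  classical
  ext a b
  rw [unit_mul_apply]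
  by_cases hb : b = υ
  · subst hb; simp [h]
  · simp [unit, hb]

theorem unit_mul_unit_of_ne {σ τ τ' υ : V} (h : τ ≠ τ') :
    unit K σ τ * unit K τ' υ = 0 := by
  classical
  ext a b
  rw [unit_mul_apply]
  simp [unit, h]

theorem sum_unit : ∑ σ : V, unit K σ σ = 1 := by
  classical
  ext a b
  rw [sum_apply, Finset.sum_eq_single a]
  · simp [unit, one_apply, eq_comm]
  · intro c _ hc
    simp [unit, hc.symm]
  · simp

/-- The diagonal entries, as algebra homomorphisms. -/
def diag (K : Type u) [CommRing K] (σ : V) : GeoMatrix K V →ₐ[K] K :=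
  AlgHom.ofLinearMap (entry σ σ) (by simp [one_apply]) fun F G => by
    rw [entry_apply, mul_apply, Finset.sum_eq_single σ]
    · simp [isBetween_left]
    · intro τ _ hτ
      rw [if_neg]
      intro h
      rw [IsBetween, gdist_self] at h
      exact hτ (eq_of_gdist_eq_zero (by omega : gdist τ σ = 0))
    · simp

@[simp] theorem diag_apply (σ : V) (F : GeoMatrix K V) : diag K σ F = F σ σ := rfl

theorem mul_mem_filtration {k l : ℕ} {F G : GeoMatrix K V} (hF : F ∈ filtration K V k)
    (hG : G ∈ filtration K V l) : F * G ∈ filtration K V (k + l) := by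
  intro σ υ h
  rw [mul_apply]
  refine Finset.sum_eq_zero fun τ _ => ?_
  split_ifs with hb
  · rw [IsBetween] at hb
    by_cases h1 : gdist σ τ < k
    · rw [hF σ τ h1, zero_mul]
    · rw [hG τ υ (by omega), mul_zero]
  · rfl

variable (K V) in
theorem exists_filtration_eq_bot : ∃ k, filtration K V k = ⊥ := by
  -- Any number above all distances would do; the sum of all distances bounds each of them.
  refine ⟨∑ σ : V, ∑ τ : V, gdist σ τ + 1, eq_bot_iff.2 fun F hF => ?_⟩
  refine (Submodule.mem_bot K).2 (ext fun σ τ => hF σ τ (Nat.lt_succ_of_le ?_))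
  exact (Finset.single_le_sum (f := fun τ => gdist σ τ) (by simp) (Finset.mem_univ τ)).trans
    (Finset.single_le_sum (f := fun σ => ∑ τ : V, gdist σ τ) (by simp) (Finset.mem_univ σ))

theorem isNilpotent_of_diag_eq_zero {F : GeoMatrix K V} (hF : ∀ σ, F σ σ = 0) :
    IsNilpotent F := by
  have h1 : F ∈ filtration K V 1 := fun σ τ h => by
    obtain rfl : σ = τ := eq_of_gdist_eq_zero (by omega)
    exact hF σ
  have h2 : ∀ n, F ^ n ∈ filtration K V n := fun n => by
    induction n with
    | zero => exact fun _ _ h => absurd h (by simp)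
    | succ n ih => rw [pow_succ]; exact mul_mem_filtration ih h1
  obtain ⟨k, hk⟩ := exists_filtration_eq_bot K V
  exact ⟨k, by simpa [hk] using h2 k⟩

/-- A subalgebra that contains all matrix units at distance at most one up to matrices supported
at larger distances is the whole algebra. -/
theorem subalgebra_eq_top (S : Subalgebra K (GeoMatrix K V))
    (h : ∀ σ τ : V, gdist σ τ ≤ 1 →
      ∃ x ∈ S, x - unit K σ τ ∈ filtration K V (gdist σ τ + 1)) : S = ⊤ := by
  have key : ∀ n (σ τ : V), gdist σ τ = n →
      ∃ x ∈ S, x - unit K σ τ ∈ filtration K V (n + 1) := by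
    intro n
    induction n with
    | zero => intro σ τ hd; simpa [hd] using h σ τ (by omega)
    | succ n ih =>
      intro σ τ hd
      -- The unit at distance n + 1 is the product of units for the first step and the rest of a
      -- geodesic. Replacing both factors by elements of `S` with these leading terms changes the
      -- product only at larger distance.
      obtain ⟨υ, h1, h2⟩ := exists_step (σ := σ) (τ := τ) (by
        rintro rfl; rw [gdist_self] at hd; omega)
      obtain ⟨x, hx, hx'⟩ := h σ υ h1.le
      obtain ⟨y, hy, hy'⟩ := ih υ τ (by omega)
      refine ⟨x * y, S.mul_mem hx hy, ?_⟩
      have e : x * y - unit K σ τ = (x - unit K σ υ) * (y - unit K υ τ) +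
          ((x - unit K σ υ) * unit K υ τ + unit K σ υ * (y - unit K υ τ)) := by
        rw [← unit_mul_unit (K := K) h2]; noncomm_ring
      rw [e]
      have hu := unit_mem_filtration (K := K) σ υ
      have hv := unit_mem_filtration (K := K) υ τ
      have hn : gdist υ τ = n := by omega
      rw [h1] at hx' hu
      rw [hn] at hv
      refine Submodule.add_mem _ (filtration_mono (by omega) (mul_mem_filtration hx' hy'))
        (Submodule.add_mem _ (filtration_mono (by omega) (mul_mem_filtration hx' hv))
          (filtration_mono (by omega) (mul_mem_filtration hu hy')))
  obtain ⟨k, hk⟩ := exists_filtration_eq_bot K V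
  -- Descending induction: the entries of `F` at distance n are cancelled by a combination of
  -- elements of `S`, and the remainder lies one step deeper in the filtration.
  have step : ∀ n, filtration K V (n + 1) ≤ Subalgebra.toSubmodule S →
      filtration K V n ≤ Subalgebra.toSubmodule S := by
    classical
    intro n hn F hF
    have hx : ∀ p : V × V, ∃ x ∈ S, gdist p.1 p.2 = n →
        x - unit K p.1 p.2 ∈ filtration K V (n + 1) := fun p => by
      by_cases hp : gdist p.1 p.2 = n
      · obtain ⟨x, hx, hx'⟩ := key n p.1 p.2 hp
        exact ⟨x, hx, fun _ => hx'⟩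
      · exact ⟨0, S.zero_mem, fun h => absurd h hp⟩
    choose x hxS hx using hx
    have hsum : ∑ p ∈ Finset.univ.filter (fun p : V × V => gdist p.1 p.2 = n),
        F p.1 p.2 • x p ∈ Subalgebra.toSubmodule S :=
      Submodule.sum_mem _ fun p _ => Submodule.smul_mem _ _ (hxS p)
    have hrest : F - ∑ p ∈ Finset.univ.filter (fun p : V × V => gdist p.1 p.2 = n),
        F p.1 p.2 • x p ∈ filtration K V (n + 1) := by
      intro σ τ hd
      have hval : ∀ p ∈ Finset.univ.filter (fun p : V × V => gdist p.1 p.2 = n),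
          (F p.1 p.2 • x p) σ τ = if p = (σ, τ) then F σ τ else 0 := fun p hp => by
        have h1 := hx p (by simpa using hp) σ τ hd
        rw [sub_apply, sub_eq_zero] at h1
        rw [smul_apply, h1]
        split_ifs with h2
        · subst h2; simp
        · rw [unit_apply_of_ne, mul_zero]
          rintro ⟨rfl, rfl⟩
          exact h2 rfl
      rw [sub_apply, sum_apply, Finset.sum_congr rfl hval, Finset.sum_ite_eq']
      by_cases hd' : gdist σ τ = n
      · simp [hd']
      · simp [hd', hF σ τ (by omega)]
    have := Submodule.add_mem _ (hn hrest) hsum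
    simpa using this
  have all : ∀ j, filtration K V (k - j) ≤ Subalgebra.toSubmodule S := by
    intro j
    induction j with
    | zero => rw [Nat.sub_zero, hk]; exact bot_le
    | succ j ih =>
      by_cases hj : j < k
      · refine step _ ?_
        rwa [show k - (j + 1) + 1 = k - j by omega]
      · rwa [show k - (j + 1) = k - j by omega]
  refine eq_top_iff.2 fun F _ => ?_
  have h0 := all k
  rw [Nat.sub_self] at h0
  exact h0 fun σ τ h => absurd h (by simp)

instance {K : Type u} [Field K] : Module.Finite K (GeoMatrix K V) :=
  inferInstanceAs (Module.Finite K (V → V → K))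

theorem finrank_eq {K : Type u} [Field K] :
    Module.finrank K (GeoMatrix K V) = Fintype.card V * Fintype.card V := by
  change Module.finrank K (V → V → K) = _
  simp [Module.finrank_pi_fintype]

end GeoMatrix

end

noncomputable section

open GeodesicSpace

/-! ## Modules over algebras isomorphic to a geodesic matrix algebra -/

namespace GeoMatrix

/-! ### Radical and simple modules -/

section Basic

variable {K : Type u} {A : Type u} {V : Type v} [Field K] [Ring A] [Algebra K A] [Fintype V]
  [GeodesicSpace V] (Φ : A ≃ₐ[K] GeoMatrix K V) {S : V → (A →ₐ[K] K)}

theorem character_unit_self (hS : ∀ σ x, S σ x = Φ x σ σ) (σ : V) :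
    S σ (Φ.symm (unit K σ σ)) = 1 := by
  simp [hS]

theorem character_unit_of_ne (hS : ∀ σ x, S σ x = Φ x σ σ) {σ τ υ : V} (h : ¬(σ = τ ∧ σ = υ)) :
    S σ (Φ.symm (unit K τ υ)) = 0 := by
  simp [hS, unit_apply_of_ne h]

theorem symm_unit_mul {σ τ υ : V} (h : IsBetween σ τ υ) :
    Φ.symm (unit K σ τ) * Φ.symm (unit K τ υ) = Φ.symm (unit K σ υ) := by
  rw [← map_mul, unit_mul_unit h]

theorem isBasicAlgebra (hS : ∀ σ x, S σ x = Φ x σ σ) : IsBasicAlgebra K A := by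
  classical
  refine ⟨Module.Finite.equiv Φ.symm.toLinearEquiv, Fintype.card V, ?_⟩
  let δ : A →ₐ[K] (V → K) := AlgHom.pi S
  have hδ : ∀ x σ, δ x σ = Φ x σ σ := fun x σ => hS σ x
  have hsurj : Function.Surjective δ := fun f => by
    let F : GeoMatrix K V := fun σ τ => if σ = τ then f σ else 0
    refine ⟨Φ.symm F, ?_⟩
    ext σ
    rw [hδ, AlgEquiv.apply_symm_apply]
    simp [F]
  -- An element with a nonzero diagonal entry has a multiple on which a character takes the value
  -- -1, so it is not in the radical. The kernel is an ideal, and its elements are nilpotent because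
  -- their matrices have zero diagonal.
  have hker : Ring.jacobson A = RingHom.ker δ := by
    refine le_antisymm (fun x hx => ?_) (fun x hx => ?_)
    · rw [← Ideal.jacobson_bot, Ideal.mem_jacobson_iff] at hx
      rw [RingHom.mem_ker]
      ext σ
      by_contra hne
      have hne : S σ x ≠ 0 := hne
      -- With this multiplier the character `S σ` takes the value -1 on `z * y * x + z - 1`, which
      -- is supposed to be zero.
      obtain ⟨z, hz⟩ := hx (algebraMap K A (-(S σ x)⁻¹))
      rw [Ideal.mem_bot] at hz
      have := congrArg (S σ) hz
      simp only [map_sub, map_add, map_mul, AlgHom.commutes, map_one, map_zero,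
        Algebra.algebraMap_self, RingHom.id_apply, mul_assoc, neg_mul, mul_neg,
        inv_mul_cancel₀ hne] at this
      simp at this
    · rw [← Ideal.jacobson_bot, Ideal.mem_jacobson_iff]
      intro y
      have hnil : IsNilpotent (y * x) := by
        have h0 : IsNilpotent (Φ (y * x)) := isNilpotent_of_diag_eq_zero fun σ => by
          rw [← hS, map_mul]
          have : S σ x = 0 := congrFun hx σ
          rw [this, mul_zero]
        exact (IsNilpotent.map_iff Φ.injective).1 h0
      obtain ⟨w, hw⟩ := hnil.isUnit_one_add
      refine ⟨↑w⁻¹, ?_⟩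
      have h1 : (↑w⁻¹ : A) * (1 + y * x) = 1 := by rw [← hw, Units.inv_mul]
      rw [mul_add, mul_one, ← mul_assoc] at h1
      rw [Ideal.mem_bot, add_comm, h1, sub_self]
  exact ⟨((Ideal.quotientEquivAlgOfEq K hker).trans
    (Ideal.quotientKerAlgEquivOfSurjective hsurj)).trans
    (AlgEquiv.piCongrLeft' K (fun _ : V => K) (Fintype.equivFin V))⟩

/-- In a module over a geodesic matrix algebra, a nonzero vector `m • E σ τ` with `σ` and `τ` at
the largest possible distance is a common eigenvector. -/
theorem exists_eigenvector (M : Type*) [AddCommGroup M] [Module Aᵐᵒᵖ M] [Nontrivial M] :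
    ∃ (τ : V) (m : M), m ≠ 0 ∧
      ∀ a : A, MulOpposite.op a • m = MulOpposite.op (algebraMap K A (Φ a τ τ)) • m := by
  classical
  obtain ⟨m₀, hm₀⟩ := exists_ne (0 : M)
  let s : Finset (V × V) := Finset.univ.filter fun p =>
    ∃ m : M, MulOpposite.op (Φ.symm (unit K p.1 p.2)) • m ≠ 0
  have hs : s.Nonempty := by
    by_contra hempty
    rw [Finset.not_nonempty_iff_eq_empty, Finset.filter_eq_empty_iff] at hempty
    apply hm₀
    have h1 : (∑ σ : V, MulOpposite.op (Φ.symm (unit K σ σ))) • m₀ = m₀ := by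
      rw [← Finset.op_sum, ← map_sum, sum_unit, map_one, MulOpposite.op_one, one_smul]
    rw [← h1, Finset.sum_smul]
    refine Finset.sum_eq_zero fun σ _ => ?_
    have := hempty (Finset.mem_univ (σ, σ))
    push Not at this
    exact this m₀
  obtain ⟨⟨σ, τ⟩, hp, hmax⟩ := s.exists_max_image (fun p => gdist p.1 p.2) hs
  obtain ⟨m, hm⟩ := (Finset.mem_filter.1 hp).2
  refine ⟨τ, _, hm, fun a => ?_⟩
  rw [smul_smul, smul_smul, ← MulOpposite.op_mul, ← MulOpposite.op_mul]
  have h1 : Φ.symm (unit K σ τ) * a =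
      ∑ υ, (if IsBetween σ τ υ then Φ a τ υ else 0) • Φ.symm (unit K σ υ) := by
    apply Φ.injective
    rw [map_mul, map_sum]
    ext x y
    simp only [AlgEquiv.apply_symm_apply, unit_mul_apply, map_smul, sum_apply, smul_apply]
    by_cases hx : x = σ
    · subst hx
      simp [unit]
    · simp [unit, hx]
  rw [h1, Finset.op_sum, Finset.sum_smul, Finset.sum_eq_single τ]
  · rw [if_pos (isBetween_right σ τ), Algebra.smul_def, Algebra.commutes]
  · intro υ _ hυ
    split_ifs with hb
    · have hd : gdist σ τ < gdist σ υ := by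
        rw [IsBetween] at hb
        have : gdist τ υ ≠ 0 := fun h => hυ (eq_of_gdist_eq_zero h).symm
        omega
      have hnot : (σ, υ) ∉ s := fun h => absurd (hmax _ h) (not_le.2 hd)
      have h0 : MulOpposite.op (Φ.symm (unit K σ υ)) • m = 0 := by
        by_contra hne
        exact hnot (Finset.mem_filter.2 ⟨Finset.mem_univ _, m, hne⟩)
      rw [Algebra.smul_def, Algebra.commutes, MulOpposite.op_mul, mul_smul, h0, smul_zero]
    · simp
  · simp

theorem isCompleteSystemOfSimples (hS : ∀ σ x, S σ x = Φ x σ σ) :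
    IsCompleteSystemOfSimples S := by
  refine ⟨fun σ τ h => ?_, fun M _ _ _ => ?_⟩
  · by_contra hne
    have h1 := character_unit_self Φ hS σ
    rw [h, character_unit_of_ne Φ hS (fun h => hne h.1.symm)] at h1
    exact zero_ne_one h1
  · have := IsSimpleModule.nontrivial Aᵐᵒᵖ M
    obtain ⟨τ, v, hv, heig⟩ := exists_eigenvector Φ M
    -- The eigenvector `v` spans a line that is stable under `A`, and `v` generates the simple
    -- module, so the line is all of `M`.
    let g : K →+ M :=
      { toFun := fun c => MulOpposite.op (algebraMap K A c) • v
        map_zero' := by simp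
        map_add' := fun c d => by rw [map_add, MulOpposite.op_add, add_smul] }
    have hg : ∀ c, g c = MulOpposite.op (algebraMap K A c) • v := fun _ => rfl
    have hbij : Function.Bijective g := by
      refine ⟨(injective_iff_map_eq_zero g).2 fun c hc => ?_, fun m => ?_⟩
      · by_contra hne
        apply hv
        have h1 : MulOpposite.op (algebraMap K A c⁻¹) • g c = v := by
          rw [hg, smul_smul, ← MulOpposite.op_mul, ← map_mul, mul_inv_cancel₀ hne, map_one,
            MulOpposite.op_one, one_smul]
        rw [← h1, hc, smul_zero]
      · obtain ⟨a, ha⟩ := IsSimpleModule.toSpanSingleton_surjective Aᵐᵒᵖ hv m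
        refine ⟨Φ a.unop τ τ, ?_⟩
        rw [hg, ← heig]
        exact ha
    refine ⟨τ, (AddEquiv.ofBijective g hbij).symm, fun a m => ?_⟩
    obtain ⟨c, rfl⟩ := hbij.2 m
    have h1 : Φ (algebraMap K A c * a) τ τ = c * S τ a := by
      rw [← hS, map_mul, AlgHom.commutes, Algebra.algebraMap_self, RingHom.id_apply]
    have h2 : (AddEquiv.ofBijective g hbij).symm (g c) = c :=
      (AddEquiv.ofBijective g hbij).symm_apply_apply c
    rw [h2, AddEquiv.symm_apply_eq, AddEquiv.ofBijective_apply, hg, hg, smul_smul,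
      ← MulOpposite.op_mul, heig, h1]

end Basic

/-! ### Extensions between simple modules -/

section Ext

variable {K : Type u} {A : Type u} {V : Type v} [Field K] [Ring A] [Algebra K A] [Fintype V]
  [GeodesicSpace V] (Φ : A ≃ₐ[K] GeoMatrix K V) {S : V → (A →ₐ[K] K)}

/-- The entry at `(σ, τ)` as a functional on an algebra isomorphic to a geodesic matrix algebra. -/
def entryOf (σ τ : V) : A →ₗ[K] K := entry σ τ ∘ₗ Φ.toLinearMap

theorem entryOf_apply (σ τ : V) (x : A) : entryOf Φ σ τ x = Φ x σ τ := rfl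

theorem eq_of_eq_on_units {f g : A →ₗ[K] K}
    (h : ∀ σ τ : V, f (Φ.symm (unit K σ τ)) = g (Φ.symm (unit K σ τ))) : f = g := by
  have h1 : f ∘ₗ Φ.symm.toLinearMap = g ∘ₗ Φ.symm.toLinearMap := hom_ext h
  refine LinearMap.ext fun x => ?_
  simpa using DFunLike.congr_fun h1 (Φ x)

theorem cocycle_apply {r r' : A →ₐ[K] K} {f : A →ₗ[K] K} (hf : f ∈ extCocycles r r') (x y : A) :
    f (x * y) = r x * f y + f x * r' y := hf x y

/-- Write the unit at `(a, b)` as its product with the diagonal unit at `b`, or as the product of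
the diagonal unit at `a` with it. Characters vanish off the diagonal, so the cocycle identity leaves
only the value at `(a, b)` times `S τ` or `S σ` of that diagonal unit, and one of these two factors
is zero. -/
theorem cocycle_unit_of_ne (hS : ∀ σ x, S σ x = Φ x σ σ) {σ τ : V} {f : A →ₗ[K] K}
    (hf : f ∈ extCocycles (S σ) (S τ)) {a b : V} (hab : a ≠ b) (h : ¬(a = σ ∧ b = τ)) :
    f (Φ.symm (unit K a b)) = 0 := by
  by_cases ha : a = σ
  · have hb : b ≠ τ := fun hb => h ⟨ha, hb⟩
    rw [← symm_unit_mul Φ (isBetween_right a b), cocycle_apply hf,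
      character_unit_of_ne Φ hS fun h => hb h.1.symm,
      character_unit_of_ne Φ hS fun h => hab (h.1.symm.trans h.2)]
    simp
  · rw [← symm_unit_mul Φ (isBetween_left a b), cocycle_apply hf,
      character_unit_of_ne Φ hS fun h => ha h.1.symm,
      character_unit_of_ne Φ hS fun h => hab (h.1.symm.trans h.2)]
    simp

theorem cocycle_unit_self (hS : ∀ σ x, S σ x = Φ x σ σ) {σ τ : V} {f : A →ₗ[K] K}
    (hf : f ∈ extCocycles (S σ) (S τ)) {a : V} (h1 : a ≠ σ) (h2 : a ≠ τ) :
    f (Φ.symm (unit K a a)) = 0 := by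
  rw [← symm_unit_mul Φ (isBetween_left a a), cocycle_apply hf,
    character_unit_of_ne Φ hS fun h => h1 h.1.symm, character_unit_of_ne Φ hS fun h => h2 h.1.symm]
  simp

theorem cocycle_eq_zero (hS : ∀ σ x, S σ x = Φ x σ σ) {σ : V} {f : A →ₗ[K] K}
    (hf : f ∈ extCocycles (S σ) (S σ)) : f = 0 := by
  refine eq_of_eq_on_units Φ fun a b => ?_
  rw [LinearMap.zero_apply]
  by_cases hab : a = b
  · subst hab
    by_cases ha : a = σ
    · subst ha
      have h := cocycle_apply hf (Φ.symm (unit K a a)) (Φ.symm (unit K a a))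
      rw [symm_unit_mul Φ (isBetween_left a a), character_unit_self Φ hS] at h
      simpa using h
    · exact cocycle_unit_self Φ hS hf ha ha
  · exact cocycle_unit_of_ne Φ hS hf hab fun h => hab (h.1.trans h.2.symm)

/-- The diagonal units at `σ` and `τ` are orthogonal, which forces opposite values of `f` on them.
So on the diagonal `f` is a multiple of the coboundary, and off the diagonal only the value at `(σ,
τ)` can survive. -/
theorem cocycle_eq (hS : ∀ σ x, S σ x = Φ x σ σ) {σ τ : V} (hne : σ ≠ τ) {f : A →ₗ[K] K}
    (hf : f ∈ extCocycles (S σ) (S τ)) :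
    f = f (Φ.symm (unit K σ σ)) • ((S σ).toLinearMap - (S τ).toLinearMap)
      + f (Φ.symm (unit K σ τ)) • entryOf Φ σ τ := by
  have hsum : f (Φ.symm (unit K τ τ)) = - f (Φ.symm (unit K σ σ)) := by
    have h := cocycle_apply hf (Φ.symm (unit K σ σ)) (Φ.symm (unit K τ τ))
    rw [← map_mul, unit_mul_unit_of_ne hne, character_unit_self Φ hS, character_unit_self Φ hS,
      map_zero, map_zero] at h
    linear_combination -h
  refine eq_of_eq_on_units Φ fun a b => ?_
  simp only [LinearMap.add_apply, LinearMap.smul_apply, LinearMap.sub_apply,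
    AlgHom.toLinearMap_apply, entryOf_apply, AlgEquiv.apply_symm_apply, hS, smul_eq_mul]
  by_cases hab : a = b
  · subst hab
    rw [unit_apply_of_ne (a := σ) (b := τ) fun h => hne (h.1.trans h.2.symm)]
    by_cases ha : a = σ
    · subst ha
      rw [unit_self, unit_apply_of_ne fun h => hne h.1.symm]
      ring
    · by_cases ha' : a = τ
      · subst ha'
        rw [unit_self, unit_apply_of_ne fun h => hne h.1, hsum]
        ring
      · rw [unit_apply_of_ne fun h => ha h.1.symm, unit_apply_of_ne fun h => ha' h.1.symm,
          cocycle_unit_self Φ hS hf ha ha']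
        ring
  · rw [unit_apply_of_ne fun h => hab (h.1.symm.trans h.2),
      unit_apply_of_ne fun h => hab (h.1.symm.trans h.2)]
    by_cases h : a = σ ∧ b = τ
    · obtain ⟨rfl, rfl⟩ := h
      rw [unit_self]
      ring
    · rw [cocycle_unit_of_ne Φ hS hf hab h, unit_apply_of_ne fun h' => h ⟨h'.1.symm, h'.2.symm⟩]
      ring

/-- If the distance is not one, an intermediate point of a geodesic factors the unit at `(σ, τ)`
into two off-diagonal units, on which both characters vanish. -/
theorem cocycle_unit_eq_zero (hS : ∀ σ x, S σ x = Φ x σ σ) {σ τ : V} (hne : σ ≠ τ)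
    (hd : gdist σ τ ≠ 1) {f : A →ₗ[K] K} (hf : f ∈ extCocycles (S σ) (S τ)) :
    f (Φ.symm (unit K σ τ)) = 0 := by
  obtain ⟨υ, h1, h2⟩ := exists_step hne
  have hσ : σ ≠ υ := by rintro rfl; rw [gdist_self] at h1; omega
  have hτ : τ ≠ υ := by rintro rfl; exact hd h1
  rw [← symm_unit_mul Φ h2, cocycle_apply hf, character_unit_of_ne Φ hS fun h => hσ h.2,
    character_unit_of_ne Φ hS fun h => hτ h.1]
  simp

/-- No third point lies between two points at distance one, so the product formula for the entry at
`(σ, τ)` has exactly the two terms of the cocycle identity. -/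
theorem entryOf_mem_cocycles (hS : ∀ σ x, S σ x = Φ x σ σ) {σ τ : V} (hd : gdist σ τ = 1) :
    entryOf Φ σ τ ∈ extCocycles (S σ) (S τ) := by
  classical
  intro x y
  have hne : σ ≠ τ := by rintro rfl; rw [gdist_self] at hd; omega
  rw [entryOf_apply, entryOf_apply, entryOf_apply, hS, hS, map_mul, mul_apply,
    ← Finset.sum_subset (Finset.subset_univ {σ, τ}), Finset.sum_pair hne,
    if_pos (isBetween_left σ τ), if_pos (isBetween_right σ τ)]
  intro υ _ hυ
  rw [if_neg]
  intro hb
  rw [IsBetween, hd] at hb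
  simp only [Finset.mem_insert, Finset.mem_singleton, not_or] at hυ
  have h1 : gdist σ υ ≠ 0 := fun h => hυ.1 (eq_of_gdist_eq_zero h).symm
  have h2 : gdist υ τ ≠ 0 := fun h => hυ.2 (eq_of_gdist_eq_zero h)
  omega

theorem ext1_eq_bot (hS : ∀ σ x, S σ x = Φ x σ σ) {σ τ : V} (hd : gdist σ τ ≠ 1) :
    Ext1 (S σ) (S τ) = ⊥ := by
  rw [Ext1, eq_bot_iff, Submodule.map_le_iff_le_comap]
  intro f hf
  rw [Submodule.mem_comap, Submodule.mem_bot, Submodule.mkQ_apply, Submodule.Quotient.mk_eq_zero]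
  by_cases hne : σ = τ
  · subst hne
    rw [cocycle_eq_zero Φ hS hf]
    exact Submodule.zero_mem _
  · rw [cocycle_eq Φ hS hne hf, cocycle_unit_eq_zero Φ hS hne hd hf, zero_smul, add_zero]
    exact Submodule.smul_mem _ _ (Submodule.mem_span_singleton_self _)

theorem ext1_eq_span (hS : ∀ σ x, S σ x = Φ x σ σ) {σ τ : V} (hd : gdist σ τ = 1) :
    Ext1 (S σ) (S τ) =
      Submodule.span K {(extCoboundaries (S σ) (S τ)).mkQ (entryOf Φ σ τ)} := by
  have hne : σ ≠ τ := by rintro rfl; rw [gdist_self] at hd; omega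
  refine le_antisymm ?_ ?_
  · rintro _ ⟨f, hf, rfl⟩
    rw [cocycle_eq Φ hS hne hf, map_add, map_smul, map_smul]
    have h0 : (extCoboundaries (S σ) (S τ)).mkQ ((S σ).toLinearMap - (S τ).toLinearMap) = 0 := by
      rw [Submodule.mkQ_apply, Submodule.Quotient.mk_eq_zero]
      exact Submodule.mem_span_singleton_self _
    rw [h0, smul_zero, zero_add]
    exact Submodule.smul_mem _ _ (Submodule.mem_span_singleton_self _)
  · rw [Submodule.span_singleton_le_iff_mem]
    exact Submodule.mem_map_of_mem (entryOf_mem_cocycles Φ hS hd)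

theorem mkQ_entryOf_ne_zero (hS : ∀ σ x, S σ x = Φ x σ σ) {σ τ : V} (hd : gdist σ τ = 1) :
    (extCoboundaries (S σ) (S τ)).mkQ (entryOf Φ σ τ) ≠ 0 := by
  have hne : σ ≠ τ := by rintro rfl; rw [gdist_self] at hd; omega
  rw [Submodule.mkQ_apply, Ne, Submodule.Quotient.mk_eq_zero, extCoboundaries,
    Submodule.mem_span_singleton]
  rintro ⟨c, hc⟩
  have h := DFunLike.congr_fun hc (Φ.symm (unit K σ τ))
  simp [entryOf_apply, hS, unit_apply_of_ne fun h : σ = σ ∧ σ = τ => hne h.2,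
    unit_apply_of_ne fun h : τ = σ ∧ τ = τ => hne h.1.symm] at h

/-- The quiver has one arrow from each point to each point at distance one, and no others. -/
structure IsGeodesicQuiver (V : Type v) [Quiver.{v} V] [GeodesicSpace V] : Prop where
  subsingleton : ∀ σ τ : V, Subsingleton (σ ⟶ τ)
  nonempty_iff : ∀ σ τ : V, Nonempty (σ ⟶ τ) ↔ gdist σ τ = 1

theorem isOrdinaryQuiver [Quiver.{v} V] (hV : IsGeodesicQuiver V)
    (hS : ∀ σ x, S σ x = Φ x σ σ) : IsOrdinaryQuiver S := by
  refine ⟨isBasicAlgebra Φ hS, isCompleteSystemOfSimples Φ hS, fun σ τ => ?_⟩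
  have := hV.subsingleton σ τ
  refine ⟨inferInstance, ?_⟩
  by_cases hd : gdist σ τ = 1
  · have := (hV.nonempty_iff σ τ).2 hd
    rw [ext1_eq_span Φ hS hd, finrank_span_singleton (mkQ_entryOf_ne_zero Φ hS hd)]
    refine ⟨inferInstance, ?_⟩
    rw [Nat.card_eq_one_iff_unique.2 ⟨inferInstance, inferInstance⟩]
  · have : IsEmpty (σ ⟶ τ) := not_nonempty_iff.1 fun h => hd ((hV.nonempty_iff σ τ).1 h)
    rw [ext1_eq_bot Φ hS hd]
    exact ⟨inferInstance, by simp⟩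

end Ext

end GeoMatrix

end

noncomputable section

open GeodesicSpace

/-- The coefficient of a path in an element of the path algebra. -/
def PathAlgebra.coeff (K : Type u) {V : Type v} [CommRing K] [Quiver.{v} V] (p : AnyPath V) :
    PathAlgebra K V →ₗ[K] K :=
  (Finsupp.lapply p : (AnyPath V →₀ K) →ₗ[K] K)

theorem PathAlgebra.mem_arrowPower {K : Type u} {V : Type v} [CommRing K] [Quiver.{v} V] {m : ℕ}
    {x : PathAlgebra K V} (hx : ∀ p : AnyPath V, p.2.2.length < m → PathAlgebra.coeff K p x = 0) :
    x ∈ PathAlgebra.arrowPower K V m := by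
  change AnyPath V →₀ K at x
  have h1 : x = ∑ p ∈ x.support, x p • (PathAlgebra.of K p : AnyPath V →₀ K) := by
    conv_lhs => rw [← Finsupp.sum_single x]
    exact Finset.sum_congr rfl fun p _ => (Finsupp.smul_single_one p _).symm
  rw [h1]
  refine Submodule.sum_mem _ fun p hp => Submodule.smul_mem _ _ (Submodule.subset_span ⟨p, ?_, rfl⟩)
  by_contra hlt
  exact Finsupp.mem_support_iff.1 hp (hx p (by omega))

namespace GeoMatrix

/-! ## The presentation by the quiver of points at distance one -/

section Presentation

variable {K : Type u} {V : Type v} [Quiver.{v} V] [GeodesicSpace V]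

theorem gdist_le_length (hV : IsGeodesicQuiver V) {σ τ : V} (p : Quiver.Path σ τ) :
    gdist σ τ ≤ p.length := by
  induction p with
  | nil => rw [gdist_self]; exact Nat.zero_le _
  | @cons b c p e ih =>
    have h1 := gdist_triangle σ b c
    have h2 := (hV.nonempty_iff b c).1 ⟨e⟩
    rw [Quiver.Path.length_cons]
    omega

theorem exists_geodesic (hV : IsGeodesicQuiver V) (σ τ : V) :
    ∃ p : Quiver.Path σ τ, p.length = gdist σ τ := by
  induction hn : gdist σ τ generalizing σ with
  | zero =>
    obtain rfl := eq_of_gdist_eq_zero hn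
    exact ⟨Quiver.Path.nil, rfl⟩
  | succ n ih =>
    obtain ⟨υ, h1, h2⟩ := exists_step (σ := σ) (τ := τ) (by
      rintro rfl; rw [gdist_self] at hn; omega)
    obtain ⟨p, hp⟩ := ih υ (by omega)
    obtain ⟨e⟩ := (hV.nonempty_iff σ υ).2 h1
    exact ⟨e.toPath.comp p, by simp [hp, add_comm]⟩

/-- Trivial paths and arrows are the only geodesics between their end points. Hence no relation
involves paths of length at most one, which puts the kernel of `ofPathHom` into the square of the
arrow ideal. -/
theorem eq_of_length_le_one (hV : IsGeodesicQuiver V) {σ τ : V} {p q : Quiver.Path σ τ}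
    (hp : p.length ≤ 1) (hq : q.length = gdist σ τ) : p.length = gdist σ τ ∧ q = p := by
  have hle := gdist_le_length hV p
  cases p with
  | nil =>
    rw [gdist_self] at hq ⊢
    exact ⟨rfl, Quiver.Path.eq_nil_of_length_zero q hq⟩
  | @cons b _ p e =>
    rw [Quiver.Path.length_cons] at hp
    have hp0 : p.length = 0 := by omega
    obtain rfl := Quiver.Path.eq_of_length_zero p hp0
    have hd := (hV.nonempty_iff _ _).1 ⟨e⟩
    refine ⟨by rw [Quiver.Path.length_cons, hp0, hd], ?_⟩
    rw [hd] at hq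
    cases q with
    | nil => simp at hq
    | @cons b' _ q e' =>
      rw [Quiver.Path.length_cons] at hq
      have hq0 : q.length = 0 := by omega
      obtain rfl := Quiver.Path.eq_of_length_zero q hq0
      have := hV.subsingleton σ τ
      rw [Quiver.Path.eq_nil_of_length_zero p hp0, Quiver.Path.eq_nil_of_length_zero q hq0,
        Subsingleton.elim e e']

variable [Fintype V] [CommRing K]

/-- The image of a path in the geodesic matrix algebra. -/
def ofPath (K : Type u) [CommRing K] (p : AnyPath V) : GeoMatrix K V :=
  if p.2.2.length = gdist p.1 p.2.1 then unit K p.1 p.2.1 else 0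

/-- A concatenation is geodesic exactly when both parts are geodesic and the point where they meet
lies between the end points. -/
theorem ofPath_mul (hV : IsGeodesicQuiver V) {a b c : V} (p : Quiver.Path a b)
    (q : Quiver.Path b c) :
    ofPath K ⟨a, b, p⟩ * ofPath K ⟨b, c, q⟩ = ofPath K ⟨a, c, p.comp q⟩ := by
  have h1 := gdist_le_length hV p
  have h2 := gdist_le_length hV q
  have h3 := gdist_triangle a b c
  simp only [ofPath, Quiver.Path.length_comp]
  by_cases hb : IsBetween a b c
  · have hb' : gdist a b + gdist b c = gdist a c := hb
    by_cases hp : p.length = gdist a b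
    · by_cases hq : q.length = gdist b c
      · rw [if_pos hp, if_pos hq, if_pos (by omega), unit_mul_unit hb]
      · rw [if_neg hq, if_neg (by omega : ¬p.length + q.length = gdist a c), mul_zero]
    · rw [if_neg hp, if_neg (by omega : ¬p.length + q.length = gdist a c), zero_mul]
  · have hb' : ¬gdist a b + gdist b c = gdist a c := hb
    rw [if_neg (by omega : ¬p.length + q.length = gdist a c)]
    by_cases hp : p.length = gdist a b
    · by_cases hq : q.length = gdist b c
      · rw [if_pos hp, if_pos hq, unit_mul_unit_of_not hb]
      · rw [if_neg hq, mul_zero]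
    · rw [if_neg hp, zero_mul]

theorem ofPath_mul_of_ne {a b c d : V} (p : Quiver.Path a b) (q : Quiver.Path c d) (h : b ≠ c) :
    ofPath K ⟨a, b, p⟩ * ofPath K ⟨c, d, q⟩ = 0 := by
  simp only [ofPath]
  split_ifs <;> simp [unit_mul_unit_of_ne h]

theorem ofPath_nil (a : V) : ofPath K ⟨a, a, Quiver.Path.nil⟩ = unit K a a := by
  simp [ofPath, gdist_self]

/-- The linear map from the path algebra that sends geodesics to matrix units and all other paths
to zero. -/
def ofPathLin (K : Type u) (V : Type v) [Quiver.{v} V] [GeodesicSpace V]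
    [Fintype V] [CommRing K] : PathAlgebra K V →ₗ[K] GeoMatrix K V :=
  Finsupp.linearCombination K (ofPath K)

theorem ofPathLin_of (p : AnyPath V) : ofPathLin K V (PathAlgebra.of K p) = ofPath K p := by
  unfold ofPathLin PathAlgebra.of
  erw [Finsupp.linearCombination_single, one_smul]

/-- The algebra homomorphism from the path algebra that sends geodesics to matrix units and all
other paths to zero. -/
def ofPathHom (K : Type u) [CommRing K] (hV : IsGeodesicQuiver V) :
    PathAlgebra K V →ₐ[K] GeoMatrix K V :=
  AlgHom.ofLinearMap (ofPathLin K V)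
    (by
      rw [PathAlgebra.one_def, map_sum, ← sum_unit]
      exact Finset.sum_congr rfl fun a _ => (ofPathLin_of _).trans (ofPath_nil a))
    (fun x y => by
      refine DFunLike.congr_fun (f := (ofPathLin K V) ∘ₗ (LinearMap.mul K _).flip y)
        (g := (LinearMap.mul K _).flip (ofPathLin K V y) ∘ₗ (ofPathLin K V))
        (PathAlgebra.hom_ext fun p => ?_) x
      refine DFunLike.congr_fun (f := (ofPathLin K V) ∘ₗ LinearMap.mul K _ (PathAlgebra.of K p))
        (g := (LinearMap.mul K _) (ofPathLin K V (PathAlgebra.of K p)) ∘ₗ (ofPathLin K V))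
        (PathAlgebra.hom_ext fun q => ?_) y
      obtain ⟨a, b, p⟩ := p
      obtain ⟨c, d, q⟩ := q
      simp only [LinearMap.comp_apply, LinearMap.mul_apply', ofPathLin_of]
      by_cases h : b = c
      · subst h
        rw [PathAlgebra.of_mul_of_comp, ofPathLin_of, ofPath_mul hV]
      · rw [PathAlgebra.of_mul_of_ne K p q h, ofPath_mul_of_ne p q h, map_zero])

theorem ofPathHom_of (hV : IsGeodesicQuiver V) (p : AnyPath V) :
    ofPathHom K hV (PathAlgebra.of K p) = ofPath K p := ofPathLin_of p

theorem ofPathHom_vertex (hV : IsGeodesicQuiver V) (a : V) :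
    ofPathHom K hV (PathAlgebra.vertex K a) = unit K a a :=
  (ofPathLin_of _).trans (ofPath_nil a)

theorem ofPathHom_arrow (hV : IsGeodesicQuiver V) {a b : V} (f : a ⟶ b) :
    ofPathHom K hV (PathAlgebra.arrow K f) = unit K a b := by
  refine (ofPathLin_of _).trans ?_
  rw [ofPath, if_pos]
  exact ((hV.nonempty_iff a b).1 ⟨f⟩).symm

theorem ofPathHom_surjective (hV : IsGeodesicQuiver V) :
    Function.Surjective (ofPathHom K hV) := by
  rw [← AlgHom.range_eq_top, eq_top_iff]
  intro F _
  rw [eq_sum_unit F]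
  refine Subalgebra.sum_mem _ fun σ _ => Subalgebra.sum_mem _ fun τ _ =>
    Subalgebra.smul_mem _ ?_ _
  obtain ⟨p, hp⟩ := exists_geodesic hV σ τ
  exact ⟨PathAlgebra.of K ⟨σ, τ, p⟩, (ofPathLin_of _).trans (if_pos hp)⟩

/-- A path `q` contributes to the entry at the end points of `p` only if it is a geodesic between
them, and then `q = p`. -/
theorem ofPathHom_apply_short (hV : IsGeodesicQuiver V) (p : AnyPath V) (hp : p.2.2.length ≤ 1)
    (x : PathAlgebra K V) : ofPathHom K hV x p.1 p.2.1 = PathAlgebra.coeff K p x := by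
  refine DFunLike.congr_fun (f := entry p.1 p.2.1 ∘ₗ ofPathLin K V)
    (g := PathAlgebra.coeff K p) (PathAlgebra.hom_ext fun q => ?_) x
  rw [LinearMap.comp_apply, ofPathLin_of, entry_apply]
  obtain ⟨a, b, p⟩ := p
  obtain ⟨c, d, q⟩ := q
  change _ = Finsupp.single (⟨c, d, q⟩ : AnyPath V) (1 : K) ⟨a, b, p⟩
  by_cases h : c = a ∧ d = b
  · obtain ⟨rfl, rfl⟩ := h
    by_cases hq : q.length = gdist c d
    · obtain ⟨_, rfl⟩ := eq_of_length_le_one hV hp hq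
      rw [ofPath, if_pos hq, Finsupp.single_eq_same, unit_self]
    · rw [ofPath, if_neg hq, zero_apply, Finsupp.single_eq_of_ne]
      rintro h
      simp only [Sigma.mk.injEq, heq_eq_eq, true_and] at h
      subst h
      obtain ⟨r, hr⟩ := exists_geodesic hV c d
      exact hq (eq_of_length_le_one hV hp hr).1
  · rw [Finsupp.single_eq_of_ne]
    · rw [ofPath]
      split_ifs
      · exact unit_apply_of_ne fun h' => h ⟨h'.1.symm, h'.2.symm⟩
      · rfl
    · intro h'
      simp only [Sigma.mk.injEq] at h'
      obtain ⟨rfl, h'⟩ := h'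
      simp only [heq_eq_eq, Sigma.mk.injEq] at h'
      exact h ⟨rfl, h'.1.symm⟩

theorem mem_arrowPower_two (hV : IsGeodesicQuiver V) {x : PathAlgebra K V}
    (hx : ofPathHom K hV x = 0) : x ∈ PathAlgebra.arrowPower K V 2 :=
  PathAlgebra.mem_arrowPower fun p hp => by
    rw [← ofPathHom_apply_short hV p (by omega), hx, zero_apply]

theorem exists_arrowPower_eq_zero (hV : IsGeodesicQuiver V) :
    ∃ m : ℕ, 2 ≤ m ∧ ∀ x ∈ PathAlgebra.arrowPower K V m, ofPathHom K hV x = 0 := by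
  refine ⟨∑ σ : V, ∑ τ : V, gdist σ τ + 2, by omega, fun x hx => ?_⟩
  induction hx using Submodule.span_induction with
  | zero => exact map_zero _
  | add x y _ _ hx hy => rw [map_add, hx, hy, add_zero]
  | smul c x _ hx => rw [map_smul, hx, smul_zero]
  | mem x hx =>
    obtain ⟨⟨a, b, p⟩, hp, rfl⟩ := hx
    rw [ofPathHom_of, ofPath, if_neg]
    have h1 : gdist a b ≤ ∑ σ : V, ∑ τ : V, gdist σ τ :=
      (Finset.single_le_sum (f := fun τ => gdist a τ) (by simp) (Finset.mem_univ b)).trans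
        (Finset.single_le_sum (f := fun σ => ∑ τ : V, gdist σ τ) (by simp) (Finset.mem_univ a))
    dsimp only at hp ⊢
    omega

end Presentation

theorem isGabrielPresentation {K : Type u} {A : Type u} {V : Type v} [Field K] [Ring A]
    [Algebra K A] [Fintype V] [GeodesicSpace V] [Quiver.{v} V] (hV : IsGeodesicQuiver V)
    (Φ : A ≃ₐ[K] GeoMatrix K V) {S : V → (A →ₐ[K] K)} (hS : ∀ σ x, S σ x = Φ x σ σ) :
    IsGabrielPresentation S (Φ.symm.toAlgHom.comp (ofPathHom K hV)) where
  surjective := Φ.symm.surjective.comp (ofPathHom_surjective hV)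
  admissible_lower := by
    obtain ⟨m, hm, h⟩ := exists_arrowPower_eq_zero (K := K) hV
    exact ⟨m, hm, fun x hx => (congrArg Φ.symm (h x hx)).trans (map_zero _)⟩
  admissible_upper x hx := mem_arrowPower_two hV (Φ.symm.injective (hx.trans (map_zero _).symm))
  simple_self v := (congrArg (fun y => S v (Φ.symm y)) (ofPathHom_vertex hV v)).trans
    (character_unit_self Φ hS v)
  simple_ne v w h := (congrArg (fun y => S w (Φ.symm y)) (ofPathHom_vertex hV v)).trans
    (character_unit_of_ne Φ hS fun h' => h h'.1.symm)

end GeoMatrix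

/-! ## Right ideals generated by idempotents -/

section Idempotent

variable {A : Type u} [Ring A] {e : A}

theorem mem_span_idempotent_iff (he : e * e = e) {x : A} :
    x ∈ Submodule.span Aᵐᵒᵖ {e} ↔ e * x = x := by
  rw [Submodule.mem_span_singleton]
  constructor
  · rintro ⟨a, rfl⟩
    rw [MulOpposite.smul_eq_mul_unop, ← mul_assoc, he]
  · intro h
    exact ⟨MulOpposite.op x, h⟩

theorem projective_span_idempotent (he : e * e = e) :
    Module.Projective Aᵐᵒᵖ (Submodule.span Aᵐᵒᵖ {e}) := by
  have : Module.Projective Aᵐᵒᵖ A := Module.Projective.of_equiv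
    ({ MulOpposite.opAddEquiv.symm with map_smul' := fun _ _ => rfl } : Aᵐᵒᵖ ≃ₗ[Aᵐᵒᵖ] A)
  let s : A →ₗ[Aᵐᵒᵖ] Submodule.span Aᵐᵒᵖ {e} :=
    { toFun := fun x => ⟨e * x, (mem_span_idempotent_iff he).2 (by rw [← mul_assoc, he])⟩
      map_add' := fun x y => Subtype.ext (mul_add e x y)
      map_smul' := fun a x => Subtype.ext (mul_assoc e x a.unop).symm }
  refine Module.Projective.of_split (Submodule.subtype _) s (LinearMap.ext fun x => ?_)
  exact Subtype.ext ((mem_span_idempotent_iff he).1 x.2)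

/-- An idempotent `e` with `e A e = K e` generates an indecomposable right ideal. -/
theorem isIndecomposableModule_span_idempotent {K : Type u} [Field K] [Algebra K A]
    (he : e * e = e) (he0 : e ≠ 0) (hK : ∀ x : A, ∃ c : K, e * x * e = c • e) :
    IsIndecomposableModule Aᵐᵒᵖ (Submodule.span Aᵐᵒᵖ {e}) := by
  let e' : Submodule.span Aᵐᵒᵖ {e} := ⟨e, Submodule.mem_span_singleton_self e⟩
  have he' : (e' : A) = e := rfl
  -- Here `x * e = e * x * e` is a nonzero multiple of `e`, so `p` contains the generator `e`.
  have key : ∀ (p : Submodule Aᵐᵒᵖ (Submodule.span Aᵐᵒᵖ {e})), ∀ x ∈ p, (x : A) * e ≠ 0 →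
      p = ⊤ := by
    intro p x hx hne
    obtain ⟨c, hc⟩ := hK x
    rw [(mem_span_idempotent_iff he).1 x.2] at hc
    have hc0 : c ≠ 0 := by
      rintro rfl
      exact hne (by rw [hc, zero_smul])
    have hmem : e' ∈ p := by
      have h1 : MulOpposite.op (e * algebraMap K A c⁻¹) • x = e' := by
        refine Subtype.ext ?_
        change (x : A) * (e * algebraMap K A c⁻¹) = e
        rw [← mul_assoc, hc, ← Algebra.commutes, ← Algebra.smul_def, smul_smul,
          inv_mul_cancel₀ hc0, one_smul]
      rw [← h1]
      exact p.smul_mem _ hx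
    refine eq_top_iff.2 fun y _ => ?_
    have h2 : MulOpposite.op (y : A) • e' = y :=
      Subtype.ext ((mem_span_idempotent_iff he).1 y.2)
    rw [← h2]
    exact p.smul_mem _ hmem
  refine ⟨⟨e', 0, fun h => he0 (congrArg Subtype.val h)⟩, fun p q hpq => ?_⟩
  have htop : e' ∈ p ⊔ q := by rw [hpq.sup_eq_top]; exact Submodule.mem_top
  obtain ⟨x, hx, y, hy, hxy⟩ := Submodule.mem_sup.1 htop
  by_cases h : (x : A) * e = 0
  · left
    have h1 : (y : A) * e ≠ 0 := fun hy0 => he0 (by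
      have h2 : ((x : A) + y) * e = e := by rw [← Submodule.coe_add, hxy, he', he]
      rw [← h2, add_mul, h, hy0, add_zero])
    have := key q y hy h1
    rw [this] at hpq
    exact eq_bot_of_isCompl_top hpq
  · right
    have := key p x hx h
    rw [this] at hpq
    exact eq_bot_of_top_isCompl hpq

end Idempotent

end

noncomputable section

open GeodesicSpace

/-! ## The quiver on `𝕊₄` as a geodesic space -/

namespace S4Quiver

instance : DecidableEq S4Quiver := inferInstanceAs (DecidableEq (Equiv.Perm (Fin 4)))

/-- The rank of a letter in the order `3 < 1 < 4 < 2`, in which the letters exchanged by the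
transpositions `t i` are adjacent. -/
def rank : Fin 4 → Fin 4 := ![1, 3, 0, 2]

/-- The number of pairs of points whose images under `σ` and `τ` are ordered differently. -/
def discordance (σ τ : S4Quiver) : ℕ :=
  (Finset.univ.filter fun x : Fin 4 × Fin 4 =>
    rank (σ.perm x.1) < rank (σ.perm x.2) ∧ rank (τ.perm x.2) < rank (τ.perm x.1)).card

theorem discordance_mul_right (σ τ υ : S4Quiver) :
    discordance (σ * υ) (τ * υ) = discordance σ τ := by
  refine Finset.card_equiv (Equiv.prodCongr υ.perm υ.perm) fun x => ?_
  simp only [Finset.mem_filter, Finset.mem_univ, true_and]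
  rfl

/-- Reduces statements about pairs of vertices to statements about the 24 distances from the
identity, which are checked one by one. -/
theorem discordance_eq_one_left (σ τ : S4Quiver) :
    discordance σ τ = discordance 1 (τ * σ⁻¹) := by
  rw [← discordance_mul_right σ τ σ⁻¹, mul_inv_cancel]

theorem discordance_triangle (σ τ υ : S4Quiver) :
    discordance σ υ ≤ discordance σ τ + discordance τ υ := by
  refine (Finset.card_le_card fun x hx => ?_).trans (Finset.card_union_le _ _)
  simp only [Finset.mem_union, Finset.mem_filter, Finset.mem_univ, true_and] at hx ⊢
  rcases lt_trichotomy (rank (τ.perm x.1)) (rank (τ.perm x.2)) with h | h | h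
  · exact Or.inr ⟨h, hx.2⟩
  · have h1 : x.1 = x.2 := τ.perm.injective ((by decide : Function.Injective rank) h)
    rw [h1] at hx
    exact absurd hx.1 (lt_irrefl _)
  · exact Or.inl ⟨hx.1, h⟩

theorem eq_one_of_discordance_eq_zero :
    ∀ σ : S4Quiver, discordance 1 σ = 0 → 1 = σ := by
  decide +kernel

theorem exists_t_discordance :
    ∀ σ : S4Quiver, 1 ≠ σ → ∃ i, discordance 1 (t i) = 1 ∧
      discordance 1 (t i) + discordance (t i) σ = discordance 1 σ := by
  decide +kernel

theorem discordance_t : ∀ i, discordance 1 (t i) = 1 := by decide +kernel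

theorem eq_t_of_discordance_eq_one :
    ∀ σ : S4Quiver, discordance 1 σ = 1 → ∃ i, t i = σ := by
  decide +kernel

instance : GeodesicSpace S4Quiver where
  gdist := discordance
  gdist_self σ := by
    refine Finset.card_eq_zero.2 (Finset.filter_eq_empty_iff.2 fun x _ h => ?_)
    exact lt_asymm h.1 h.2
  eq_of_gdist_eq_zero {σ τ} h := by
    rw [discordance_eq_one_left] at h
    exact (mul_inv_eq_one.1 (eq_one_of_discordance_eq_zero _ h).symm).symm
  gdist_triangle := discordance_triangle
  exists_step {σ τ} h := by
    obtain ⟨i, h1, h2⟩ := exists_t_discordance (τ * σ⁻¹) fun h' =>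
      h (mul_inv_eq_one.1 h'.symm).symm
    refine ⟨t i * σ, ?_, ?_⟩
    · rw [discordance_eq_one_left, mul_inv_cancel_right, h1]
    · rw [discordance_eq_one_left σ (t i * σ), mul_inv_cancel_right, discordance_eq_one_left σ τ,
        ← h2, ← discordance_mul_right (t i) (τ * σ⁻¹) σ, inv_mul_cancel_right]

theorem gdist_eq (σ τ : S4Quiver) : gdist σ τ = discordance σ τ := rfl

theorem gdist_mul_right (σ τ υ : S4Quiver) : gdist (σ * υ) (τ * υ) = gdist σ τ :=
  discordance_mul_right σ τ υ

theorem gdist_t_mul (σ : S4Quiver) (i : Fin 3) : gdist σ (t i * σ) = 1 := by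
  rw [gdist_eq, discordance_eq_one_left, mul_inv_cancel_right, discordance_t]

theorem t_injective : Function.Injective t := by decide +kernel

theorem isGeodesicQuiver : GeoMatrix.IsGeodesicQuiver S4Quiver where
  subsingleton σ τ := ⟨fun f g => Subtype.ext (t_injective (mul_right_cancel (f.2.trans g.2.symm)))⟩
  nonempty_iff σ τ := by
    constructor
    · rintro ⟨i, rfl⟩
      exact gdist_t_mul σ i
    · intro h
      rw [gdist_eq, discordance_eq_one_left] at h
      obtain ⟨i, hi⟩ := eq_t_of_discordance_eq_one _ h
      exact ⟨⟨i, by rw [hi, inv_mul_cancel_right]⟩⟩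

end S4Quiver

/-! ## The deformed Fomin-Kirillov algebra and the geodesic matrix algebra of `𝕊₄` -/

namespace DeformedFK

/-- For `i > j`, the expansion of `e y_{ij}` in the basis elements of `e B`, where `B` is the
geodesic matrix algebra: pairs of the values of a permutation at `0, 1, 2` and a coefficient. -/
def lowerRow : Fin 4 → Fin 4 → List ((Fin 4 × Fin 4 × Fin 4) × ℤ)
  | 2, 1 => [((1, 3, 0), -1), ((1, 0, 3), -1)]
  | 2, 0 => [((2, 1, 0), 1), ((3, 1, 0), -1), ((3, 2, 0), -1), ((1, 0, 3), 1), ((3, 0, 1), -1)]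
  | 3, 1 => [((0, 3, 2), 1), ((1, 3, 2), -1), ((2, 3, 1), -1), ((1, 0, 3), 1), ((1, 2, 3), -1)]
  | 3, 0 => [((3, 1, 2), -1), ((2, 1, 3), 1), ((3, 0, 2), 1), ((2, 3, 1), -1), ((2, 0, 3), -1),
      ((3, 2, 0), -1), ((1, 0, 3), -1)]
  | _, _ => []

/-- The coefficient of `e y_{ij}` at a permutation. -/
def rowCoeff (i j : Fin 4) (σ : S4Quiver) : ℤ :=
  if i < j then (if σ = 1 then 1 else 0)
    - ((lowerRow j i).lookup (σ.perm 0, σ.perm 1, σ.perm 2)).getD 0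
  else ((lowerRow i j).lookup (σ.perm 0, σ.perm 1, σ.perm 2)).getD 0

/-- The coefficient of `e y_{ij} y_{kl}` at a permutation. -/
def rowMul (i j k l : Fin 4) (υ : S4Quiver) : ℤ :=
  ∑ σ : S4Quiver, if rowCoeff i j σ = 0 then 0 else
    if S4Quiver.discordance 1 σ + S4Quiver.discordance σ υ = S4Quiver.discordance 1 υ then
      rowCoeff i j σ * rowCoeff (σ.perm k) (σ.perm l) (υ * σ⁻¹) else 0

/-- This and the next three checks are the relations between the idempotents in the row at the
identity, for all choices of indices. The row at `σ` is the row at the identity with the indices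
relabelled by `σ`, so no further rows need checking. -/
theorem rowCoeff_add_swap : ∀ i j : Fin 4, i ≠ j → ∀ σ : S4Quiver,
    rowCoeff i j σ + rowCoeff j i σ = if σ = 1 then 1 else 0 := by
  decide +kernel

theorem rowMul_self : ∀ i j : Fin 4, i ≠ j → ∀ σ : S4Quiver,
    rowMul i j i j σ = rowCoeff i j σ := by
  decide +kernel

theorem rowMul_comm : ∀ i j k : Fin 4, i ≠ j → i ≠ k → j ≠ k → ∀ l : Fin 4, k ≠ l → i ≠ l →
    j ≠ l → ∀ σ : S4Quiver, rowMul i j k l σ = rowMul k l i j σ := by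
  decide +kernel

theorem rowMul_triple : ∀ i j k : Fin 4, i ≠ j → j ≠ k → i ≠ k → ∀ σ : S4Quiver,
    rowMul i j j k σ = rowMul j k i k σ + rowMul i k i j σ - rowCoeff i k σ := by
  decide +kernel

theorem rowCoeff_one : ∀ i j : Fin 4, i ≠ j →
    rowCoeff i j 1 = if i < j then 1 else 0 := by
  decide +kernel

section

variable (K : Type u) [CommRing K]

/-- The image of the idempotent `y_{ij}` in the geodesic matrix algebra. -/
def idemMatrix (i j : Fin 4) : GeoMatrix K S4Quiver :=
  fun σ τ => (rowCoeff (σ.perm i) (σ.perm j) (τ * σ⁻¹) : ℤ)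

theorem idemMatrix_apply (i j : Fin 4) (σ τ : S4Quiver) :
    idemMatrix K i j σ τ = (rowCoeff (σ.perm i) (σ.perm j) (τ * σ⁻¹) : ℤ) := rfl

/-- The intermediate index is translated by `σ⁻¹`, which preserves distances. The second factor is
then read in the row at `τ * σ⁻¹`, where its indices are relabelled once more. -/
theorem idemMatrix_mul_apply (i j k l : Fin 4) (σ υ : S4Quiver) :
    (idemMatrix K i j * idemMatrix K k l) σ υ =
      (rowMul (σ.perm i) (σ.perm j) (σ.perm k) (σ.perm l) (υ * σ⁻¹) : ℤ) := by
  rw [GeoMatrix.mul_apply, rowMul, Int.cast_sum]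
  refine Fintype.sum_equiv (Equiv.mulRight σ⁻¹) _ _ fun τ => ?_
  have hb : IsBetween σ τ υ ↔ S4Quiver.discordance 1 (τ * σ⁻¹) +
      S4Quiver.discordance (τ * σ⁻¹) (υ * σ⁻¹) = S4Quiver.discordance 1 (υ * σ⁻¹) := by
    rw [← S4Quiver.discordance_eq_one_left, ← S4Quiver.discordance_eq_one_left,
      S4Quiver.discordance_mul_right]
    rfl
  have h1 : ∀ m, (S4Quiver.perm (τ * σ⁻¹)) (σ.perm m) = τ.perm m := fun m =>
    congrArg τ.perm (σ.perm.symm_apply_apply m)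
  simp only [Equiv.coe_mulRight, idemMatrix_apply, h1, mul_inv_rev, inv_inv, hb]
  rw [show υ * σ⁻¹ * (σ * τ⁻¹) = υ * τ⁻¹ by group]
  split_ifs with h2 h3 h3
  · simp [h3]
  · simp
  · simp
  · simp

variable {i j k l : Fin 4}

theorem idemMatrix_add_swap (h : i ≠ j) : idemMatrix K i j + idemMatrix K j i = 1 := by
  ext σ τ
  rw [GeoMatrix.add_apply, idemMatrix_apply, idemMatrix_apply, ← Int.cast_add,
    rowCoeff_add_swap _ _ (σ.perm.injective.ne h), GeoMatrix.one_apply]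
  by_cases hστ : σ = τ
  · subst hστ; simp
  · rw [if_neg hστ, if_neg fun h => hστ (mul_inv_eq_one.1 h).symm, Int.cast_zero]

theorem idemMatrix_mul_self (h : i ≠ j) :
    idemMatrix K i j * idemMatrix K i j = idemMatrix K i j := by
  ext σ τ
  rw [idemMatrix_mul_apply, rowMul_self _ _ (σ.perm.injective.ne h), idemMatrix_apply]

theorem idemMatrix_comm (hij : i ≠ j) (hkl : k ≠ l) (hik : i ≠ k) (hil : i ≠ l) (hjk : j ≠ k)
    (hjl : j ≠ l) :
    idemMatrix K i j * idemMatrix K k l = idemMatrix K k l * idemMatrix K i j := by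
  ext σ τ
  have hσ := fun {m n : Fin 4} (h : m ≠ n) => σ.perm.injective.ne h
  rw [idemMatrix_mul_apply, idemMatrix_mul_apply,
    rowMul_comm _ _ _ (hσ hij) (hσ hik) (hσ hjk) _ (hσ hkl) (hσ hil) (hσ hjl)]

theorem idemMatrix_triple (hij : i ≠ j) (hjk : j ≠ k) (hik : i ≠ k) :
    idemMatrix K i j * idemMatrix K j k = idemMatrix K j k * idemMatrix K i k +
      idemMatrix K i k * idemMatrix K i j - idemMatrix K i k := by
  ext σ τ
  have hσ := fun {m n : Fin 4} (h : m ≠ n) => σ.perm.injective.ne h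
  simp only [GeoMatrix.sub_apply, GeoMatrix.add_apply, idemMatrix_mul_apply, idemMatrix_apply]
  rw [rowMul_triple _ _ _ (hσ hij) (hσ hjk) (hσ hik)]
  push_cast
  ring

theorem idemMatrix_diag (h : i ≠ j) (σ : S4Quiver) :
    idemMatrix K i j σ σ = if σ.perm i < σ.perm j then 1 else 0 := by
  rw [idemMatrix_apply, mul_inv_cancel, rowCoeff_one _ _ (σ.perm.injective.ne h)]
  split_ifs <;> simp

/-- The homomorphism from the deformed Fomin-Kirillov algebra to the geodesic matrix algebra. -/
def toGeoMatrix {a b : K} (hb : b ^ 2 = a) : DeformedFK 4 K a (-a) →ₐ[K] GeoMatrix K S4Quiver :=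
  RingQuot.liftAlgHom K
    ⟨FreeAlgebra.lift K fun p => b • (2 * idemMatrix K p.1.1 p.1.2 - 1), by
      intro y z hyz
      subst hb
      have hs : ∀ (P Q : GeoMatrix K S4Quiver), (b • P) * (b • Q) = b ^ 2 • (P * Q) :=
        fun P Q => by rw [smul_mul_smul_comm, sq]
      cases hyz with
      | antisymm i j h =>
        simp only [fkGen, map_neg, FreeAlgebra.lift_ι_apply]
        rw [← smul_neg, ← idemMatrix_add_swap K h]
        congr 1
        noncomm_ring
      | square i j h =>
        simp only [fkGen, map_mul, FreeAlgebra.lift_ι_apply, AlgHom.commutes]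
        rw [hs, Algebra.algebraMap_eq_smul_one]
        congr 1
        linear_combination (norm := noncomm_ring) 4 * idemMatrix_mul_self K h
      | commute i j k l hij hkl hik hil hjk hjl =>
        simp only [fkGen, map_mul, map_sub, map_zero, FreeAlgebra.lift_ι_apply]
        rw [hs, hs, ← smul_sub]
        rw [show (2 * idemMatrix K i j - 1) * (2 * idemMatrix K k l - 1) -
          (2 * idemMatrix K k l - 1) * (2 * idemMatrix K i j - 1) = 0 by
            linear_combination (norm := noncomm_ring)
              4 * idemMatrix_comm K hij hkl hik hil hjk hjl, smul_zero]
      | triple i j k hij hjk hki =>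
        simp only [fkGen, map_mul, map_add, FreeAlgebra.lift_ι_apply, AlgHom.commutes]
        have h1 : idemMatrix K k i = 1 - idemMatrix K i k := by
          rw [← idemMatrix_add_swap K hki]; abel
        rw [hs, hs, hs, ← smul_add, ← smul_add, map_neg, Algebra.algebraMap_eq_smul_one,
          ← smul_neg]
        congr 1
        rw [h1]
        linear_combination (norm := noncomm_ring) 4 * idemMatrix_triple K hij hjk hki.symm⟩

@[simp] theorem toGeoMatrix_x {a b : K} (hb : b ^ 2 = a) (i j : Fin 4) (h : i ≠ j) :
    toGeoMatrix K hb (x a (-a) i j h) = b • (2 * idemMatrix K i j - 1) := by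
  simp [toGeoMatrix, x, fkGen]

/-- Two algebra homomorphisms on a deformed Fomin-Kirillov algebra agree if they agree on the
generators. -/
theorem hom_ext {n : ℕ} {K : Type u} [CommRing K] {a₁ a₂ : K} {B : Type*} [Semiring B]
    [Algebra K B] {f g : DeformedFK n K a₁ a₂ →ₐ[K] B}
    (h : ∀ i j hij, f (x a₁ a₂ i j hij) = g (x a₁ a₂ i j hij)) : f = g :=
  RingQuot.ringQuot_ext' _ _ _ (FreeAlgebra.hom_ext (funext fun p => h p.1.1 p.1.2 p.2))

theorem rho_eq_diag {a b : K} (hb : b ^ 2 = a) (σ : S4Quiver) :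
    rho hb σ.perm = (GeoMatrix.diag K σ).comp (toGeoMatrix K hb) := by
  refine hom_ext fun i j h => ?_
  rw [rho_x, AlgHom.comp_apply, toGeoMatrix_x, map_smul, map_sub, map_mul, map_ofNat, map_one,
    GeoMatrix.diag_apply, idemMatrix_diag K h, smul_eq_mul]
  split_ifs <;> ring

/-- Translation of the indices, as an automorphism of the geodesic matrix algebra. -/
def translate (g : S4Quiver) : GeoMatrix K S4Quiver →ₐ[K] GeoMatrix K S4Quiver :=
  AlgHom.ofLinearMap
    { toFun := fun F σ τ => F (σ * g) (τ * g)
      map_add' := fun _ _ => rfl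
      map_smul' := fun _ _ => rfl }
    (by
      ext σ τ
      change (1 : GeoMatrix K S4Quiver) (σ * g) (τ * g) = _
      simp [GeoMatrix.one_apply])
    (fun F G => by
      ext σ υ
      change (F * G) (σ * g) (υ * g) = _
      rw [GeoMatrix.mul_apply, GeoMatrix.mul_apply]
      refine (Fintype.sum_equiv (Equiv.mulRight g) _ _ fun τ => ?_).symm
      simp only [Equiv.coe_mulRight, IsBetween, S4Quiver.gdist_mul_right]
      rfl)

theorem translate_apply (g : S4Quiver) (F : GeoMatrix K S4Quiver) (σ τ : S4Quiver) :
    translate K g F σ τ = F (σ * g) (τ * g) := rfl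

theorem translate_unit (g σ τ : S4Quiver) :
    translate K g (GeoMatrix.unit K σ τ) = GeoMatrix.unit K (σ * g⁻¹) (τ * g⁻¹) := by
  ext a b
  rw [translate_apply]
  simp [GeoMatrix.unit, eq_mul_inv_iff_mul_eq]

theorem translate_idemMatrix (g : S4Quiver) (i j : Fin 4) :
    translate K g (idemMatrix K i j) = idemMatrix K (g.perm i) (g.perm j) := by
  ext σ τ
  rw [translate_apply, idemMatrix_apply, idemMatrix_apply, mul_inv_rev, mul_assoc,
    mul_inv_cancel_left]
  rfl

theorem toGeoMatrix_act {a b : K} (hb : b ^ 2 = a) (g : S4Quiver) (y : DeformedFK 4 K a (-a)) :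
    toGeoMatrix K hb (act g.perm y) = translate K g (toGeoMatrix K hb y) := by
  refine DFunLike.congr_fun (f := (toGeoMatrix K hb).comp (act g.perm))
    (g := (translate K g).comp (toGeoMatrix K hb)) (hom_ext fun i j h => ?_) y
  simp only [AlgHom.comp_apply, act_x, toGeoMatrix_x, map_smul, map_sub, map_mul, map_one,
    map_ofNat, translate_idemMatrix]

end

end DeformedFK

end

/-! ### Surjectivity, and the isomorphism with the geodesic matrix algebra -/

noncomputable section

open GeodesicSpace

namespace GeoMatrix

variable {K : Type u} {V : Type v} [CommRing K] [Fintype V] [GeodesicSpace V]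

theorem mem_filtration_one {K : Type*} {V : Type*} [CommRing K] [GeodesicSpace V]
    {F : GeoMatrix K V} (h : ∀ σ, F σ σ = 0) : F ∈ filtration K V 1 := by
  intro σ τ hd
  obtain rfl : σ = τ := eq_of_gdist_eq_zero (by omega)
  exact h σ

/-- Matrix units at distance one, up to matrices supported at larger distances, from matrix units
on the diagonal up to matrices with zero diagonal. -/
theorem mul_mul_sub_unit_mem_filtration {σ τ : V} {P Q Z : GeoMatrix K V}
    (hP : P - unit K σ σ ∈ filtration K V 1) (hQ : Q - unit K τ τ ∈ filtration K V 1)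
    (hσ : Z σ σ = 0) (hτ : Z τ τ = 0) (hστ : Z σ τ = 1) :
    P * Z * Q - unit K σ τ ∈ filtration K V 2 := by
  classical
  have h1 : Z * unit K τ τ ∈ filtration K V 1 := mem_filtration_one fun a => by
    rw [mul_unit_apply]
    split_ifs with h
    · rw [h.1, hτ]
    · rfl
  have h2 : unit K σ σ * Z ∈ filtration K V 1 := mem_filtration_one fun a => by
    rw [unit_mul_apply]
    split_ifs with h
    · rw [h.1, hσ]
    · rfl
  have h3 : unit K σ σ * Z * unit K τ τ = unit K σ τ := by
    ext a b
    rw [mul_unit_apply, unit_mul_apply]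
    by_cases ha : a = σ
    · by_cases hb : b = τ
      · subst ha hb
        simp [isBetween_left, isBetween_right, hστ]
      · rw [if_neg fun h => hb h.1, unit_apply_of_ne fun h => hb h.2]
    · rw [if_neg fun h : a = σ ∧ _ => ha h.1, unit_apply_of_ne fun h => ha h.1, ite_self]
  have h4 : Z ∈ filtration K V 0 := fun _ _ h => absurd h (Nat.not_lt_zero _)
  -- In the first two summands the diagonal units pick a column or row of `Z` whose diagonal entry
  -- is zero, so both factors lie in the first step of the filtration.
  have e : P * Z * Q - unit K σ τ = (P - unit K σ σ) * (Z * unit K τ τ) +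
      (unit K σ σ * Z) * (Q - unit K τ τ) + (P - unit K σ σ) * Z * (Q - unit K τ τ) := by
    rw [← h3]
    noncomm_ring
  rw [e]
  exact add_mem (add_mem (mul_mem_filtration hP h1) (mul_mem_filtration h2 hQ))
    (mul_mem_filtration (mul_mem_filtration hP h4) hQ)

end GeoMatrix

namespace DeformedFK

theorem eq_one_iff_increasing : ∀ σ : S4Quiver,
    (σ.perm 0 < σ.perm 1 ∧ σ.perm 1 < σ.perm 2 ∧ σ.perm 2 < σ.perm 3) ↔ σ = 1 := by
  decide +kernel

/-- Provides a difference of two idempotents with zero diagonal entries at `1` and `t i` and entry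
one at `(1, t i)`: cut out by the two approximate diagonal units, it has the arrow as its leading
term. -/
theorem exists_rowCoeff_sub : ∀ i : Fin 3, ∃ j k l : Fin 4, j ≠ k ∧ j ≠ l ∧
    rowCoeff j k 1 - rowCoeff j l 1 = 0 ∧
    rowCoeff ((S4Quiver.t i).perm j) ((S4Quiver.t i).perm k) 1 -
      rowCoeff ((S4Quiver.t i).perm j) ((S4Quiver.t i).perm l) 1 = 0 ∧
    rowCoeff j k (S4Quiver.t i) - rowCoeff j l (S4Quiver.t i) = 1 := by
  decide +kernel

section

variable (K : Type u) [CommRing K]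

/-- A product of idempotents with only one nonzero entry on the diagonal. -/
def chainMatrix (σ : S4Quiver) : GeoMatrix K S4Quiver :=
  idemMatrix K (σ.perm.symm 0) (σ.perm.symm 1) * idemMatrix K (σ.perm.symm 1) (σ.perm.symm 2) *
    idemMatrix K (σ.perm.symm 2) (σ.perm.symm 3)

theorem chainMatrix_sub_unit_mem (σ : S4Quiver) :
    chainMatrix K σ - GeoMatrix.unit K σ σ ∈ GeoMatrix.filtration K S4Quiver 1 := by
  refine GeoMatrix.mem_filtration_one fun τ => ?_
  have hne : ∀ {i j : Fin 4}, i ≠ j → σ.perm.symm i ≠ σ.perm.symm j :=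
    fun h => σ.perm.symm.injective.ne h
  have h1 : chainMatrix K σ τ τ = if τ = σ then 1 else 0 := by
    change GeoMatrix.diag K τ (chainMatrix K σ) = _
    rw [chainMatrix, map_mul, map_mul]
    simp only [GeoMatrix.diag_apply]
    rw [idemMatrix_diag K (hne (by decide)), idemMatrix_diag K (hne (by decide)),
      idemMatrix_diag K (hne (by decide))]
    have h2 := eq_one_iff_increasing (τ * σ⁻¹)
    rw [mul_inv_eq_one] at h2
    simp only [← ite_and, mul_ite, mul_one, mul_zero]
    refine if_congr ?_ rfl rfl
    rw [← h2]
    change _ ↔ (τ.perm (σ.perm.symm 0) < τ.perm (σ.perm.symm 1) ∧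
      τ.perm (σ.perm.symm 1) < τ.perm (σ.perm.symm 2) ∧
      τ.perm (σ.perm.symm 2) < τ.perm (σ.perm.symm 3))
    tauto
  rw [GeoMatrix.sub_apply, h1]
  by_cases h : τ = σ
  · subst h; simp
  · rw [if_neg h, GeoMatrix.unit_apply_of_ne fun h' => h h'.1, sub_zero]

/-- The idempotents `y_{ij}` generate the geodesic matrix algebra. -/
theorem eq_top_of_idemMatrix_mem (S : Subalgebra K (GeoMatrix K S4Quiver))
    (hS : ∀ i j : Fin 4, i ≠ j → idemMatrix K i j ∈ S) : S = ⊤ := by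
  have hchain : ∀ σ, chainMatrix K σ ∈ S := fun σ => by
    have hne : ∀ {i j : Fin 4}, i ≠ j → σ.perm.symm i ≠ σ.perm.symm j :=
      fun h => σ.perm.symm.injective.ne h
    exact mul_mem (mul_mem (hS _ _ (hne (by decide))) (hS _ _ (hne (by decide))))
      (hS _ _ (hne (by decide)))
  refine GeoMatrix.subalgebra_eq_top S fun σ τ hd => ?_
  rcases Nat.lt_or_eq_of_le hd with hd | hd
  · obtain rfl : σ = τ := eq_of_gdist_eq_zero (by omega)
    refine ⟨_, hchain σ, ?_⟩
    rw [gdist_self]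
    exact chainMatrix_sub_unit_mem K σ
  · obtain ⟨⟨i, rfl⟩⟩ := (S4Quiver.isGeodesicQuiver.nonempty_iff σ τ).2 hd
    obtain ⟨j, k, l, hjk, hjl, h1, h2, h3⟩ := exists_rowCoeff_sub i
    have hne : ∀ {i j : Fin 4}, i ≠ j → σ.perm.symm i ≠ σ.perm.symm j :=
      fun h => σ.perm.symm.injective.ne h
    refine ⟨_, mul_mem (mul_mem (hchain σ) (sub_mem (hS _ _ (hne hjk)) (hS _ _ (hne hjl))))
      (hchain (S4Quiver.t i * σ)), ?_⟩
    rw [hd]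
    have hp : ∀ m, S4Quiver.perm (S4Quiver.t i * σ) (σ.perm.symm m) = (S4Quiver.t i).perm m :=
      fun m => congrArg (S4Quiver.t i).perm (σ.perm.apply_symm_apply m)
    refine GeoMatrix.mul_mul_sub_unit_mem_filtration (chainMatrix_sub_unit_mem K σ)
      (chainMatrix_sub_unit_mem K _) ?_ ?_ ?_
    · rw [GeoMatrix.sub_apply, idemMatrix_apply, idemMatrix_apply, ← Int.cast_sub,
        mul_inv_cancel, Equiv.apply_symm_apply, Equiv.apply_symm_apply, Equiv.apply_symm_apply,
        h1, Int.cast_zero]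
    · rw [GeoMatrix.sub_apply, idemMatrix_apply, idemMatrix_apply, ← Int.cast_sub,
        mul_inv_cancel, hp, hp, hp, h2, Int.cast_zero]
    · rw [GeoMatrix.sub_apply, idemMatrix_apply, idemMatrix_apply, ← Int.cast_sub,
        mul_inv_cancel_right, Equiv.apply_symm_apply, Equiv.apply_symm_apply,
        Equiv.apply_symm_apply, h3, Int.cast_one]

end

theorem eq_top_of_x_mem {n : ℕ} {K : Type u} [CommRing K] {a₁ a₂ : K}
    (S : Subalgebra K (DeformedFK n K a₁ a₂)) (hS : ∀ i j h, x a₁ a₂ i j h ∈ S) : S = ⊤ := by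
  have h1 : ((RingQuot.mkAlgHom K (DFKRel n K a₁ a₂)).range) = ⊤ :=
    (AlgHom.range_eq_top _).2 (RingQuot.mkAlgHom_surjective K _)
  rw [eq_top_iff, ← h1, ← Algebra.map_top, ← FreeAlgebra.adjoin_range_ι, AlgHom.map_adjoin,
    Algebra.adjoin_le_iff]
  rintro _ ⟨_, ⟨p, rfl⟩, rfl⟩
  exact hS p.1.1 p.1.2 p.2

/-! ### From elements of square b² to idempotents -/

section Idempotent

variable {K : Type*} {A : Type*} [Field K] [CharZero K] [Ring A] [Algebra K A] {a b : K}
  {X Y Z : A}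

/-- The idempotent `(1 + X / b) / 2`, for an element `X` with `X² = b²`. -/
def idemOf (b : K) (X : A) : A := (2⁻¹ : K) • (1 + b⁻¹ • X)

theorem inv_two_smul_two_mul (y : A) : (2⁻¹ : K) • (2 * y) = y := by
  rw [show 2 * y = (2 : K) • y by rw [Algebra.smul_def, map_ofNat], smul_smul,
    inv_mul_cancel₀ (two_ne_zero' K), one_smul]

theorem eq_smul_idemOf (hb : b ≠ 0) (X : A) : X = b • (2 * idemOf b X - 1) := by
  rw [idemOf, mul_smul_comm, inv_two_smul_two_mul, add_sub_cancel_left, smul_smul,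
    mul_inv_cancel₀ hb, one_smul]

theorem idemOf_add_neg (b : K) (X : A) : idemOf b X + idemOf b (-X) = 1 := by
  rw [idemOf, idemOf, ← smul_add, smul_neg, add_add_add_comm, add_neg_cancel, add_zero,
    one_add_one_eq_two, show (2 : A) = 2 * 1 by simp, inv_two_smul_two_mul]

theorem smul_mul_smul_sq {K : Type*} {A : Type*} [Field K] [Ring A] [Algebra K A] {a b : K}
    (hb : b ^ 2 = a) (y z : A) : (b • y) * (b • z) = a • (y * z) := by
  rw [smul_mul_smul_comm, ← sq, hb]

theorem eq_zero_of_smul_four_mul (ha : a ≠ 0) {y : A} (h : a • (4 * y) = 0) : y = 0 := by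
  rw [show 4 * y = (4 : K) • y by rw [Algebra.smul_def, map_ofNat], smul_smul] at h
  exact (smul_eq_zero.1 h).resolve_left (mul_ne_zero ha (by norm_num : (4 : K) ≠ 0))

theorem idemOf_mul_self (ha : a ≠ 0) (hb : b ^ 2 = a) (h : X * X = algebraMap K A a) :
    idemOf b X * idemOf b X = idemOf b X := by
  have hb0 : b ≠ 0 := by rintro rfl; exact ha (by rw [← hb]; simp)
  have hX := eq_smul_idemOf hb0 X
  generalize idemOf b X = u at *
  rw [hX, smul_mul_smul_sq hb, Algebra.algebraMap_eq_smul_one, ← sub_eq_zero, ← smul_sub] at h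
  rw [← sub_eq_zero]
  refine eq_zero_of_smul_four_mul ha ?_
  rw [← h]
  congr 1
  noncomm_ring

theorem idemOf_comm (ha : a ≠ 0) (hb : b ^ 2 = a) (h : X * Y - Y * X = 0) :
    idemOf b X * idemOf b Y = idemOf b Y * idemOf b X := by
  have hb0 : b ≠ 0 := by rintro rfl; exact ha (by rw [← hb]; simp)
  have hX := eq_smul_idemOf hb0 X
  have hY := eq_smul_idemOf hb0 Y
  generalize idemOf b X = u at *
  generalize idemOf b Y = v at *
  rw [hX, hY, smul_mul_smul_sq hb, smul_mul_smul_sq hb, ← smul_sub] at h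
  rw [← sub_eq_zero]
  refine eq_zero_of_smul_four_mul ha ?_
  rw [← h]
  congr 1
  noncomm_ring

/-- In the application `-Z` is `x_{ki}`. Substituting `X = b (2u - 1)` and likewise for `Y` and `Z`
turns the hypothesis into `4 * a` times the conclusion; the same scalar is cancelled in the two
preceding lemmas. -/
theorem idemOf_triple (ha : a ≠ 0) (hb : b ^ 2 = a)
    (h : X * Y + Y * -Z + -Z * X = algebraMap K A (-a)) :
    idemOf b X * idemOf b Y =
      idemOf b Y * idemOf b Z + idemOf b Z * idemOf b X - idemOf b Z := by
  have hb0 : b ≠ 0 := by rintro rfl; exact ha (by rw [← hb]; simp)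
  have hX := eq_smul_idemOf hb0 X
  have hY := eq_smul_idemOf hb0 Y
  have hZ := eq_smul_idemOf hb0 Z
  generalize idemOf b X = u at *
  generalize idemOf b Y = v at *
  generalize idemOf b Z = w at *
  rw [hX, hY, hZ, ← smul_neg, smul_mul_smul_sq hb, smul_mul_smul_sq hb, smul_mul_smul_sq hb,
    ← smul_add, ← smul_add, map_neg, Algebra.algebraMap_eq_smul_one, ← smul_neg, ← sub_eq_zero,
    ← smul_sub] at h
  rw [← sub_eq_zero]
  refine eq_zero_of_smul_four_mul ha ?_
  rw [← h]
  congr 1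
  noncomm_ring

theorem triple_swap {A : Type*} [Ring A] {u v w : A}
    (h : (1 - u) * v = v * w + w * (1 - u) - w) : w * u = u * v + v * w - v := by
  linear_combination (norm := noncomm_ring) h

end Idempotent

section Field

variable {K : Type u} [Field K] [CharZero K] {a b : K}

/-- The idempotent `y_{ij} = (1 + x_{ij} / b) / 2`. -/
def idem (a b : K) (i j : Fin 4) (h : i ≠ j) : DeformedFK 4 K a (-a) :=
  idemOf b (x a (-a) i j h)

variable {i j k l : Fin 4}

theorem idem_swap (h : i ≠ j) : idem a b j i h.symm = 1 - idem a b i j h := by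
  rw [← idemOf_add_neg b (x a (-a) i j h), idem, x_antisymm a (-a) j i]
  exact (add_sub_cancel_left _ _).symm

variable (ha : a ≠ 0) (hb : b ^ 2 = a)

include ha hb

theorem idem_mul_self (h : i ≠ j) : idem a b i j h * idem a b i j h = idem a b i j h :=
  idemOf_mul_self ha hb (x_square a (-a) i j h)

theorem idem_comm (hij : i ≠ j) (hkl : k ≠ l) (hik : i ≠ k) (hil : i ≠ l) (hjk : j ≠ k)
    (hjl : j ≠ l) :
    idem a b i j hij * idem a b k l hkl = idem a b k l hkl * idem a b i j hij :=
  idemOf_comm ha hb (x_commute a (-a) i j k l hij hkl hik hil hjk hjl)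

theorem idem_triple (hij : i ≠ j) (hjk : j ≠ k) (hik : i ≠ k) :
    idem a b i j hij * idem a b j k hjk = idem a b j k hjk * idem a b i k hik +
      idem a b i k hik * idem a b i j hij - idem a b i k hik :=
  idemOf_triple ha hb (by
    have h := x_triple a (-a) i j k hij hjk hik.symm
    rwa [x_antisymm a (-a) k i] at h)

/-- This is `idem_triple` for the indices `j, i, k`, rewritten by `y_{ji} = 1 - y_{ij}`. It supplies
the rules that sort products written in the opposite order. -/
theorem idem_triple_swap (hij : i ≠ j) (hjk : j ≠ k) (hik : i ≠ k) :
    idem a b j k hjk * idem a b i j hij = idem a b i j hij * idem a b i k hik +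
      idem a b i k hik * idem a b j k hjk - idem a b i k hik := by
  have h1 := idem_triple ha hb hij.symm hik hjk
  rw [idem_swap hij] at h1
  exact triple_swap h1

theorem fkIdempotents : FKIdempotents (idem a b 0 1 (by decide)) (idem a b 0 2 (by decide))
    (idem a b 0 3 (by decide)) (idem a b 1 2 (by decide)) (idem a b 1 3 (by decide))
    (idem a b 2 3 (by decide)) where
  aa := idem_mul_self ha hb _
  bb := idem_mul_self ha hb _
  cc := idem_mul_self ha hb _
  pp := idem_mul_self ha hb _
  qq := idem_mul_self ha hb _
  rr := idem_mul_self ha hb _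
  pa := idem_triple_swap ha hb _ _ _
  pb := by rw [idem_triple ha hb (by decide) (by decide) (by decide)]; abel
  pc := idem_comm ha hb _ _ (by decide) (by decide) (by decide) (by decide)
  qa := idem_triple_swap ha hb _ _ _
  qb := idem_comm ha hb _ _ (by decide) (by decide) (by decide) (by decide)
  qc := by rw [idem_triple ha hb (by decide) (by decide) (by decide)]; abel
  ra := idem_comm ha hb _ _ (by decide) (by decide) (by decide) (by decide)
  rb := idem_triple_swap ha hb _ _ _
  rc := by rw [idem_triple ha hb (by decide) (by decide) (by decide)]; abel
  rp := idem_triple_swap ha hb _ _ _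
  rq := by rw [idem_triple ha hb (by decide) (by decide) (by decide)]; abel

theorem adjoin_idem_eq_top : Algebra.adjoin K {idem a b 0 1 (by decide),
    idem a b 0 2 (by decide), idem a b 0 3 (by decide), idem a b 1 2 (by decide),
    idem a b 1 3 (by decide), idem a b 2 3 (by decide)} = ⊤ := by
  have key : ∀ {S : Subalgebra K (DeformedFK 4 K a (-a))}, (∀ i j h, i < j → idem a b i j h ∈ S) →
      S = ⊤ := by
    intro S hS
    have h1 : ∀ i j h, i < j → x a (-a) i j h ∈ S := fun i j h hij => by
      have hb0 : b ≠ 0 := by rintro rfl; exact ha (by rw [← hb]; simp)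
      rw [eq_smul_idemOf hb0 (x a (-a) i j h)]
      exact S.smul_mem (sub_mem (mul_mem (ofNat_mem S 2) (hS i j h hij)) (one_mem S)) b
    refine eq_top_of_x_mem S fun i j h => ?_
    rcases lt_or_gt_of_ne h with hij | hij
    · exact h1 i j h hij
    · rw [x_antisymm]
      exact neg_mem (h1 j i h.symm hij)
  refine key fun i j h hij => Algebra.subset_adjoin ?_
  fin_cases i <;> fin_cases j <;> first | exact absurd hij (by decide) | simp

theorem toGeoMatrix_idem (h : i ≠ j) :
    toGeoMatrix K hb (idem a b i j h) = idemMatrix K i j := by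
  have hb0 : b ≠ 0 := by rintro rfl; exact ha (by rw [← hb]; simp)
  change toGeoMatrix K hb ((2⁻¹ : K) • (1 + b⁻¹ • x a (-a) i j h)) = _
  rw [map_smul, map_add, map_smul, map_one, toGeoMatrix_x, smul_smul,
    inv_mul_cancel₀ hb0, one_smul, add_sub_cancel, inv_two_smul_two_mul]

theorem toGeoMatrix_surjective : Function.Surjective (toGeoMatrix K hb) := by
  rw [← AlgHom.range_eq_top]
  exact eq_top_of_idemMatrix_mem K _ fun i j h => ⟨_, toGeoMatrix_idem ha hb h⟩

/-- A surjection from a space of dimension at most 576 onto one of dimension 24² = 576. -/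
theorem toGeoMatrix_bijective : Function.Bijective (toGeoMatrix K hb) := by
  obtain ⟨hfin, hrank⟩ := (fkIdempotents ha hb).finite_and_finrank_le (adjoin_idem_eq_top ha hb)
  have hsurj := toGeoMatrix_surjective ha hb
  have hcard : Module.finrank K (GeoMatrix K S4Quiver) = 576 := by
    rw [GeoMatrix.finrank_eq, show Fintype.card S4Quiver = 24 from by
      rw [show Fintype.card S4Quiver = Fintype.card (Equiv.Perm (Fin 4)) from rfl,
        Fintype.card_perm]; rfl]
  have hge : Module.finrank K (GeoMatrix K S4Quiver) ≤
      Module.finrank K (DeformedFK 4 K a (-a)) :=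
    LinearMap.finrank_le_finrank_of_surjective (f := (toGeoMatrix K hb).toLinearMap) hsurj
  refine ⟨?_, hsurj⟩
  exact (LinearMap.injective_iff_surjective_of_finrank_eq_finrank
    (f := (toGeoMatrix K hb).toLinearMap) (by omega)).2 hsurj

/-- The deformed Fomin-Kirillov algebra is isomorphic to the geodesic matrix algebra. -/
def equivGeoMatrix : DeformedFK 4 K a (-a) ≃ₐ[K] GeoMatrix K S4Quiver :=
  AlgEquiv.ofBijective (toGeoMatrix K hb) (toGeoMatrix_bijective ha hb)

theorem equivGeoMatrix_apply (y : DeformedFK 4 K a (-a)) :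
    equivGeoMatrix ha hb y = toGeoMatrix K hb y := rfl

theorem rho_apply (σ : S4Quiver) (y : DeformedFK 4 K a (-a)) :
    rho hb σ.perm y = equivGeoMatrix ha hb y σ σ := by
  rw [rho_eq_diag]
  rfl

theorem act_symm (g : S4Quiver) (F : GeoMatrix K S4Quiver) :
    act g.perm ((equivGeoMatrix ha hb).symm F) = (equivGeoMatrix ha hb).symm (translate K g F) := by
  rw [AlgEquiv.eq_symm_apply, equivGeoMatrix_apply, toGeoMatrix_act, ← equivGeoMatrix_apply ha,
    AlgEquiv.apply_symm_apply]

end Field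

end DeformedFK

end

noncomputable section

open GeodesicSpace

/-! ## The nil-Coxeter algebra of `𝕊₄` -/

section NilCoxeterSpan

open scoped Pointwise

variable {K : Type*} {A : Type*} [Field K] [Ring A] [Algebra K A] {s₀ s₁ s₂ : A}

/-- Used with `H` generated by fewer of the `s_i` and `U` spanned by coset representatives: it is
enough to multiply each representative by each generator. -/
theorem mem_mul_of_mem_adjoin {s : Set A} {H : Subalgebra K A} {U : Submodule K A}
    (h1 : (1 : A) ∈ U)
    (hs : ∀ y ∈ U, ∀ g ∈ s, y * g ∈ Subalgebra.toSubmodule H * U) {x : A}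
    (hx : x ∈ Algebra.adjoin K s) : x ∈ Subalgebra.toSubmodule H * U := by
  have hHH : Subalgebra.toSubmodule H * Subalgebra.toSubmodule H = Subalgebra.toSubmodule H :=
    Subalgebra.isIdempotentElem_toSubmodule _
  have h1H : (1 : A) ∈ Subalgebra.toSubmodule H := one_mem H
  refine mem_of_mem_adjoin (by simpa using Submodule.mul_mem_mul h1H h1) (fun x hx g hg => ?_) hx
  induction hx using Submodule.mul_induction_on' with
  | mem_mul_mem u hu y hy =>
    have := Submodule.mul_mem_mul hu (hs y hy g hg)
    rwa [← mul_assoc, ← mul_assoc, hHH] at this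
  | add x _ y _ hx hy => rw [add_mul]; exact Submodule.add_mem _ hx hy

theorem adjoin_singleton_le_span (h00 : s₀ * s₀ = 0) :
    Subalgebra.toSubmodule (Algebra.adjoin K {s₀}) ≤ Submodule.span K {1, s₀} := by
  refine fun x hx => mem_of_mem_adjoin (Submodule.subset_span (by simp)) (fun y hy g hg => ?_) hx
  obtain rfl := Set.mem_singleton_iff.1 hg
  induction hy using Submodule.span_induction with
  | zero => simp
  | add x y _ _ hx hy => rw [add_mul]; exact Submodule.add_mem _ hx hy
  | smul k x _ hx => rw [smul_mul_assoc]; exact Submodule.smul_mem _ k hx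
  | mem y hy =>
    rcases hy with rfl | rfl
    · rw [one_mul]; exact Submodule.subset_span (by simp)
    · rw [h00]; exact Submodule.zero_mem _

theorem adjoin_pair_le_mul (h00 : s₀ * s₀ = 0) (h11 : s₁ * s₁ = 0)
    (h01 : s₀ * s₁ * s₀ = s₁ * s₀ * s₁) :
    Subalgebra.toSubmodule (Algebra.adjoin K {s₀, s₁}) ≤
      Subalgebra.toSubmodule (Algebra.adjoin K {s₀}) * Submodule.span K {1, s₁, s₁ * s₀} := by
  have hs : s₀ ∈ Subalgebra.toSubmodule (Algebra.adjoin K {s₀}) :=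
    Algebra.subset_adjoin (by simp)
  have hone : (1 : A) ∈ Subalgebra.toSubmodule (Algebra.adjoin K {s₀}) :=
    one_mem (Algebra.adjoin K {s₀})
  have hm : ∀ z ∈ ({1, s₁, s₁ * s₀} : Set A), z ∈ Submodule.span K {1, s₁, s₁ * s₀} :=
    fun z hz => Submodule.subset_span hz
  simp only [Set.mem_insert_iff, Set.mem_singleton_iff, forall_eq_or_imp, forall_eq] at hm
  obtain ⟨m1, m2, m3⟩ := hm
  refine fun x hx => mem_mul_of_mem_adjoin m1 (fun y hy g hg => ?_) hx
  simp only [Set.mem_insert_iff, Set.mem_singleton_iff] at hg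
  induction hy using Submodule.span_induction with
  | zero => simp
  | add x y _ _ hx hy => rw [add_mul]; exact Submodule.add_mem _ hx hy
  | smul k x _ hx => rw [smul_mul_assoc]; exact Submodule.smul_mem _ k hx
  | mem y hy =>
    simp only [Set.mem_insert_iff, Set.mem_singleton_iff] at hy
    rcases hg with rfl | rfl
    · rcases hy with rfl | rfl | rfl
      · simpa using Submodule.mul_mem_mul hs m1
      · simpa using Submodule.mul_mem_mul hone m3
      · rw [mul_assoc, h00, mul_zero]; exact Submodule.zero_mem _
    · rcases hy with rfl | rfl | rfl
      · simpa using Submodule.mul_mem_mul hone m2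
      · rw [h11]; exact Submodule.zero_mem _
      · rw [← h01, mul_assoc]; exact Submodule.mul_mem_mul hs m3

/-- The four words represent the cosets of 𝕊₃ in 𝕊₄. A representative times a generator is another
representative, or zero, or `s₀` or `s₁` times a representative. With the two analogous steps below
this gives 2 · 3 · 4 = 24. -/
theorem adjoin_triple_le_mul (h00 : s₀ * s₀ = 0) (h11 : s₁ * s₁ = 0) (h22 : s₂ * s₂ = 0)
    (h02 : s₀ * s₂ = s₂ * s₀) (h01 : s₀ * s₁ * s₀ = s₁ * s₀ * s₁)
    (h12 : s₁ * s₂ * s₁ = s₂ * s₁ * s₂) :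
    Subalgebra.toSubmodule (Algebra.adjoin K {s₀, s₁, s₂}) ≤
      Subalgebra.toSubmodule (Algebra.adjoin K {s₀, s₁}) *
        Submodule.span K {1, s₂, s₂ * s₁, s₂ * s₁ * s₀} := by
  have hs : s₀ ∈ Subalgebra.toSubmodule (Algebra.adjoin K {s₀, s₁}) :=
    Algebra.subset_adjoin (by simp)
  have hs' : s₁ ∈ Subalgebra.toSubmodule (Algebra.adjoin K {s₀, s₁}) :=
    Algebra.subset_adjoin (by simp)
  have hone : (1 : A) ∈ Subalgebra.toSubmodule (Algebra.adjoin K {s₀, s₁}) :=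
    one_mem (Algebra.adjoin K {s₀, s₁})
  have hm : ∀ z ∈ ({1, s₂, s₂ * s₁, s₂ * s₁ * s₀} : Set A),
      z ∈ Submodule.span K {1, s₂, s₂ * s₁, s₂ * s₁ * s₀} :=
    fun z hz => Submodule.subset_span hz
  simp only [Set.mem_insert_iff, Set.mem_singleton_iff, forall_eq_or_imp, forall_eq] at hm
  obtain ⟨m1, m2, m3, m4⟩ := hm
  refine fun x hx => mem_mul_of_mem_adjoin m1 (fun y hy g hg => ?_) hx
  simp only [Set.mem_insert_iff, Set.mem_singleton_iff] at hg
  induction hy using Submodule.span_induction with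
  | zero => simp
  | add x y _ _ hx hy => rw [add_mul]; exact Submodule.add_mem _ hx hy
  | smul k x _ hx => rw [smul_mul_assoc]; exact Submodule.smul_mem _ k hx
  | mem y hy =>
    simp only [Set.mem_insert_iff, Set.mem_singleton_iff] at hy
    rcases hg with rfl | rfl | rfl
    · rcases hy with rfl | rfl | rfl | rfl
      · simpa using Submodule.mul_mem_mul hs m1
      · rw [← h02]; exact Submodule.mul_mem_mul hs m2
      · simpa using Submodule.mul_mem_mul hone m4
      · have e : s₂ * s₁ * g * g = 0 := by rw [mul_assoc (s₂ * s₁), h00, mul_zero]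
        rw [e]; exact Submodule.zero_mem _
    · rcases hy with rfl | rfl | rfl | rfl
      · simpa using Submodule.mul_mem_mul hs' m1
      · simpa using Submodule.mul_mem_mul hone m3
      · have e : s₂ * g * g = 0 := by rw [mul_assoc s₂, h11, mul_zero]
        rw [e]; exact Submodule.zero_mem _
      · have e : s₂ * g * s₀ * g = s₀ * (s₂ * g * s₀) := by
          simp only [← mul_assoc, h02]
          simp only [mul_assoc]
          rw [← mul_assoc g s₀ g, ← h01, mul_assoc]
        rw [e]
        exact Submodule.mul_mem_mul hs m4
    · rcases hy with rfl | rfl | rfl | rfl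
      · simpa using Submodule.mul_mem_mul hone m2
      · rw [h22]; exact Submodule.zero_mem _
      · have e : g * s₁ * g = s₁ * (g * s₁) := by rw [← h12, mul_assoc]
        rw [e]; exact Submodule.mul_mem_mul hs' m3
      · have e : g * s₁ * s₀ * g = s₁ * (g * s₁ * s₀) := by
          rw [mul_assoc _ s₀, h02, ← mul_assoc, ← h12]
          simp only [mul_assoc]
        rw [e]
        exact Submodule.mul_mem_mul hs' m4

theorem finite_and_finrank_le_of_nilCoxeter (h00 : s₀ * s₀ = 0) (h11 : s₁ * s₁ = 0)
    (h22 : s₂ * s₂ = 0) (h02 : s₀ * s₂ = s₂ * s₀) (h01 : s₀ * s₁ * s₀ = s₁ * s₀ * s₁)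
    (h12 : s₁ * s₂ * s₁ = s₂ * s₁ * s₂) (htop : Algebra.adjoin K {s₀, s₁, s₂} = ⊤) :
    Module.Finite K A ∧ Module.finrank K A ≤ 24 := by
  classical
  let f : Finset A := {1, s₀}
  let g : Finset A := {1, s₁, s₁ * s₀}
  let h : Finset A := {1, s₂, s₂ * s₁, s₂ * s₁ * s₀}
  have hle := (adjoin_triple_le_mul (K := K) h00 h11 h22 h02 h01 h12).trans
    (mul_le_mul_left ((adjoin_pair_le_mul h00 h11 h01).trans
      (mul_le_mul_left (adjoin_singleton_le_span h00) _)) _)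
  rw [htop, Algebra.top_toSubmodule, Submodule.span_mul_span, Submodule.span_mul_span, top_le_iff,
    show ({1, s₀} * {1, s₁, s₁ * s₀} * {1, s₂, s₂ * s₁, s₂ * s₁ * s₀} : Set A) =
      ((f * g * h : Finset A) : Set A) by simp [f, g, h]] at hle
  refine ⟨⟨⟨_, hle⟩⟩, ?_⟩
  rw [← finrank_top, ← hle]
  exact (finrank_span_finset_le_card _).trans (Finset.card_mul_le.trans (Nat.mul_le_mul
    (Finset.card_mul_le.trans (Nat.mul_le_mul Finset.card_le_two Finset.card_le_three))
    Finset.card_le_four))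

end NilCoxeterSpan

namespace NilCoxeter

theorem adjoin_s_eq_top (K : Type u) [CommRing K] :
    Algebra.adjoin K {s K (0 : Fin 3), s K (1 : Fin 3), s K (2 : Fin 3)} = ⊤ := by
  have h1 : ((RingQuot.mkAlgHom K (NilCoxeterRel 3 K)).range) = ⊤ :=
    (AlgHom.range_eq_top _).2 (RingQuot.mkAlgHom_surjective K _)
  rw [eq_top_iff, ← h1, ← Algebra.map_top, ← FreeAlgebra.adjoin_range_ι, AlgHom.map_adjoin]
  refine Algebra.adjoin_mono ?_
  rintro _ ⟨_, ⟨i, rfl⟩, rfl⟩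
  change s K i ∈ _
  fin_cases i <;> simp

theorem finite_and_finrank_le (K : Type u) [Field K] :
    Module.Finite K (NilCoxeter 3 K) ∧ Module.finrank K (NilCoxeter 3 K) ≤ 24 := by
  have hrel : ∀ {y z : FreeAlgebra K (Fin 3)}, NilCoxeterRel 3 K y z →
      RingQuot.mkAlgHom K (NilCoxeterRel 3 K) y = RingQuot.mkAlgHom K (NilCoxeterRel 3 K) z :=
    fun h => RingQuot.mkAlgHom_rel K h
  refine finite_and_finrank_le_of_nilCoxeter ?_ ?_ ?_ ?_ ?_ ?_ (adjoin_s_eq_top K)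
  · exact (map_mul _ _ _).symm.trans ((hrel (.square 0)).trans (map_zero _))
  · exact (map_mul _ _ _).symm.trans ((hrel (.square 1)).trans (map_zero _))
  · exact (map_mul _ _ _).symm.trans ((hrel (.square 2)).trans (map_zero _))
  · have h := hrel (.commute 0 2 (by decide))
    rw [map_mul, map_mul] at h
    exact h
  · have h := hrel (.braid 0 1 (by decide))
    rw [map_mul, map_mul, map_mul, map_mul] at h
    exact h
  · have h := hrel (.braid 1 2 (by decide))
    rw [map_mul, map_mul, map_mul, map_mul] at h
    exact h

/-! ### Translation invariant matrices -/

section Invariant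

open GeoMatrix DeformedFK

variable (K : Type u) [CommRing K]

theorem isBetween_mul_right (υ ω σ : S4Quiver) :
    IsBetween σ (υ * σ) (ω * σ) ↔ IsBetween 1 υ ω := by
  have h1 := S4Quiver.gdist_mul_right 1 υ σ
  have h2 := S4Quiver.gdist_mul_right υ ω σ
  have h3 := S4Quiver.gdist_mul_right 1 ω σ
  rw [one_mul] at h1 h3
  rw [IsBetween, IsBetween, h1, h2, h3]

/-- The matrix with entries one at the pairs `(σ, υ σ)`. -/
def invariantMatrix (υ : S4Quiver) : GeoMatrix K S4Quiver := fun σ τ => if τ = υ * σ then 1 else 0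

/-- Only the intermediate index `υ * σ` contributes, and whether it lies between does not depend on
`σ`. The factors appear as `ω * υ` because arrows multiply vertices on the left while paths are
composed from left to right. -/
theorem invariantMatrix_mul {υ ω : S4Quiver} (h : IsBetween 1 υ (ω * υ)) :
    invariantMatrix K υ * invariantMatrix K ω = invariantMatrix K (ω * υ) := by
  ext σ τ
  rw [GeoMatrix.mul_apply, Finset.sum_eq_single (υ * σ)]
  · have hb := (isBetween_mul_right υ (ω * υ) σ).2 h
    simp only [invariantMatrix, if_true, one_mul, ← mul_assoc]
    by_cases hτ : τ = ω * υ * σ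
    · subst hτ
      rw [if_pos hb]
    · rw [if_neg hτ, ite_self]
  · intro x _ hx
    simp [invariantMatrix, hx]
  · simp

theorem invariantMatrix_mul_of_not {υ ω : S4Quiver} (h : ¬IsBetween 1 υ (ω * υ)) :
    invariantMatrix K υ * invariantMatrix K ω = 0 := by
  ext σ τ
  rw [GeoMatrix.mul_apply]
  refine Finset.sum_eq_zero fun x _ => ?_
  split_ifs with hb
  · simp only [invariantMatrix]
    by_cases hx : x = υ * σ
    · by_cases hτ : τ = ω * x
      · subst hx hτ
        rw [← mul_assoc] at hb
        exact absurd ((isBetween_mul_right υ (ω * υ) σ).1 hb) h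
      · rw [if_neg hτ, mul_zero]
    · rw [if_neg hx, zero_mul]
  · rfl

theorem not_isBetween_t : ∀ i, ¬IsBetween 1 (S4Quiver.t i) (S4Quiver.t i * S4Quiver.t i) := by
  decide +kernel

theorem isBetween_t_t : ∀ i j : Fin 3, i ≠ j →
    IsBetween 1 (S4Quiver.t i) (S4Quiver.t j * S4Quiver.t i) := by
  decide +kernel

theorem t_commute : ∀ i j : Fin 3, (i : ℕ) + 1 < j →
    S4Quiver.t j * S4Quiver.t i = S4Quiver.t i * S4Quiver.t j := by
  decide +kernel

theorem isBetween_t_t_t : ∀ i j : Fin 3, (i : ℕ) + 1 = j →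
    IsBetween 1 (S4Quiver.t j * S4Quiver.t i) (S4Quiver.t i * (S4Quiver.t j * S4Quiver.t i)) ∧
    IsBetween 1 (S4Quiver.t i * S4Quiver.t j) (S4Quiver.t j * (S4Quiver.t i * S4Quiver.t j)) ∧
    S4Quiver.t i * (S4Quiver.t j * S4Quiver.t i) =
      S4Quiver.t j * (S4Quiver.t i * S4Quiver.t j) := by
  decide +kernel

/-- The homomorphism from the nil-Coxeter algebra onto the translation invariant matrices. -/
def toGeoMatrix : NilCoxeter 3 K →ₐ[K] GeoMatrix K S4Quiver :=
  RingQuot.liftAlgHom K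
    ⟨FreeAlgebra.lift K fun i => invariantMatrix K (S4Quiver.t i), by
      intro y z hyz
      cases hyz with
      | square i =>
        simp only [map_mul, map_zero, FreeAlgebra.lift_ι_apply]
        exact invariantMatrix_mul_of_not K (not_isBetween_t i)
      | commute i j h =>
        simp only [map_mul, FreeAlgebra.lift_ι_apply]
        rw [invariantMatrix_mul K (isBetween_t_t i j (by rintro rfl; omega)),
          invariantMatrix_mul K (isBetween_t_t j i (by rintro rfl; omega)), t_commute i j h]
      | braid i j h =>
        obtain ⟨h1, h2, h3⟩ := isBetween_t_t_t i j h
        simp only [map_mul, FreeAlgebra.lift_ι_apply]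
        rw [invariantMatrix_mul K (isBetween_t_t i j (by rintro rfl; omega)),
          invariantMatrix_mul K (isBetween_t_t j i (by rintro rfl; omega)),
          invariantMatrix_mul K h1, invariantMatrix_mul K h2, h3]⟩

theorem toGeoMatrix_s (i : Fin 3) : toGeoMatrix K (s K i) = invariantMatrix K (S4Quiver.t i) := by
  simp [toGeoMatrix, s]

theorem translate_toGeoMatrix (g : S4Quiver) (y : NilCoxeter 3 K) :
    translate K g (toGeoMatrix K y) = toGeoMatrix K y := by
  have h : (translate K g).comp (toGeoMatrix K) = toGeoMatrix K := by
    refine RingQuot.ringQuot_ext' _ _ _ (FreeAlgebra.hom_ext (funext fun i => ?_))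
    change translate K g (toGeoMatrix K (s K i)) = toGeoMatrix K (s K i)
    rw [toGeoMatrix_s]
    ext σ τ
    rw [translate_apply]
    simp [invariantMatrix, ← mul_assoc]
  exact DFunLike.congr_fun h y

theorem unit_mul_invariantMatrix (σ : S4Quiver) (i : Fin 3) :
    unit K σ σ * invariantMatrix K (S4Quiver.t i) = unit K σ (S4Quiver.t i * σ) := by
  classical
  ext x y
  rw [unit_mul_apply]
  by_cases hx : x = σ
  · subst hx
    simp [isBetween_left, invariantMatrix, unit]
  · rw [if_neg fun h => hx h.1, unit_apply_of_ne fun h => hx h.1]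

theorem unit_mul_toGeoMatrix_cons (σ : S4Quiver) (i : Fin 3) (w : List (Fin 3)) :
    unit K σ σ * toGeoMatrix K ((i :: w).map (s K)).prod =
      unit K σ (S4Quiver.t i * σ) * (unit K (S4Quiver.t i * σ) (S4Quiver.t i * σ) *
        toGeoMatrix K (w.map (s K)).prod) := by
  rw [List.map_cons, List.prod_cons, map_mul, toGeoMatrix_s, ← mul_assoc,
    unit_mul_invariantMatrix, ← mul_assoc, unit_mul_unit (isBetween_right _ _)]

/-- Matches words with paths: each letter of the word moves the row index along the arrow with that
label. For `σ = 1` it describes Ψ on words. -/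
theorem unit_mul_toGeoMatrix_word (σ : S4Quiver) (w : List (Fin 3)) :
    unit K σ σ * toGeoMatrix K (w.map (s K)).prod = ofPath K ⟨σ, S4Quiver.wordPath σ w⟩ := by
  induction w generalizing σ with
  | nil =>
    rw [List.map_nil, List.prod_nil, map_one, mul_one]
    exact (ofPath_nil σ).symm
  | cons i w ih =>
    rw [unit_mul_toGeoMatrix_cons, ih]
    have h1 : unit K σ (S4Quiver.t i * σ) =
        ofPath K ⟨σ, S4Quiver.t i * σ, (S4Quiver.edge σ i).toPath⟩ := by
      rw [ofPath, if_pos]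
      exact (S4Quiver.gdist_t_mul σ i).symm
    rw [h1]
    exact ofPath_mul S4Quiver.isGeodesicQuiver _ _

theorem exists_word (σ τ : S4Quiver) :
    ∃ w : List (Fin 3), unit K σ σ * toGeoMatrix K (w.map (s K)).prod = unit K σ τ := by
  induction hn : gdist σ τ generalizing σ with
  | zero =>
    obtain rfl := eq_of_gdist_eq_zero hn
    exact ⟨[], by simp⟩
  | succ n ih =>
    obtain ⟨υ, h1, h2⟩ := exists_step (σ := σ) (τ := τ) (by
      rintro rfl; rw [gdist_self] at hn; omega)
    obtain ⟨⟨i, rfl⟩⟩ := (S4Quiver.isGeodesicQuiver.nonempty_iff σ υ).2 h1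
    obtain ⟨w, hw⟩ := ih (S4Quiver.t i * σ) (by omega)
    exact ⟨i :: w, by rw [unit_mul_toGeoMatrix_cons, hw, unit_mul_unit h2]⟩

end Invariant

/-! ### The row at the identity as a model of the nil-Coxeter algebra -/

section Row

open GeoMatrix

variable (K : Type u) [Field K]

/-- The row of the image of an element of the nil-Coxeter algebra at the identity. -/
def rowMap : NilCoxeter 3 K →ₗ[K] (S4Quiver → K) :=
  (LinearMap.pi fun τ => entry 1 τ) ∘ₗ (toGeoMatrix K).toLinearMap

theorem rowMap_apply (y : NilCoxeter 3 K) (τ : S4Quiver) :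
    rowMap K y τ = toGeoMatrix K y 1 τ := rfl

theorem unit_mul_row (F : GeoMatrix K S4Quiver) (τ : S4Quiver) :
    (unit K 1 1 * F : GeoMatrix K S4Quiver) 1 τ = F 1 τ := by
  classical
  rw [unit_mul_apply, if_pos ⟨rfl, isBetween_left _ _⟩]

theorem rowMap_surjective : Function.Surjective (rowMap K) := by
  rw [← LinearMap.range_eq_top, ← top_le_iff, ← (Pi.basisFun K S4Quiver).span_eq,
    Submodule.span_le]
  rintro _ ⟨τ, rfl⟩
  obtain ⟨w, hw⟩ := exists_word K 1 τ
  refine ⟨(w.map (s K)).prod, funext fun υ => ?_⟩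
  have hrow := unit_mul_row K (toGeoMatrix K (w.map (s K)).prod) υ
  rw [hw] at hrow
  rw [Pi.basisFun_apply]
  refine hrow.symm.trans ?_
  by_cases h : υ = τ
  · subst h; simp
  · rw [unit_apply_of_ne fun h' => h h'.2, Pi.single_eq_of_ne h]

/-- The row has 24 entries and the nil-Coxeter algebra has dimension at most 24, so surjectivity
suffices. -/
theorem rowMap_injective : Function.Injective (rowMap K) := by
  obtain ⟨hfin, hrank⟩ := finite_and_finrank_le K
  have hsurj := rowMap_surjective K
  have hcard : Module.finrank K (S4Quiver → K) = 24 := by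
    rw [Module.finrank_fintype_fun_eq_card, show Fintype.card S4Quiver =
      Fintype.card (Equiv.Perm (Fin 4)) from rfl, Fintype.card_perm]
    rfl
  have hge := LinearMap.finrank_le_finrank_of_surjective hsurj
  exact (LinearMap.injective_iff_surjective_of_finrank_eq_finrank (by omega)).2 hsurj

end Row

end NilCoxeter

/-! ### The projective module at the identity -/

namespace DeformedFK

open GeoMatrix

variable {K : Type u} [Field K] [CharZero K] {a b : K} (ha : a ≠ 0) (hb : b ^ 2 = a)

/-- The presentation of `𝒟₄(a, -a)` by the quiver on `𝕊₄`. -/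
def presentation : PathAlgebra K S4Quiver →ₐ[K] DeformedFK 4 K a (-a) :=
  (equivGeoMatrix ha hb).symm.toAlgHom.comp (ofPathHom K S4Quiver.isGeodesicQuiver)

theorem presentation_of (p : AnyPath S4Quiver) :
    presentation ha hb (PathAlgebra.of K p) = (equivGeoMatrix ha hb).symm (ofPath K p) :=
  congrArg (equivGeoMatrix ha hb).symm (ofPathHom_of S4Quiver.isGeodesicQuiver p)

theorem presentation_vertex (σ : S4Quiver) :
    presentation ha hb (PathAlgebra.vertex K σ) = (equivGeoMatrix ha hb).symm (unit K σ σ) :=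
  congrArg (equivGeoMatrix ha hb).symm (ofPathHom_vertex S4Quiver.isGeodesicQuiver σ)

theorem presentation_edge (σ : S4Quiver) (i : Fin 3) :
    presentation ha hb (PathAlgebra.arrow K (S4Quiver.edge σ i)) =
      (equivGeoMatrix ha hb).symm (unit K σ (S4Quiver.t i * σ)) :=
  congrArg (equivGeoMatrix ha hb).symm
    (ofPathHom_arrow S4Quiver.isGeodesicQuiver (S4Quiver.edge σ i))

/-- The idempotent at the vertex `1`. -/
def idemOne : DeformedFK 4 K a (-a) := (equivGeoMatrix ha hb).symm (unit K 1 1)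

theorem idemOne_mul_self : idemOne ha hb * idemOne ha hb = idemOne ha hb :=
  symm_unit_mul _ (isBetween_left _ _)

theorem idemOne_ne_zero : idemOne ha hb ≠ 0 := by
  intro h
  have h1 := congrArg (fun y => equivGeoMatrix ha hb y 1 1) h
  simp [idemOne] at h1

theorem idemOne_mul_mul (y : DeformedFK 4 K a (-a)) :
    ∃ c : K, idemOne ha hb * y * idemOne ha hb = c • idemOne ha hb := by
  classical
  refine ⟨equivGeoMatrix ha hb y 1 1, (equivGeoMatrix ha hb).injective ?_⟩
  rw [map_mul, map_mul, map_smul, idemOne, AlgEquiv.apply_symm_apply]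
  ext σ τ
  rw [mul_unit_apply, unit_mul_apply, GeoMatrix.smul_apply]
  by_cases h : σ = 1 ∧ τ = 1
  · obtain ⟨rfl, rfl⟩ := h
    simp [isBetween_left]
  · rw [unit_apply_of_ne h, mul_zero]
    by_cases hσ : σ = 1
    · rw [if_neg fun h' => h ⟨hσ, h'.1⟩]
    · rw [if_neg fun h' : σ = 1 ∧ _ => hσ h'.1, ite_self]

/-- The right ideal generated by the idempotent at the vertex `1`. -/
def rightIdeal : Submodule (DeformedFK 4 K a (-a))ᵐᵒᵖ (DeformedFK 4 K a (-a)) :=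
  Submodule.span _ {idemOne ha hb}

/-- The linear map from the nil-Coxeter algebra to the right ideal at the vertex `1`. -/
def toRightIdeal : NilCoxeter 3 K →ₗ[K] rightIdeal ha hb where
  toFun y := ⟨idemOne ha hb * (equivGeoMatrix ha hb).symm (NilCoxeter.toGeoMatrix K y),
    (mem_span_idempotent_iff (idemOne_mul_self ha hb)).2
      (by rw [← mul_assoc, idemOne_mul_self])⟩
  map_add' y z := Subtype.ext (show idemOne ha hb * (equivGeoMatrix ha hb).symm
      (NilCoxeter.toGeoMatrix K (y + z)) =
      idemOne ha hb * (equivGeoMatrix ha hb).symm (NilCoxeter.toGeoMatrix K y) +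
      idemOne ha hb * (equivGeoMatrix ha hb).symm (NilCoxeter.toGeoMatrix K z) by
    rw [map_add, map_add, mul_add])
  map_smul' c y := Subtype.ext (show idemOne ha hb * (equivGeoMatrix ha hb).symm
      (NilCoxeter.toGeoMatrix K (c • y)) =
      c • (idemOne ha hb * (equivGeoMatrix ha hb).symm (NilCoxeter.toGeoMatrix K y)) by
    rw [map_smul, map_smul, mul_smul_comm])

theorem toRightIdeal_apply (y : NilCoxeter 3 K) : (toRightIdeal ha hb y : DeformedFK 4 K a (-a)) =
    (equivGeoMatrix ha hb).symm (unit K 1 1 * NilCoxeter.toGeoMatrix K y) :=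
  (map_mul (equivGeoMatrix ha hb).symm _ _).symm

theorem equivGeoMatrix_toRightIdeal (y : NilCoxeter 3 K) (τ : S4Quiver) :
    equivGeoMatrix ha hb (toRightIdeal ha hb y) 1 τ = NilCoxeter.rowMap K y τ := by
  rw [toRightIdeal_apply, AlgEquiv.apply_symm_apply, NilCoxeter.unit_mul_row,
    NilCoxeter.rowMap_apply]

theorem toRightIdeal_bijective : Function.Bijective (toRightIdeal ha hb) := by
  classical
  constructor
  · intro y z h
    refine NilCoxeter.rowMap_injective K (funext fun τ => ?_)
    rw [← equivGeoMatrix_toRightIdeal ha hb, h, equivGeoMatrix_toRightIdeal]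
  · intro x
    obtain ⟨y, hy⟩ := NilCoxeter.rowMap_surjective K (equivGeoMatrix ha hb x 1)
    refine ⟨y, Subtype.ext ((equivGeoMatrix ha hb).injective ?_)⟩
    have hx := (mem_span_idempotent_iff (idemOne_mul_self ha hb)).1 x.2
    -- Elements of the right ideal are determined by their row at the identity, since multiplying by
    -- the idempotent on the left clears all other rows.
    rw [← hx, map_mul, toRightIdeal_apply, idemOne, AlgEquiv.apply_symm_apply,
      AlgEquiv.apply_symm_apply]
    ext σ τ
    rw [unit_mul_apply, unit_mul_apply, ← NilCoxeter.rowMap_apply, hy]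

/-- The action of `σ` moves the row at the identity to the row at `σ⁻¹` and fixes invariant
matrices. Summing over `σ` therefore restores the whole invariant matrix from its one row. -/
theorem sum_act_toRightIdeal (z : NilCoxeter 3 K) :
    ∑ σ : S4Quiver, act σ.perm (toRightIdeal ha hb z : DeformedFK 4 K a (-a)) =
      (equivGeoMatrix ha hb).symm (NilCoxeter.toGeoMatrix K z) := by
  have h1 : ∀ σ : S4Quiver, act σ.perm (toRightIdeal ha hb z : DeformedFK 4 K a (-a)) =
      (equivGeoMatrix ha hb).symm (unit K σ⁻¹ σ⁻¹ * NilCoxeter.toGeoMatrix K z) := fun σ => by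
    rw [toRightIdeal_apply, act_symm, map_mul, translate_unit, NilCoxeter.translate_toGeoMatrix,
      one_mul]
  have h2 : ∑ σ : S4Quiver, unit K σ⁻¹ σ⁻¹ = 1 :=
    (Equiv.sum_comp (Equiv.inv S4Quiver) fun σ => unit K σ σ).trans sum_unit
  rw [Finset.sum_congr rfl fun σ _ => h1 σ, ← map_sum, ← Finset.sum_mul, h2, one_mul]

end DeformedFK

end

/-! ### The theorem -/

theorem proposition2p13 {K : Type u} [Field K] [IsAlgClosed K] [CharZero K]
    (a b : K) (ha : a ≠ 0) (hb : b ^ 2 = a) :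
    IsOrdinaryQuiver (fun σ : S4Quiver => DeformedFK.rho hb σ.perm) ∧
    ∃ φ : PathAlgebra K S4Quiver →ₐ[K] DeformedFK 4 K a (-a),
      IsGabrielPresentation (fun σ : S4Quiver => DeformedFK.rho hb σ.perm) φ ∧
      (∀ σ τ : S4Quiver,
        φ (PathAlgebra.vertex K (τ * σ⁻¹)) =
          DeformedFK.act σ.perm (φ (PathAlgebra.vertex K τ))) ∧
      (∀ (σ τ : S4Quiver) (i : Fin 3),
        φ (PathAlgebra.arrow K (S4Quiver.edge (τ * σ⁻¹) i)) =
          DeformedFK.act σ.perm (φ (PathAlgebra.arrow K (S4Quiver.edge τ i)))) ∧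
      ∃ Γ : Submodule (DeformedFK 4 K a (-a))ᵐᵒᵖ (DeformedFK 4 K a (-a)),
        Γ = Submodule.span _ {φ (PathAlgebra.vertex K (1 : S4Quiver))} ∧
        Module.Projective (DeformedFK 4 K a (-a))ᵐᵒᵖ Γ ∧
        IsIndecomposableModule (DeformedFK 4 K a (-a))ᵐᵒᵖ Γ ∧
        ∃ Ψ : NilCoxeter 3 K ≃ₗ[K] Γ,
          (Ψ 1 : DeformedFK 4 K a (-a)) = φ (PathAlgebra.vertex K (1 : S4Quiver)) ∧
          (∀ y z : NilCoxeter 3 K, (Ψ (y * z) : DeformedFK 4 K a (-a)) =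
            Ψ y * ∑ σ : S4Quiver, DeformedFK.act σ.perm (Ψ z : DeformedFK 4 K a (-a))) ∧
          (∀ w : List (Fin 3),
            (Ψ (w.map (NilCoxeter.s K)).prod : DeformedFK 4 K a (-a)) =
              φ (PathAlgebra.of K ⟨1, S4Quiver.wordPath 1 w⟩)) := by
  have hS : ∀ (σ : S4Quiver) y,
      DeformedFK.rho hb σ.perm y = DeformedFK.equivGeoMatrix ha hb y σ σ :=
    DeformedFK.rho_apply ha hb
  refine ⟨GeoMatrix.isOrdinaryQuiver (DeformedFK.equivGeoMatrix ha hb) S4Quiver.isGeodesicQuiver hS,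
    DeformedFK.presentation ha hb,
    GeoMatrix.isGabrielPresentation S4Quiver.isGeodesicQuiver (DeformedFK.equivGeoMatrix ha hb) hS,
    fun σ τ => ?_, fun σ τ i => ?_, DeformedFK.rightIdeal ha hb, ?_, ?_, ?_,
    LinearEquiv.ofBijective (DeformedFK.toRightIdeal ha hb)
      (DeformedFK.toRightIdeal_bijective ha hb), ?_,
    fun y z => ?_, fun w => ?_⟩
  · rw [DeformedFK.presentation_vertex, DeformedFK.presentation_vertex, DeformedFK.act_symm,
      DeformedFK.translate_unit]
  · rw [DeformedFK.presentation_edge, DeformedFK.presentation_edge, DeformedFK.act_symm,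
      DeformedFK.translate_unit, mul_assoc]
  · rw [DeformedFK.presentation_vertex]
    rfl
  · exact projective_span_idempotent (DeformedFK.idemOne_mul_self ha hb)
  · exact isIndecomposableModule_span_idempotent (DeformedFK.idemOne_mul_self ha hb)
      (DeformedFK.idemOne_ne_zero ha hb) (DeformedFK.idemOne_mul_mul ha hb)
  · rw [LinearEquiv.ofBijective_apply, DeformedFK.toRightIdeal_apply,
      DeformedFK.presentation_vertex, map_one, mul_one]
  -- Once the sum over the group is replaced by the invariant matrix of `z`, both sides are the
  -- idempotent times the product of the invariant matrices of `y` and `z`.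
  · rw [LinearEquiv.ofBijective_apply, LinearEquiv.ofBijective_apply,
      LinearEquiv.ofBijective_apply, DeformedFK.sum_act_toRightIdeal, DeformedFK.toRightIdeal_apply,
      DeformedFK.toRightIdeal_apply,
      ← map_mul (DeformedFK.equivGeoMatrix ha hb).symm, mul_assoc,
      ← map_mul (NilCoxeter.toGeoMatrix K)]
  · rw [LinearEquiv.ofBijective_apply, DeformedFK.toRightIdeal_apply, DeformedFK.presentation_of,
      NilCoxeter.unit_mul_toGeoMatrix_word]
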